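/- For every $\gamma>0$ there is a constant $\delta=\delta(\gamma)>0$ such that for every integer $r\ge 3$ the following holds. If $k$-HyperPath in undirected $r$-uniform hypergraphs can be solved in time $O^*\big(2^{(1-\frac1{r-1}-\gamma)k}\big)$, then Exact Cover on $n$ elements can be solved in time $O^*\big(2^{(1-\delta)n}\big)$. Here $k$-HyperPath is the following decision problem: given an $r$-uniform hypergraph $H=(V,E)$ and an integer $k\geq 0$, is there a tight path on $k$ nodes, i.e. a sequence of $k$ distinct nodes of $H$ such that every $r$ consecutive ones constitute a hyperedge? Exact Cover is the following decision problem: given a ground set $U$ with $n$ elements and a family $\mathcal S\subseteq 2^U$ of $m$ sets, is there a subfamily of $\mathcal S$ that consists of pairwise disjoint sets and has union $U$? "Solved" means by a deterministic algorithm on a random access machine with logarithmic cost, and $O^*$ suppresses factors that are polynomial in the size of the instance, which is $|V|+|E|+k$ for $k$-HyperPath and $n+m$ for Exact Cover (the degree of the polynomial may depend on $\gamma$, on $r$ and on the algorithm). -/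

import Mathlib

/-! ## Random access machines with logarithmic cost

Since running times `O*(2 ^ (α k))` with exact constants `α` in the exponent are compared, the model
has to be a random access machine: passing from a random access machine to a Turing machine costs
more than a factor polynomial in the input size.  The model is the usual one with logarithmic cost:
registers and array cells hold natural numbers, arrays are addressed indirectly, and an operation is
charged the bit lengths of all numbers (addresses included) that it touches.  A program mentions
only finitely many registers and arrays; control flow is written with `if` and `while`. -/

namespace RAM

/-- The memory: registers `reg x` and arrays `arr a`, each cell holding a natural number. -/
structure State where
  reg : ℕ → ℕ
  arr : ℕ → ℕ → ℕ

/-- Expressions.  Subtraction is truncated at `0`, division is integer division (and `x / 0 = 0`). -/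
inductive Expr where
  | const (c : ℕ)
  | var (x : ℕ)
  | load (a : ℕ) (i : Expr)
  | add (e₁ e₂ : Expr)
  | sub (e₁ e₂ : Expr)
  | mul (e₁ e₂ : Expr)
  | div (e₁ e₂ : Expr)

/-- Programs. -/
inductive Prog where
  | skip
  | assign (x : ℕ) (e : Expr)
  | store (a : ℕ) (i e : Expr)
  | seq (p q : Prog)
  | ite (e : Expr) (p q : Prog)
  | while (e : Expr) (p : Prog)

/-- The charge for handling the number `v`: its bit length plus one. -/
def logCost (v : ℕ) : ℕ := Nat.size v + 1

/-- The value of an expression. -/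
def Expr.eval (s : State) : Expr → ℕ
  | .const c => c
  | .var x => s.reg x
  | .load a i => s.arr a (i.eval s)
  | .add e₁ e₂ => e₁.eval s + e₂.eval s
  | .sub e₁ e₂ => e₁.eval s - e₂.eval s
  | .mul e₁ e₂ => e₁.eval s * e₂.eval s
  | .div e₁ e₂ => e₁.eval s / e₂.eval s

/-- The time needed to evaluate an expression: every number that occurs is charged. -/
def Expr.cost (s : State) : Expr → ℕ
  | .const c => logCost c
  | .var x => logCost (s.reg x)
  | .load a i => i.cost s + logCost (s.arr a (i.eval s))
  | .add e₁ e₂ => e₁.cost s + e₂.cost s + logCost (e₁.eval s + e₂.eval s)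
  | .sub e₁ e₂ => e₁.cost s + e₂.cost s + logCost (e₁.eval s - e₂.eval s)
  | .mul e₁ e₂ => e₁.cost s + e₂.cost s + logCost (e₁.eval s * e₂.eval s)
  | .div e₁ e₂ => e₁.cost s + e₂.cost s + logCost (e₁.eval s / e₂.eval s)

/-- Write the value `v` into register `x`. -/
def State.setReg (s : State) (x v : ℕ) : State :=
  { s with reg := Function.update s.reg x v }

/-- Write the value `v` into cell `i` of array `a`. -/
def State.setArr (s : State) (a i v : ℕ) : State :=
  { s with arr := Function.update s.arr a (Function.update (s.arr a) i v) }

/-- `Exec p s s' t`: started in memory state `s`, the program `p` halts in memory state `s'` after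
exactly `t` units of time. -/
inductive Exec : Prog → State → State → ℕ → Prop where
  | skip (s : State) : Exec .skip s s 1
  | assign (s : State) (x : ℕ) (e : Expr) :
      Exec (.assign x e) s (s.setReg x (e.eval s)) (e.cost s + 1)
  | store (s : State) (a : ℕ) (i e : Expr) :
      Exec (.store a i e) s (s.setArr a (i.eval s) (e.eval s)) (i.cost s + e.cost s + 1)
  | seq {p q : Prog} {s s₁ s₂ : State} {t₁ t₂ : ℕ} (hp : Exec p s s₁ t₁) (hq : Exec q s₁ s₂ t₂) :
      Exec (.seq p q) s s₂ (t₁ + t₂)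
  | ite_true {e : Expr} {p q : Prog} {s s' : State} {t : ℕ} (he : e.eval s ≠ 0)
      (hp : Exec p s s' t) : Exec (.ite e p q) s s' (e.cost s + t)
  | ite_false {e : Expr} {p q : Prog} {s s' : State} {t : ℕ} (he : e.eval s = 0)
      (hq : Exec q s s' t) : Exec (.ite e p q) s s' (e.cost s + t)
  | while_done {e : Expr} {p : Prog} {s : State} (he : e.eval s = 0) :
      Exec (.while e p) s s (e.cost s)
  | while_step {e : Expr} {p : Prog} {s s₁ s₂ : State} {t₁ t₂ : ℕ} (he : e.eval s ≠ 0)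
      (hp : Exec p s s₁ t₁) (hw : Exec (.while e p) s₁ s₂ t₂) :
      Exec (.while e p) s s₂ (e.cost s + t₁ + t₂)

/-- The initial memory on input `w`: array `0` holds `w`, everything else is `0`. -/
def State.init (w : List ℕ) : State where
  reg := fun _ => 0
  arr := fun a i => if a = 0 then w.getD i 0 else 0

end RAM

/-- The decision problem with instances `ι`, encodings `enc w x` ("the word `w` is a presentation of
the instance `x`") and yes-instances `yes` can be solved in time `O*(f)`: a fixed program halts on
each presentation of each instance `x` within time `C * (size x + 1) ^ c * f x`, with constants `C`
and `c`, and then register `0` is nonzero exactly if `x` is a yes-instance. -/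
def SolvableInOStar {ι : Type} (enc : List ℕ → ι → Prop) (yes : ι → Prop) (size : ι → ℕ)
    (f : ι → ℝ) : Prop :=
  ∃ (p : RAM.Prog) (C c : ℕ), ∀ (x : ι) (w : List ℕ), enc w x →
    ∃ (s : RAM.State) (t : ℕ), RAM.Exec p (RAM.State.init w) s t ∧
      (s.reg 0 ≠ 0 ↔ yes x) ∧ (t : ℝ) ≤ C * ((size x : ℝ) + 1) ^ c * f x

/-! ## Tight paths in uniform hypergraphs -/

/-- An undirected `r`-uniform hypergraph on the vertex set `V`. -/
structure UniformHypergraph (V : Type) (r : ℕ) where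
  edges : Finset (Finset V)
  card_eq : ∀ e ∈ edges, e.card = r

/-- `v 0, …, v (k - 1)` is a tight path: the nodes are distinct and every `r` consecutive ones
constitute a hyperedge. -/
def UniformHypergraph.IsTightPath {V : Type} [DecidableEq V] {r k : ℕ} (H : UniformHypergraph V r)
    (v : Fin k → V) : Prop :=
  Function.Injective v ∧ ∀ (i : ℕ) (hi : i + r ≤ k),
    (Finset.univ.image fun j : Fin r => v ⟨i + j, by have := j.isLt; omega⟩) ∈ H.edges

/-- An instance of the `k`-HyperPath problem: an `r`-uniform hypergraph on `numVerts` nodes, and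
the number `k`. -/
structure HyperPathInstance (r : ℕ) where
  numVerts : ℕ
  graph : UniformHypergraph (Fin numVerts) r
  k : ℕ

namespace HyperPathInstance

variable {r : ℕ}

/-- Yes-instances: there is a tight path on `k` nodes. -/
def Yes (I : HyperPathInstance r) : Prop :=
  ∃ v : Fin I.k → Fin I.numVerts, I.graph.IsTightPath v

/-- Number of nodes plus number of hyperedges plus `k`. -/
def size (I : HyperPathInstance r) : ℕ := I.numVerts + I.graph.edges.card + I.k

/-- Presentations: the number of nodes, the number of hyperedges, `k`, and then the hyperedges,
each given once by its `r` nodes, in any order. -/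
def Enc (w : List ℕ) (I : HyperPathInstance r) : Prop :=
  ∃ L : List (List (Fin I.numVerts)), (∀ l ∈ L, l.Nodup) ∧ (L.map List.toFinset).Nodup ∧
    (L.map List.toFinset).toFinset = I.graph.edges ∧
    w = [I.numVerts, L.length, I.k] ++ L.flatten.map Fin.val

end HyperPathInstance

/-- `k`-HyperPath in undirected `r`-uniform hypergraphs can be solved in time `O*(2 ^ (α k))`. -/
def HyperPathSolvable (r : ℕ) (α : ℝ) : Prop :=
  SolvableInOStar (ι := HyperPathInstance r) HyperPathInstance.Enc HyperPathInstance.Yes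
    HyperPathInstance.size (fun I => (2 : ℝ) ^ (α * (I.k : ℝ)))

/-! ## Exact Cover -/

/-- An instance of Exact Cover: a ground set of `n` elements and a family of subsets of it. -/
structure ExactCoverInstance where
  n : ℕ
  family : Finset (Finset (Fin n))

namespace ExactCoverInstance

/-- Yes-instances: some subfamily consists of pairwise disjoint sets whose union is the whole
ground set. -/
def Yes (I : ExactCoverInstance) : Prop :=
  ∃ T ⊆ I.family, (∀ A ∈ T, ∀ B ∈ T, A ≠ B → Disjoint A B) ∧ ∀ x : Fin I.n, ∃ A ∈ T, x ∈ A

/-- Number of elements plus number of sets. -/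
def size (I : ExactCoverInstance) : ℕ := I.n + I.family.card

/-- Presentations: the number of elements, the number of sets, and then the sets, each given once,
by its cardinality followed by its elements, in any order. -/
def Enc (w : List ℕ) (I : ExactCoverInstance) : Prop :=
  ∃ L : List (List (Fin I.n)), (∀ l ∈ L, l.Nodup) ∧ (L.map List.toFinset).Nodup ∧
    (L.map List.toFinset).toFinset = I.family ∧
    w = [I.n, L.length] ++ (L.map fun l => l.length :: l.map Fin.val).flatten

end ExactCoverInstance

/-- Exact Cover on `n` elements can be solved in time `O*(2 ^ (β n))`. -/
def ExactCoverSolvable (β : ℝ) : Prop :=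
  SolvableInOStar ExactCoverInstance.Enc ExactCoverInstance.Yes ExactCoverInstance.size
    (fun I => (2 : ℝ) ^ (β * (I.n : ℝ)))

/-! Put `r = d + 2`.  The elements of the sets of an Exact Cover instance are listed set after set
as tokens, and a cover becomes a sequence of `n` tokens with distinct labels in which every set that
is started is completed.  The hypergraph has the elements as nodes, together with one state node for
every position of a block boundary and every choice of the tokens in the two blocks of `d` positions
around it; these are polynomially many, as `d` is fixed.  A tight path alternates blocks of `d`
element nodes with single state nodes, since every `d + 2` consecutive nodes contain a state.  That
consecutive states agree on the block between them is a local condition, and no element is covered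
twice because the nodes of a path are distinct.  Padding at both ends of the sequence takes care of
the unknown position and direction of the path.  The path has `k = (1 + 1 / d) n + O(d)` nodes, and
`1 - 1 / (r - 1) = d / (d + 1)` turns the exponent `(1 - 1 / (r - 1) - γ) k` into at most
`(1 - γ) n + O(d)`. -/

/-! ## Polynomially bounded functions -/

/-- `f` is bounded by a polynomial in `size`. -/
def PolyBounded {ι : Type*} (size f : ι → ℕ) : Prop :=
  ∃ K c : ℕ, ∀ x, f x ≤ K * (size x + 1) ^ c

namespace PolyBounded

variable {ι : Type*} {size f g : ι → ℕ}

theorem const (size : ι → ℕ) (a : ℕ) : PolyBounded size fun _ => a :=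
  ⟨a, 0, fun x => by simp⟩

theorem self (size : ι → ℕ) : PolyBounded size size :=
  ⟨1, 1, fun x => by simp⟩

theorem mono (hg : PolyBounded size g) (h : ∀ x, f x ≤ g x) : PolyBounded size f := by
  obtain ⟨K, c, H⟩ := hg
  exact ⟨K, c, fun x => (h x).trans (H x)⟩

theorem add (hf : PolyBounded size f) (hg : PolyBounded size g) :
    PolyBounded size fun x => f x + g x := by
  obtain ⟨K, c, H⟩ := hf
  obtain ⟨K', c', H'⟩ := hg
  refine ⟨K + K', c + c', fun x => ?_⟩
  have h1 : (size x + 1) ^ c ≤ (size x + 1) ^ (c + c') :=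
    Nat.pow_le_pow_right (Nat.succ_pos _) (by omega)
  have h2 : (size x + 1) ^ c' ≤ (size x + 1) ^ (c + c') :=
    Nat.pow_le_pow_right (Nat.succ_pos _) (by omega)
  calc f x + g x ≤ K * (size x + 1) ^ c + K' * (size x + 1) ^ c' := Nat.add_le_add (H x) (H' x)
    _ ≤ K * (size x + 1) ^ (c + c') + K' * (size x + 1) ^ (c + c') := by gcongr
    _ = _ := by ring

theorem mul (hf : PolyBounded size f) (hg : PolyBounded size g) :
    PolyBounded size fun x => f x * g x := by
  obtain ⟨K, c, H⟩ := hf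
  obtain ⟨K', c', H'⟩ := hg
  refine ⟨K * K', c + c', fun x => ?_⟩
  calc f x * g x ≤ (K * (size x + 1) ^ c) * (K' * (size x + 1) ^ c') := Nat.mul_le_mul (H x) (H' x)
    _ = _ := by ring

theorem pow (hf : PolyBounded size f) (a : ℕ) : PolyBounded size fun x => f x ^ a := by
  induction a with
  | zero => simpa using const size 1
  | succ a ih => simpa [pow_succ] using ih.mul hf

theorem comp {h : ℕ → ℕ} (hh : PolyBounded id h) (hf : PolyBounded size f) :
    PolyBounded size fun x => h (f x) := by
  obtain ⟨K, c, H⟩ := hh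
  exact mono ((const size K).mul ((hf.add (const size 1)).pow c)) fun x => by simpa using H (f x)

end PolyBounded

namespace RAM

theorem State.reg_setReg (s : State) (x v y : ℕ) :
    (s.setReg x v).reg y = if y = x then v else s.reg y :=
  Function.update_apply ..

theorem State.arr_setReg (s : State) (x v : ℕ) : (s.setReg x v).arr = s.arr := rfl

theorem State.reg_setArr (s : State) (a i v : ℕ) : (s.setArr a i v).reg = s.reg := rfl

theorem State.arr_setArr (s : State) (a i v b : ℕ) :
    (s.setArr a i v).arr b = if b = a then Function.update (s.arr a) i v else s.arr b :=
  Function.update_apply ..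

theorem logCost_le (v : ℕ) : logCost v ≤ v + 1 := by
  have : Nat.size v ≤ v := Nat.size_le.2 v.lt_two_pow_self
  unfold logCost; omega

/-- All registers and all array cells hold numbers that are at most `B`. -/
def State.BoundedBy (B : ℕ) (s : State) : Prop :=
  (∀ x, s.reg x ≤ B) ∧ ∀ a i, s.arr a i ≤ B

/-- A bound for the value of an expression in a memory bounded by `B`. -/
def Expr.valueBound (B : ℕ) : Expr → ℕ
  | .const c => c
  | .var _ => B
  | .load _ _ => B
  | .add e₁ e₂ => e₁.valueBound B + e₂.valueBound B
  | .sub e₁ _ => e₁.valueBound B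
  | .mul e₁ e₂ => e₁.valueBound B * e₂.valueBound B
  | .div e₁ _ => e₁.valueBound B

/-- A bound for the cost of an expression in a memory bounded by `B`. -/
def Expr.costBound (B : ℕ) : Expr → ℕ
  | .const c => c + 1
  | .var _ => B + 1
  | .load _ i => i.costBound B + (B + 1)
  | .add e₁ e₂ => e₁.costBound B + e₂.costBound B + (e₁.valueBound B + e₂.valueBound B + 1)
  | .sub e₁ e₂ => e₁.costBound B + e₂.costBound B + (e₁.valueBound B + 1)
  | .mul e₁ e₂ => e₁.costBound B + e₂.costBound B + (e₁.valueBound B * e₂.valueBound B + 1)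
  | .div e₁ e₂ => e₁.costBound B + e₂.costBound B + (e₁.valueBound B + 1)

theorem Expr.eval_le_valueBound {B : ℕ} {s : State} (hs : s.BoundedBy B) (e : Expr) :
    e.eval s ≤ e.valueBound B := by
  induction e with
  | const c => exact le_rfl
  | var x => exact hs.1 x
  | load a i _ => exact hs.2 a _
  | add e₁ e₂ h₁ h₂ => exact Nat.add_le_add h₁ h₂
  | sub e₁ e₂ h₁ _ => exact (Nat.sub_le _ _).trans h₁
  | mul e₁ e₂ h₁ h₂ => exact Nat.mul_le_mul h₁ h₂
  | div e₁ e₂ h₁ _ => exact (Nat.div_le_self _ _).trans h₁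

theorem Expr.cost_le_costBound {B : ℕ} {s : State} (hs : s.BoundedBy B) (e : Expr) :
    e.cost s ≤ e.costBound B := by
  have key : ∀ {v b : ℕ}, v ≤ b → logCost v ≤ b + 1 := fun h => (logCost_le _).trans (by omega)
  induction e with
  | const c => exact key le_rfl
  | var x => exact key (hs.1 x)
  | load a i h => exact Nat.add_le_add h (key (hs.2 a _))
  | add e₁ e₂ h₁ h₂ =>
    exact Nat.add_le_add (Nat.add_le_add h₁ h₂) (key ((Expr.add e₁ e₂).eval_le_valueBound hs))
  | sub e₁ e₂ h₁ h₂ =>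
    exact Nat.add_le_add (Nat.add_le_add h₁ h₂) (key ((Expr.sub e₁ e₂).eval_le_valueBound hs))
  | mul e₁ e₂ h₁ h₂ =>
    exact Nat.add_le_add (Nat.add_le_add h₁ h₂) (key ((Expr.mul e₁ e₂).eval_le_valueBound hs))
  | div e₁ e₂ h₁ h₂ =>
    exact Nat.add_le_add (Nat.add_le_add h₁ h₂) (key ((Expr.div e₁ e₂).eval_le_valueBound hs))

theorem Expr.polyBounded_valueBound (e : Expr) : PolyBounded id fun B => e.valueBound B := by
  induction e with
  | const c => exact .const _ c
  | var _ => exact .self _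
  | load _ _ _ => exact .self _
  | add e₁ e₂ h₁ h₂ => exact h₁.add h₂
  | sub _ _ h₁ _ => exact h₁
  | mul e₁ e₂ h₁ h₂ => exact h₁.mul h₂
  | div _ _ h₁ _ => exact h₁

theorem Expr.polyBounded_costBound (e : Expr) : PolyBounded id fun B => e.costBound B := by
  have one : PolyBounded (id : ℕ → ℕ) fun _ => 1 := .const _ 1
  induction e with
  | const c => exact .const _ (c + 1)
  | var _ => exact (PolyBounded.self _).add one
  | load _ i h => exact h.add ((PolyBounded.self _).add one)
  | add e₁ e₂ h₁ h₂ =>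
    exact (h₁.add h₂).add ((e₁.polyBounded_valueBound.add e₂.polyBounded_valueBound).add one)
  | sub e₁ e₂ h₁ h₂ => exact (h₁.add h₂).add (e₁.polyBounded_valueBound.add one)
  | mul e₁ e₂ h₁ h₂ =>
    exact (h₁.add h₂).add ((e₁.polyBounded_valueBound.mul e₂.polyBounded_valueBound).add one)
  | div e₁ e₂ h₁ h₂ => exact (h₁.add h₂).add (e₁.polyBounded_valueBound.add one)

/-! ## Total correctness with polynomial running time -/

/-- A predicate transformer: from memory `s`, the program halts in a memory that satisfies `Q`,
every number written is at most `B`, and every loop is run at most `B` times. -/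
def Prog.WP (B : ℕ) : Prog → (State → Prop) → State → Prop
  | .skip, Q, s => Q s
  | .assign x e, Q, s => e.eval s ≤ B ∧ Q (s.setReg x (e.eval s))
  | .store a i e, Q, s => e.eval s ≤ B ∧ Q (s.setArr a (i.eval s) (e.eval s))
  | .seq p q, Q, s => p.WP B (q.WP B Q) s
  | .ite e p q, Q, s => (e.eval s ≠ 0 → p.WP B Q s) ∧ (e.eval s = 0 → q.WP B Q s)
  | .while e p, Q, s => ∃ N ≤ B, ∃ I : ℕ → State → Prop, I 0 s ∧
      (∀ i < N, ∀ s', I i s' → e.eval s' ≠ 0 ∧ p.WP B (I (i + 1)) s') ∧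
      ∀ s', I N s' → e.eval s' = 0 ∧ Q s'

/-- A bound for the running time of a program with `WP B`. -/
def Prog.timeBound (B : ℕ) : Prog → ℕ
  | .skip => 1
  | .assign _ e => e.costBound B + 1
  | .store _ i e => i.costBound B + e.costBound B + 1
  | .seq p q => p.timeBound B + q.timeBound B
  | .ite e p q => e.costBound B + (p.timeBound B + q.timeBound B)
  | .while e p => B * (e.costBound B + p.timeBound B) + e.costBound B

theorem Prog.polyBounded_timeBound (p : Prog) : PolyBounded id fun B => p.timeBound B := by
  have one : PolyBounded (id : ℕ → ℕ) fun _ => 1 := .const _ 1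
  induction p with
  | skip => exact one
  | assign _ e => exact e.polyBounded_costBound.add one
  | store _ i e => exact (i.polyBounded_costBound.add e.polyBounded_costBound).add one
  | seq p q hp hq => exact hp.add hq
  | ite e p q hp hq => exact e.polyBounded_costBound.add (hp.add hq)
  | _ e p hp =>
    exact ((PolyBounded.self _).mul (e.polyBounded_costBound.add hp)).add e.polyBounded_costBound

theorem State.BoundedBy.setReg {B : ℕ} {s : State} (hs : s.BoundedBy B) {v : ℕ} (x : ℕ)
    (hv : v ≤ B) : (s.setReg x v).BoundedBy B := by
  refine ⟨fun y => ?_, hs.2⟩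
  rw [State.reg_setReg]
  split_ifs
  exacts [hv, hs.1 y]

theorem State.BoundedBy.setArr {B : ℕ} {s : State} (hs : s.BoundedBy B) {v : ℕ} (a i : ℕ)
    (hv : v ≤ B) : (s.setArr a i v).BoundedBy B := by
  refine ⟨hs.1, fun b j => ?_⟩
  rw [State.arr_setArr]
  split_ifs
  · rw [Function.update_apply]
    split_ifs
    exacts [hv, hs.2 a j]
  · exact hs.2 b j

/-- The program `p`, started in the memory `s`, halts within time `t` in a memory that satisfies
`Q`. -/
def Prog.HaltsWithin (p : Prog) (t : ℕ) (Q : State → Prop) (s : State) : Prop :=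
  ∃ s' t', Exec p s s' t' ∧ Q s' ∧ t' ≤ t

namespace Prog.HaltsWithin

theorem seq {p q : Prog} {t u : ℕ} {R Q : State → Prop} {s : State} (hp : p.HaltsWithin t R s)
    (hq : ∀ s, R s → q.HaltsWithin u Q s) : (p.seq q).HaltsWithin (t + u) Q s := by
  obtain ⟨s₁, t₁, E₁, h₁, l₁⟩ := hp
  obtain ⟨s₂, t₂, E₂, h₂, l₂⟩ := hq s₁ h₁
  exact ⟨s₂, _, .seq E₁ E₂, h₂, Nat.add_le_add l₁ l₂⟩

theorem ite {e : Expr} {p q : Prog} {t u : ℕ} {Q : State → Prop} {s : State}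
    (hp : e.eval s ≠ 0 → p.HaltsWithin t Q s) (hq : e.eval s = 0 → q.HaltsWithin u Q s) :
    (Prog.ite e p q).HaltsWithin (e.cost s + (t + u)) Q s := by
  by_cases he : e.eval s = 0
  · obtain ⟨s₁, t₁, E₁, h₁, l₁⟩ := hq he
    exact ⟨s₁, _, .ite_false he E₁, h₁, by omega⟩
  · obtain ⟨s₁, t₁, E₁, h₁, l₁⟩ := hp he
    exact ⟨s₁, _, .ite_true he E₁, h₁, by omega⟩

theorem mono {p : Prog} {t u : ℕ} {Q : State → Prop} {s : State} (h : p.HaltsWithin t Q s)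
    (htu : t ≤ u) : p.HaltsWithin u Q s :=
  let ⟨s', t', E, hQ, l⟩ := h
  ⟨s', t', E, hQ, l.trans htu⟩

/-- The invariant `I` is indexed by the number `m` of iterations that are still to come. -/
theorem loop {e : Expr} {p : Prog} {t c : ℕ} {I : ℕ → State → Prop}
    (hcost : ∀ m s, I m s → e.cost s ≤ c) (hend : ∀ s, I 0 s → e.eval s = 0)
    (hstep : ∀ m s, I (m + 1) s → e.eval s ≠ 0 ∧ p.HaltsWithin t (I m) s) :
    ∀ m s, I m s → (Prog.while e p).HaltsWithin (m * (c + t) + c) (I 0) s := by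
  intro m
  induction m with
  | zero => exact fun s hs => ⟨s, _, .while_done (hend s hs), hs, by have := hcost 0 s hs; omega⟩
  | succ m ih =>
    intro s hs
    obtain ⟨he, s₁, t₁, E₁, h₁, l₁⟩ := hstep m s hs
    obtain ⟨s₂, t₂, E₂, h₂, l₂⟩ := ih s₁ h₁
    refine ⟨s₂, _, .while_step he E₁ E₂, h₂, ?_⟩
    have := hcost _ s hs
    rw [Nat.succ_mul]
    omega

end Prog.HaltsWithin

theorem Prog.WP.haltsWithin {B : ℕ} (p : Prog) : ∀ {Q : State → Prop} {s : State},
    s.BoundedBy B → p.WP B Q s →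
      p.HaltsWithin (p.timeBound B) (fun s' => s'.BoundedBy B ∧ Q s') s := by
  induction p with
  | skip => exact fun {Q s} hs h => ⟨s, 1, .skip s, ⟨hs, h⟩, le_rfl⟩
  | assign x e =>
    exact fun {Q s} hs h => ⟨_, _, .assign s x e, ⟨hs.setReg x h.1, h.2⟩,
      Nat.add_le_add_right (e.cost_le_costBound hs) 1⟩
  | store a i e =>
    exact fun {Q s} hs h => ⟨_, _, .store s a i e, ⟨hs.setArr a _ h.1, h.2⟩,
      Nat.add_le_add_right (Nat.add_le_add (i.cost_le_costBound hs) (e.cost_le_costBound hs)) 1⟩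
  | seq p q hp hq => exact fun hs h => (hp hs h).seq fun _ h' => hq h'.1 h'.2
  | ite e p q hp hq =>
    exact fun hs h => (HaltsWithin.ite (fun he => hp hs (h.1 he)) fun he => hq hs (h.2 he)).mono
      (Nat.add_le_add_right (e.cost_le_costBound hs) _)
  | _ e p hp =>
    intro Q s hs ⟨N, hN, I, h0, hstep, hend⟩
    have hloop := HaltsWithin.loop (e := e) (p := p) (c := e.costBound B) (t := p.timeBound B)
      (I := fun m s => s.BoundedBy B ∧ m ≤ N ∧ I (N - m) s)
      (fun m s h => e.cost_le_costBound h.1) (fun s h => (hend s h.2.2).1)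
      (fun m s h => by
        obtain ⟨he, hb⟩ := hstep (N - (m + 1)) (by omega) s h.2.2
        obtain ⟨s₁, t₁, E₁, ⟨b₁, h₁⟩, l₁⟩ := hp h.1 hb
        rw [show N - (m + 1) + 1 = N - m by omega] at h₁
        exact ⟨he, s₁, t₁, E₁, ⟨b₁, by omega, h₁⟩, l₁⟩)
    obtain ⟨s', t, E, ⟨b, -, hQ⟩, l⟩ := hloop N s ⟨hs, le_rfl, by rwa [Nat.sub_self]⟩
    exact ⟨s', t, E, ⟨b, (hend s' hQ).2⟩,
      l.trans (Nat.add_le_add_right (Nat.mul_le_mul_right _ hN) _)⟩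

theorem Prog.WP.mono {B : ℕ} (p : Prog) : ∀ {Q R : State → Prop} {s : State},
    (∀ s, Q s → R s) → p.WP B Q s → p.WP B R s := by
  induction p with
  | skip => exact fun h hs => h _ hs
  | assign x e => exact fun h hs => ⟨hs.1, h _ hs.2⟩
  | store a i e => exact fun h hs => ⟨hs.1, h _ hs.2⟩
  | seq p q hp hq => exact fun h hs => hp (fun _ => hq h) hs
  | ite e p q hp hq => exact fun h hs => ⟨fun he => hp h (hs.1 he), fun he => hq h (hs.2 he)⟩
  | _ e p _ =>
    exact fun h ⟨N, hN, I, h0, h1, h2⟩ =>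
      ⟨N, hN, I, h0, h1, fun s' hs' => ⟨(h2 s' hs').1, h _ (h2 s' hs').2⟩⟩

/-- Run `p` with register `x` equal to `0`, …, `N - 1`, where `N` is the value of `e`. -/
def Prog.for (x : ℕ) (e : Expr) (p : Prog) : Prog :=
  .seq (.assign x (.const 0)) (.while (.sub e (.var x))
    (.seq p (.assign x (.add (.var x) (.const 1)))))

theorem Prog.WP.seq {B : ℕ} {p q : Prog} {P Q : State → Prop} {s : State} (hp : p.WP B P s)
    (hq : ∀ s, P s → q.WP B Q s) : (Prog.seq p q).WP B Q s :=
  hp.mono p hq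

theorem Prog.WP.for {B N x : ℕ} {e : Expr} {p : Prog} {Q : State → Prop} {s : State}
    (I : ℕ → State → Prop) (hN : N ≤ B) (h0 : I 0 (s.setReg x 0))
    (hI : ∀ i s, I i s → s.reg x = i ∧ e.eval s = N)
    (hstep : ∀ i < N, ∀ s, I i s →
      p.WP B (fun s' => s'.reg x = i ∧ I (i + 1) (s'.setReg x (i + 1))) s)
    (hend : ∀ s, I N s → Q s) : (Prog.for x e p).WP B Q s := by
  refine ⟨Nat.zero_le _, N, hN, I, h0, fun i hi s hs => ?_, fun s hs => ?_⟩
  · obtain ⟨h1, h2⟩ := hI i s hs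
    refine ⟨by simp only [Expr.eval]; omega, Prog.WP.mono p ?_ (hstep i hi s hs)⟩
    rintro s' ⟨h3, h4⟩
    simp only [Prog.WP, Expr.eval, h3]
    exact ⟨by omega, h4⟩
  · obtain ⟨h1, h2⟩ := hI N s hs
    exact ⟨by simp only [Expr.eval]; omega, hend s hs⟩

/-! ## Programs that leave part of the memory alone -/

/-- The registers and arrays that a program writes satisfy `R` and `A`. -/
def Prog.WritesOnly (R A : ℕ → Prop) : Prog → Prop
  | .skip => True
  | .assign x _ => R x
  | .store a _ _ => A a
  | .seq p q => p.WritesOnly R A ∧ q.WritesOnly R A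
  | .ite _ p q => p.WritesOnly R A ∧ q.WritesOnly R A
  | .while _ p => p.WritesOnly R A

theorem Exec.frame {R A : ℕ → Prop} {p : Prog} {s s' : State} {t : ℕ} (h : Exec p s s' t)
    (hp : p.WritesOnly R A) :
    (∀ x, ¬ R x → s'.reg x = s.reg x) ∧ ∀ a, ¬ A a → s'.arr a = s.arr a := by
  induction h with
  | skip s => exact ⟨fun _ _ => rfl, fun _ _ => rfl⟩
  | assign s x e =>
    refine ⟨fun y hy => ?_, fun _ _ => rfl⟩
    have : y ≠ x := fun h => hy (h ▸ hp)
    simp [State.setReg, this]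
  | store s a i e =>
    refine ⟨fun _ _ => rfl, fun b hb => ?_⟩
    have : b ≠ a := fun h => hb (h ▸ hp)
    simp [State.setArr, this]
  | seq _ _ h₁ h₂ =>
    obtain ⟨reg₁, arr₁⟩ := h₁ hp.1
    obtain ⟨reg₂, arr₂⟩ := h₂ hp.2
    exact ⟨fun x hx => (reg₂ x hx).trans (reg₁ x hx), fun a ha => (arr₂ a ha).trans (arr₁ a ha)⟩
  | ite_true _ _ h => exact h hp.1
  | ite_false _ _ h => exact h hp.2
  | while_done _ => exact ⟨fun _ _ => rfl, fun _ _ => rfl⟩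
  | while_step _ _ _ h₁ h₂ =>
    obtain ⟨reg₁, arr₁⟩ := h₁ hp
    obtain ⟨reg₂, arr₂⟩ := h₂ hp
    exact ⟨fun x hx => (reg₂ x hx).trans (reg₁ x hx), fun a ha => (arr₂ a ha).trans (arr₁ a ha)⟩

/-! ## Renaming registers and arrays -/

/-- Rename registers along `ρ` and arrays along `σ`. -/
def Expr.rename (ρ σ : ℕ → ℕ) : Expr → Expr
  | .const c => .const c
  | .var x => .var (ρ x)
  | .load a i => .load (σ a) (i.rename ρ σ)
  | .add e₁ e₂ => .add (e₁.rename ρ σ) (e₂.rename ρ σ)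
  | .sub e₁ e₂ => .sub (e₁.rename ρ σ) (e₂.rename ρ σ)
  | .mul e₁ e₂ => .mul (e₁.rename ρ σ) (e₂.rename ρ σ)
  | .div e₁ e₂ => .div (e₁.rename ρ σ) (e₂.rename ρ σ)

/-- Rename registers along `ρ` and arrays along `σ`. -/
def Prog.rename (ρ σ : ℕ → ℕ) : Prog → Prog
  | .skip => .skip
  | .assign x e => .assign (ρ x) (e.rename ρ σ)
  | .store a i e => .store (σ a) (i.rename ρ σ) (e.rename ρ σ)
  | .seq p q => .seq (p.rename ρ σ) (q.rename ρ σ)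
  | .ite e p q => .ite (e.rename ρ σ) (p.rename ρ σ) (q.rename ρ σ)
  | .while e p => .while (e.rename ρ σ) (p.rename ρ σ)

/-- The memory that is seen through the renaming. -/
def State.restrict (ρ σ : ℕ → ℕ) (s : State) : State where
  reg x := s.reg (ρ x)
  arr a := s.arr (σ a)

theorem Expr.eval_rename (ρ σ : ℕ → ℕ) (s : State) (e : Expr) :
    (e.rename ρ σ).eval s = e.eval (s.restrict ρ σ) := by
  induction e <;> simp_all [Expr.rename, Expr.eval, State.restrict]

theorem Expr.cost_rename (ρ σ : ℕ → ℕ) (s : State) (e : Expr) :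
    (e.rename ρ σ).cost s = e.cost (s.restrict ρ σ) := by
  induction e <;> simp_all [Expr.rename, Expr.cost, Expr.eval_rename, State.restrict]

theorem State.restrict_setReg {ρ : ℕ → ℕ} (hρ : ρ.Injective) (σ : ℕ → ℕ) (s : State) (x v : ℕ) :
    (s.setReg (ρ x) v).restrict ρ σ = (s.restrict ρ σ).setReg x v := by
  simp only [State.restrict, State.setReg, State.mk.injEq, and_true]
  exact Function.update_comp_eq_of_injective s.reg hρ x v

theorem State.restrict_setArr (ρ : ℕ → ℕ) {σ : ℕ → ℕ} (hσ : σ.Injective) (s : State) (a i v : ℕ) :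
    (s.setArr (σ a) i v).restrict ρ σ = (s.restrict ρ σ).setArr a i v := by
  simp only [State.restrict, State.setArr, State.mk.injEq, true_and]
  exact Function.update_comp_eq_of_injective s.arr hσ a _

theorem Exec.rename {ρ σ : ℕ → ℕ} (hρ : ρ.Injective) (hσ : σ.Injective) {p : Prog} {s s' : State}
    {t : ℕ} (h : Exec p s s' t) : ∀ u : State, u.restrict ρ σ = s →
      ∃ u', Exec (p.rename ρ σ) u u' t ∧ u'.restrict ρ σ = s' := by
  induction h with
  | skip s => exact fun u hu => ⟨u, .skip u, hu⟩
  | assign s x e =>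
    rintro u rfl
    refine ⟨_, ?_, State.restrict_setReg hρ σ u x _⟩
    rw [← Expr.eval_rename, ← Expr.cost_rename]
    exact .assign u _ _
  | store s a i e =>
    rintro u rfl
    refine ⟨_, ?_, State.restrict_setArr ρ hσ u a _ _⟩
    rw [← Expr.eval_rename, ← Expr.cost_rename, ← Expr.eval_rename, ← Expr.cost_rename]
    exact .store u _ _ _
  | seq _ _ h₁ h₂ =>
    intro u hu
    obtain ⟨u₁, E₁, hu₁⟩ := h₁ u hu
    obtain ⟨u₂, E₂, hu₂⟩ := h₂ u₁ hu₁
    exact ⟨u₂, .seq E₁ E₂, hu₂⟩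
  | ite_true he _ h =>
    rintro u rfl
    obtain ⟨u₁, E₁, hu₁⟩ := h u rfl
    rw [← Expr.eval_rename] at he
    rw [← Expr.cost_rename]
    exact ⟨u₁, .ite_true he E₁, hu₁⟩
  | ite_false he _ h =>
    rintro u rfl
    obtain ⟨u₁, E₁, hu₁⟩ := h u rfl
    rw [← Expr.eval_rename] at he
    rw [← Expr.cost_rename]
    exact ⟨u₁, .ite_false he E₁, hu₁⟩
  | while_done he =>
    rintro u rfl
    rw [← Expr.eval_rename] at he
    rw [← Expr.cost_rename]
    exact ⟨u, .while_done he, rfl⟩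
  | while_step he _ _ h₁ h₂ =>
    rintro u rfl
    obtain ⟨u₁, E₁, hu₁⟩ := h₁ u rfl
    obtain ⟨u₂, E₂, hu₂⟩ := h₂ u₁ hu₁
    rw [← Expr.eval_rename] at he
    rw [← Expr.cost_rename]
    exact ⟨u₂, .while_step he E₁ E₂, hu₂⟩

end RAM

/-! ## The hypergraph of a token system -/

/-- The sets of an Exact Cover instance with `n` elements, written one after the other.  Token
`t < numTokens` stands for the element `label t` of one of the sets, and `mark t ≠ 0` if a set
starts at `t`.  The number `numTokens` itself serves as a padding token, and `d` is the block length
of the reduction.  The fields `label_numTokens`, `mark_numTokens` and `mark_numTokens_succ` fix how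
the lists continue behind the last token. -/
structure TokenSystem where
  d : ℕ
  n : ℕ
  numTokens : ℕ
  label : ℕ → ℕ
  mark : ℕ → ℕ
  d_pos : 0 < d
  label_lt : ∀ t < numTokens, label t < n
  label_numTokens : label numTokens = 0
  mark_numTokens : mark numTokens ≠ 0
  mark_numTokens_succ : mark (numTokens + 1) ≠ 0

namespace TokenSystem

/-- Token `t'` may follow token `t`: a set that has been started is completed. -/
def Link (S : TokenSystem) (t t' : ℕ) : Prop :=
  (S.mark t' = 0 ∧ t' = t + 1) ∨ (S.mark t' ≠ 0 ∧ S.mark (t + 1) ≠ 0)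

/-- The positions of a walk that carry tokens; the other ones are padding.  A tight path may begin
as late as in layer `3` and end `3` layers early, hence the four blocks of padding on both sides. -/
def Occupied (S : TokenSystem) (g : ℕ) : Prop := 4 * S.d ≤ g ∧ g < 4 * S.d + S.n

/-- `τ` is a rainbow walk: the occupied positions carry `n` tokens with distinct labels. -/
structure IsWalk (S : TokenSystem) (τ : ℕ → ℕ) : Prop where
  lt : ∀ g, S.Occupied g → τ g < S.numTokens
  eq_numTokens : ∀ g, ¬ S.Occupied g → τ g = S.numTokens
  link : ∀ g, S.Link (τ g) (τ (g + 1))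
  label_injOn : ∀ g g', S.Occupied g → S.Occupied g' → S.label (τ g) = S.label (τ g') → g = g'

/-- The number of state nodes of the intended path. -/
def numLayers (S : TokenSystem) : ℕ := S.n / S.d + 8

/-- The base in which sequences of tokens are encoded; the digit `numTokens` stands for padding. -/
def base (S : TokenSystem) : ℕ := S.numTokens + 1

/-- The number of element nodes.  The nodes below `offset` are element nodes, and `offset + q` is
the state node `q`. -/
def offset (S : TokenSystem) : ℕ := S.n + (S.numLayers + 1) * S.d

/-- The number of state nodes. -/
def numStates (S : TokenSystem) : ℕ := S.numLayers * S.base ^ (2 * S.d)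

/-- The number of nodes of the intended path: `numLayers` states with blocks before, between and
after them. -/
def pathLen (S : TokenSystem) : ℕ := (S.numLayers + 1) * (S.d + 1) - 1

/-- Digit `i` of the code `c`. -/
def digit (S : TokenSystem) (c i : ℕ) : ℕ := c / S.base ^ i % S.base

/-- The number of the block in front of state `q`. -/
def layer (S : TokenSystem) (q : ℕ) : ℕ := q / S.base ^ (2 * S.d)

/-- The code of the tokens in the two blocks around state `q`. -/
def code (S : TokenSystem) (q : ℕ) : ℕ := q % S.base ^ (2 * S.d)

/-- Token `i` of the two blocks around state `q`. -/
def token (S : TokenSystem) (q i : ℕ) : ℕ := S.digit (S.code q) i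

/-- The element node at position `g` if the token there is `t`. -/
def elementNode (S : TokenSystem) (g t : ℕ) : ℕ := if t < S.numTokens then S.label t else S.n + g

/-- Element node `i` of the two blocks around state `q`. -/
def element (S : TokenSystem) (q i : ℕ) : ℕ := S.elementNode (S.layer q * S.d + i) (S.token q i)

/-- The two blocks around state `q` may be part of a rainbow walk. -/
def Valid (S : TokenSystem) (q : ℕ) : Prop :=
  q < S.numStates ∧
    (∀ i < 2 * S.d, (S.Occupied (S.layer q * S.d + i) ↔ S.token q i < S.numTokens)) ∧
    (∀ i, i + 1 < 2 * S.d → S.Link (S.token q i) (S.token q (i + 1))) ∧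
    ∀ i < 2 * S.d, ∀ i' < i, S.element q i ≠ S.element q i'

/-- The state after `q` whose second block has the code `a`. -/
def next (S : TokenSystem) (q a : ℕ) : ℕ :=
  (S.layer q + 1) * S.base ^ (2 * S.d) + (S.code q / S.base ^ S.d + a * S.base ^ S.d)

/-- The hyperedges that contain the state `q` only. -/
def edge₁ (S : TokenSystem) (q u : ℕ) : List ℕ :=
  (S.offset + q) :: (List.range (S.d + 1)).map fun i => S.element q (u + i)

/-- The hyperedges that contain two states. -/
def edge₂ (S : TokenSystem) (q a : ℕ) : List ℕ :=
  (S.offset + q) :: (S.offset + S.next q a) ::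
    (List.range S.d).map fun i => S.element q (S.d + i)

open Classical in
/-- The hyperedges that belong to state `q` and the code `a` of the block after next. -/
noncomputable def edgesNext (S : TokenSystem) (q a : ℕ) : List (List ℕ) :=
  if S.Valid (S.next q a) then [S.edge₂ q a] else []

open Classical in
/-- The hyperedges that belong to state `q`. -/
noncomputable def edgesAt (S : TokenSystem) (q : ℕ) : List (List ℕ) :=
  if S.Valid q then
    (List.range S.d).map (S.edge₁ q) ++ (List.range (S.base ^ S.d)).flatMap (S.edgesNext q)
  else []

/-- The list of all hyperedges, in the order in which the reduction program writes them. -/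
noncomputable def edges (S : TokenSystem) : List (List ℕ) :=
  (List.range S.numStates).flatMap S.edgesAt

/-- The sequence `f 0, …, f (pathLen - 1)` is a tight path of the hypergraph. -/
def IsPath (S : TokenSystem) (f : ℕ → ℕ) : Prop :=
  (∀ x < S.pathLen, ∀ y < S.pathLen, f x = f y → x = y) ∧
    ∀ i, i + (S.d + 2) ≤ S.pathLen →
      ∃ e ∈ S.edges, (Finset.Ico i (i + (S.d + 2))).image f = e.toFinset

variable {S : TokenSystem}

theorem mem_edgesNext {q a : ℕ} {e : List ℕ} :
    e ∈ S.edgesNext q a ↔ S.Valid (S.next q a) ∧ e = S.edge₂ q a := by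
  unfold edgesNext
  split_ifs with h <;> simp [h]

theorem mem_edgesAt {q : ℕ} {e : List ℕ} : e ∈ S.edgesAt q ↔
    S.Valid q ∧ ((∃ u < S.d, e = S.edge₁ q u) ∨
      ∃ a < S.base ^ S.d, S.Valid (S.next q a) ∧ e = S.edge₂ q a) := by
  unfold edgesAt
  split_ifs with hq
  · simp only [List.mem_append, List.mem_map, List.mem_range, List.mem_flatMap, mem_edgesNext, hq,
      true_and, eq_comm]
  · simp [hq]

theorem mem_edges {e : List ℕ} : e ∈ S.edges ↔
    (∃ q u, S.Valid q ∧ u < S.d ∧ e = S.edge₁ q u) ∨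
    ∃ q a, S.Valid q ∧ a < S.base ^ S.d ∧ S.Valid (S.next q a) ∧ e = S.edge₂ q a := by
  simp only [edges, List.mem_flatMap, List.mem_range, mem_edgesAt]
  constructor
  · rintro ⟨q, -, hq, ⟨u, hu, he⟩ | ⟨a, ha, hv, he⟩⟩
    · exact .inl ⟨q, u, hq, hu, he⟩
    · exact .inr ⟨q, a, hq, ha, hv, he⟩
  · rintro (⟨q, u, hq, hu, he⟩ | ⟨q, a, hq, ha, hv, he⟩)
    · exact ⟨q, hq.1, hq, .inl ⟨u, hu, he⟩⟩
    · exact ⟨q, hq.1, hq, .inr ⟨a, ha, hv, he⟩⟩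

theorem base_pos : 0 < S.base := Nat.succ_pos _

theorem digit_le (c i : ℕ) : S.digit c i ≤ S.numTokens :=
  Nat.le_of_lt_succ (Nat.mod_lt _ base_pos)

theorem token_le (q i : ℕ) : S.token q i ≤ S.numTokens := digit_le _ _

theorem code_lt (q : ℕ) : S.code q < S.base ^ (2 * S.d) := Nat.mod_lt _ (pow_pos base_pos _)

theorem layer_mul_add {j c : ℕ} (hc : c < S.base ^ (2 * S.d)) :
    S.layer (j * S.base ^ (2 * S.d) + c) = j := by
  rw [layer, mul_comm, Nat.mul_add_div (pow_pos base_pos _), Nat.div_eq_of_lt hc, add_zero]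

theorem code_mul_add {j c : ℕ} (hc : c < S.base ^ (2 * S.d)) :
    S.code (j * S.base ^ (2 * S.d) + c) = c := by
  rw [code, mul_comm, Nat.mul_add_mod, Nat.mod_eq_of_lt hc]

theorem next_code_lt {q a : ℕ} (ha : a < S.base ^ S.d) :
    S.code q / S.base ^ S.d + a * S.base ^ S.d < S.base ^ (2 * S.d) := by
  have hsq : S.base ^ (2 * S.d) = S.base ^ S.d * S.base ^ S.d := by rw [two_mul, pow_add]
  have hdiv : S.code q / S.base ^ S.d < S.base ^ S.d := by
    rw [Nat.div_lt_iff_lt_mul (pow_pos base_pos _), ← hsq]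
    exact code_lt q
  rw [hsq]
  nlinarith

theorem layer_next {q a : ℕ} (ha : a < S.base ^ S.d) : S.layer (S.next q a) = S.layer q + 1 :=
  layer_mul_add (next_code_lt ha)

theorem digit_mod {c m i : ℕ} (hi : i < m) : S.digit (c % S.base ^ m) i = S.digit c i := by
  obtain ⟨m, rfl⟩ : ∃ l, m = i + (l + 1) := ⟨m - i - 1, by omega⟩
  rw [digit, digit, pow_add, Nat.mod_mul_right_div_self, pow_succ, Nat.mod_mul_left_mod]

theorem digit_div {c m i : ℕ} : S.digit (c / S.base ^ m) i = S.digit c (m + i) := by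
  rw [digit, digit, Nat.div_div_eq_div_mul, ← pow_add]

theorem token_next {q a i : ℕ} (ha : a < S.base ^ S.d) (hi : i < S.d) :
    S.token (S.next q a) i = S.token q (S.d + i) := by
  rw [token, next, code_mul_add (next_code_lt ha), token, ← digit_div, ← digit_mod hi,
    Nat.add_mul_mod_self_right, digit_mod hi]

theorem layer_lt {q : ℕ} (hq : S.Valid q) : S.layer q < S.numLayers :=
  (Nat.div_lt_iff_lt_mul (pow_pos base_pos _)).2 hq.1

theorem elementNode_lt {g t : ℕ} (hg : g < (S.numLayers + 1) * S.d) :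
    S.elementNode g t < S.offset := by
  unfold elementNode offset
  split_ifs with h
  · have := S.label_lt t h
    omega
  · omega

theorem element_lt {q i : ℕ} (hq : S.Valid q) (hi : i < 2 * S.d) : S.element q i < S.offset := by
  refine elementNode_lt ?_
  have := layer_lt hq
  calc S.layer q * S.d + i < S.layer q * S.d + 2 * S.d := by omega
    _ = (S.layer q + 2) * S.d := by ring
    _ ≤ _ := Nat.mul_le_mul_right _ (by omega)

theorem element_injective {q i i' : ℕ} (hq : S.Valid q) (hi : i < 2 * S.d) (hi' : i' < 2 * S.d)
    (h : S.element q i = S.element q i') : i = i' := by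
  rcases lt_trichotomy i i' with hlt | heq | hlt
  · exact absurd h.symm (hq.2.2.2 i' hi' i hlt)
  · exact heq
  · exact absurd h (hq.2.2.2 i hi i' hlt)

theorem pathLen_eq : S.pathLen = S.n / S.d * (S.d + 1) + 9 * S.d + 8 := by
  rw [pathLen, numLayers]
  have : (S.n / S.d + 8 + 1) * (S.d + 1) = S.n / S.d * (S.d + 1) + 9 * S.d + 9 := by ring
  omega

theorem occupied_lt {g : ℕ} (hg : S.Occupied g) : g + 1 < (S.numLayers - 3) * S.d := by
  have hn : S.n < S.n / S.d * S.d + S.d := Nat.lt_div_mul_add S.d_pos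
  have hlayers : (S.numLayers - 3) * S.d = S.n / S.d * S.d + 5 * S.d := by
    rw [show S.numLayers - 3 = S.n / S.d + 5 from rfl]
    ring
  have := hg.2
  have := S.d_pos
  omega

/-- State `q'` may follow state `q` on a path. -/
def Follows (S : TokenSystem) (q q' : ℕ) : Prop :=
  S.Valid q ∧ S.Valid q' ∧ S.layer q' = S.layer q + 1 ∧
    ∀ i < S.d, S.token q' i = S.token q (S.d + i)

theorem Follows.layer_eq {q q' : ℕ} (h : S.Follows q q') : S.layer q' = S.layer q + 1 := h.2.2.1

theorem Follows.token_eq {q q' i : ℕ} (h : S.Follows q q') (hi : i < S.d) :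
    S.token q' i = S.token q (S.d + i) :=
  h.2.2.2 i hi

theorem follows_next {q a : ℕ} (hq : S.Valid q) (ha : a < S.base ^ S.d)
    (hnext : S.Valid (S.next q a)) : S.Follows q (S.next q a) :=
  ⟨hq, hnext, layer_next ha, fun _ => token_next ha⟩

theorem Follows.element_eq {q q' i : ℕ} (h : S.Follows q q') (hi : i < S.d) :
    S.element q' i = S.element q (S.d + i) := by
  rw [element, element, h.token_eq hi, h.layer_eq]
  congr 1
  ring

theorem Follows.element_lt {q q' i : ℕ} (h : S.Follows q q') (hi : i < S.d) :
    S.element q (S.d + i) < S.offset :=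
  TokenSystem.element_lt h.1 (by omega)

/-! ### The states on a tight path -/

section Path

variable {f : ℕ → ℕ}

/-- The window of a path that starts at position `i`, as long as a hyperedge. -/
def window (S : TokenSystem) (f : ℕ → ℕ) (i : ℕ) : Finset ℕ :=
  (Finset.Ico i (i + (S.d + 2))).image f

theorem mem_window {i y : ℕ} : y ∈ S.window f i ↔ ∃ x, i ≤ x ∧ x ≤ i + S.d + 1 ∧ f x = y := by
  simp only [window, Finset.mem_image, Finset.mem_Ico, and_assoc, ← add_assoc]
  exact exists_congr fun x => and_congr_right fun _ => and_congr_left fun _ => Nat.lt_succ_iff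

/-- The state `q` and `d + 1` consecutive nodes of the two blocks around it: the node set of
`edge₁ q u`. -/
def singleSet (S : TokenSystem) (q u : ℕ) : Finset ℕ :=
  insert (S.offset + q) ((Finset.range (S.d + 1)).image fun i => S.element q (u + i))

/-- The states `q` and `q'` and the nodes of the second block of `q`: the node set of an `edge₂`. -/
def pairSet (S : TokenSystem) (q q' : ℕ) : Finset ℕ :=
  insert (S.offset + q) (insert (S.offset + q')
    ((Finset.range S.d).image fun i => S.element q (S.d + i)))

theorem toFinset_edge₁ (q u : ℕ) : (S.edge₁ q u).toFinset = S.singleSet q u := by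
  ext y
  simp [edge₁, singleSet]

theorem toFinset_edge₂ (q a : ℕ) : (S.edge₂ q a).toFinset = S.pairSet q (S.next q a) := by
  ext y
  simp [edge₂, pairSet]

theorem eq_of_mem_singleSet {q u y : ℕ} (hq : S.Valid q) (hu : u < S.d)
    (hy : y ∈ S.singleSet q u) (hs : S.offset ≤ y) : y = S.offset + q := by
  simp only [singleSet, Finset.mem_insert, Finset.mem_image, Finset.mem_range] at hy
  rcases hy with hy | ⟨i, hi, rfl⟩
  · exact hy
  · exact absurd (element_lt hq (i := u + i) (by omega)) (by omega)

theorem exists_element_of_mem_singleSet {q u y : ℕ} (hu : u < S.d)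
    (hy : y ∈ S.singleSet q u) (hs : y < S.offset) : ∃ i < 2 * S.d, y = S.element q i := by
  simp only [singleSet, Finset.mem_insert, Finset.mem_image, Finset.mem_range] at hy
  rcases hy with hy | ⟨i, hi, rfl⟩
  · omega
  · exact ⟨u + i, by omega, rfl⟩

theorem Follows.eq_or_eq_of_mem_pairSet {q q' y : ℕ} (h : S.Follows q q')
    (hy : y ∈ S.pairSet q q') (hs : S.offset ≤ y) : y = S.offset + q ∨ y = S.offset + q' := by
  simp only [pairSet, Finset.mem_insert, Finset.mem_image, Finset.mem_range] at hy
  rcases hy with hy | hy | ⟨i, hi, rfl⟩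
  · exact .inl hy
  · exact .inr hy
  · exact absurd (h.element_lt hi) (by omega)

theorem exists_element_of_mem_pairSet {q q' y : ℕ}
    (hy : y ∈ S.pairSet q q') (hs : y < S.offset) : ∃ i < S.d, y = S.element q (S.d + i) := by
  simp only [pairSet, Finset.mem_insert, Finset.mem_image, Finset.mem_range] at hy
  rcases hy with hy | hy | ⟨i, hi, rfl⟩
  · omega
  · omega
  · exact ⟨i, hi, rfl⟩

theorem IsPath.window_eq (hf : S.IsPath f) {i : ℕ} (hi : i + (S.d + 2) ≤ S.pathLen) :
    (∃ q u, S.Valid q ∧ u < S.d ∧ S.window f i = S.singleSet q u) ∨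
    ∃ q q', S.Follows q q' ∧ S.window f i = S.pairSet q q' := by
  obtain ⟨e, he, hw⟩ := hf.2 i hi
  rcases mem_edges.1 he with ⟨q, u, hv, hu, rfl⟩ | ⟨q, a, hv, ha, hv', rfl⟩
  · exact .inl ⟨q, u, hv, hu, hw.trans (toFinset_edge₁ q u)⟩
  · exact .inr ⟨q, S.next q a, follows_next hv ha hv', hw.trans (toFinset_edge₂ q a)⟩

theorem IsPath.exists_state (hf : S.IsPath f) {i : ℕ} (hi : i + (S.d + 2) ≤ S.pathLen) :
    ∃ x, i ≤ x ∧ x ≤ i + S.d + 1 ∧ S.offset ≤ f x := by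
  obtain ⟨q, hq⟩ : ∃ q, S.offset + q ∈ S.window f i := by
    rcases hf.window_eq hi with ⟨q, u, _, _, h⟩ | ⟨q, q', _, h⟩
    · exact ⟨q, h ▸ Finset.mem_insert_self _ _⟩
    · exact ⟨q, h ▸ Finset.mem_insert_self _ _⟩
  obtain ⟨x, hix, hxi, hx⟩ := mem_window.1 hq
  exact ⟨x, hix, hxi, by omega⟩

theorem IsPath.exists_element (hf : S.IsPath f) {i a b : ℕ} (hi : i + (S.d + 2) ≤ S.pathLen)
    (ha : i ≤ a) (ha' : a ≤ i + S.d + 1) (hb : i ≤ b) (hb' : b ≤ i + S.d + 1)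
    (hsa : S.offset ≤ f a) (hsb : f b < S.offset) :
    ∃ i' < 2 * S.d, f b = S.element (f a - S.offset) i' := by
  have hma : f a ∈ S.window f i := mem_window.2 ⟨a, ha, ha', rfl⟩
  have hmb : f b ∈ S.window f i := mem_window.2 ⟨b, hb, hb', rfl⟩
  rcases hf.window_eq hi with ⟨q, u, hv, hu, h⟩ | ⟨q, q', hs, h⟩
  · rw [eq_of_mem_singleSet hv hu (h ▸ hma) hsa, Nat.add_sub_cancel_left]
    exact exists_element_of_mem_singleSet hu (h ▸ hmb) hsb
  · obtain ⟨l, hl, hb⟩ := exists_element_of_mem_pairSet (h ▸ hmb) hsb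
    rcases hs.eq_or_eq_of_mem_pairSet (h ▸ hma) hsa with ha | ha <;>
      rw [ha, Nat.add_sub_cancel_left]
    · exact ⟨S.d + l, by omega, hb⟩
    · exact ⟨l, by omega, hb.trans (hs.element_eq hl).symm⟩

/-- The window of the path at position `i` consists of the states `q` and `q'` and the block that
they share. -/
def IsTransition (S : TokenSystem) (f : ℕ → ℕ) (i q q' : ℕ) : Prop :=
  S.Follows q q' ∧ S.window f i = S.pairSet q q'

theorem IsPath.isTransition_or (hf : S.IsPath f) {i a b : ℕ} (hi : i + (S.d + 2) ≤ S.pathLen)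
    (ha : i ≤ a) (hab : a < b) (hb : b ≤ i + S.d + 1) (hsa : S.offset ≤ f a)
    (hsb : S.offset ≤ f b) :
    S.IsTransition f i (f a - S.offset) (f b - S.offset) ∨
      S.IsTransition f i (f b - S.offset) (f a - S.offset) := by
  have hma : f a ∈ S.window f i := mem_window.2 ⟨a, ha, by omega, rfl⟩
  have hmb : f b ∈ S.window f i := mem_window.2 ⟨b, by omega, hb, rfl⟩
  have hne : f a ≠ f b := fun h => hab.ne (hf.1 a (by omega) b (by omega) h)
  rcases hf.window_eq hi with ⟨q, u, hv, hu, h⟩ | ⟨q, q', hs, h⟩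
  · exact absurd ((eq_of_mem_singleSet hv hu (h ▸ hma) hsa).trans
      (eq_of_mem_singleSet hv hu (h ▸ hmb) hsb).symm) hne
  · rcases hs.eq_or_eq_of_mem_pairSet (h ▸ hma) hsa with ea | ea <;>
      rcases hs.eq_or_eq_of_mem_pairSet (h ▸ hmb) hsb with eb | eb
    · exact absurd (ea.trans eb.symm) hne
    · left
      rw [ea, eb, Nat.add_sub_cancel_left, Nat.add_sub_cancel_left]
      exact ⟨hs, h⟩
    · right
      rw [ea, eb, Nat.add_sub_cancel_left, Nat.add_sub_cancel_left]
      exact ⟨hs, h⟩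
    · exact absurd (ea.trans eb.symm) hne

theorem IsTransition.window_congr {i i' q q' : ℕ} (h : S.IsTransition f i q q')
    (h' : S.IsTransition f i' q q' ∨ S.IsTransition f i' q' q) :
    S.window f i = S.window f i' := by
  rcases h' with h' | h'
  · rw [h.2, h'.2]
  · have := h.1.layer_eq
    have := h'.1.layer_eq
    omega

theorem IsPath.lt_offset_of_near_state (hf : S.IsPath f) {a b : ℕ} (ha : 1 ≤ a) (hab : a < b)
    (hb : b ≤ a + S.d) (hbk : b + 2 ≤ S.pathLen) (hk : S.d + 3 ≤ S.pathLen)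
    (hsa : S.offset ≤ f a) : f b < S.offset := by
  by_contra hsb
  push Not at hsb
  obtain ⟨i, hia, hbi, hik⟩ :
      ∃ i, i + 1 ≤ a ∧ b ≤ i + S.d + 1 ∧ i + 1 + (S.d + 2) ≤ S.pathLen := by
    rcases le_total (a - 1) (S.pathLen - (S.d + 3)) with h | h
    · exact ⟨a - 1, by omega, by omega, by omega⟩
    · exact ⟨S.pathLen - (S.d + 3), by omega, by omega, by omega⟩
  -- Two consecutive windows would hold both states, hence be equal; but the first one loses `f i`.
  have hw : S.window f i = S.window f (i + 1) := by
    have h' := hf.isTransition_or hik hia hab (by omega) hsa hsb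
    rcases hf.isTransition_or (i := i) (by omega) (by omega) hab (by omega) hsa hsb with h | h
    · exact h.window_congr h'
    · exact h.window_congr h'.symm
  obtain ⟨x, hix, hxi, hx⟩ := mem_window.1 (hw ▸ mem_window.2 ⟨i, le_rfl, by omega, rfl⟩)
  have := hf.1 x (by omega) i (by omega) hx
  omega

theorem IsPath.card_le_of_forall_element (hf : S.IsPath f) {P : Finset ℕ} {q : ℕ}
    (hlt : ∀ x ∈ P, x < S.pathLen) (hP : ∀ x ∈ P, ∃ i < 2 * S.d, f x = S.element q i) :
    P.card ≤ 2 * S.d := by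
  calc P.card = (P.image f).card := (Finset.card_image_of_injOn fun x hx y hy =>
        hf.1 x (hlt x hx) y (hlt y hy)).symm
    _ ≤ ((Finset.range (2 * S.d)).image (S.element q)).card := by
        refine Finset.card_le_card (Finset.image_subset_iff.2 fun x hx => ?_)
        obtain ⟨i, hi, h⟩ := hP x hx
        exact Finset.mem_image.2 ⟨i, Finset.mem_range.2 hi, h.symm⟩
    _ ≤ 2 * S.d := Finset.card_image_le.trans_eq (Finset.card_range _)

/-- If the next state came one position too late, then the `2 * d + 1` nodes around it would all be
among the `2 * d` element nodes of its two blocks. -/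
theorem IsPath.next_state (hf : S.IsPath f) {a : ℕ} (ha : 1 ≤ a)
    (hak : a + 2 * S.d + 4 ≤ S.pathLen) (hsa : S.offset ≤ f a) :
    S.offset ≤ f (a + S.d + 1) := by
  by_contra hn
  push Not at hn
  have hbefore : ∀ x, a < x → x < a + S.d + 2 → f x < S.offset := by
    intro x hax hxa
    rcases Nat.lt_or_ge x (a + S.d + 1) with h | h
    · exact hf.lt_offset_of_near_state ha hax (by omega) (by omega) (by omega) hsa
    · obtain rfl : x = a + S.d + 1 := by omega
      exact hn
  obtain ⟨c, hac, hca, hsc⟩ := hf.exists_state (i := a + 1) (by omega)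
  obtain rfl : c = a + S.d + 2 := by
    by_contra h
    have := hbefore c (by omega) (by omega)
    omega
  have hafter : ∀ x, a + S.d + 2 < x → x ≤ a + S.d + 2 + S.d → f x < S.offset := fun x hx hx' =>
    hf.lt_offset_of_near_state (by omega) hx hx' (by omega) (by omega) hsc
  have hcard := hf.card_le_of_forall_element (q := f (a + S.d + 2) - S.offset)
    (P := (Finset.Icc (a + 1) (a + 2 * S.d + 2)).erase (a + S.d + 2))
    (fun x hx => by
      have := Finset.mem_Icc.1 (Finset.mem_of_mem_erase hx)
      omega)
    (fun x hx => by
      obtain ⟨hne, hx⟩ := Finset.mem_erase.1 hx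
      obtain ⟨hx1, hx2⟩ := Finset.mem_Icc.1 hx
      rcases lt_or_gt_of_ne hne with h | h
      · exact hf.exists_element (i := a + 1) (by omega) (by omega) (by omega) (by omega)
          (by omega) hsc (hbefore x (by omega) h)
      · exact hf.exists_element (i := a + S.d + 2) (by omega) (by omega) (by omega) (by omega)
          (by omega) hsc (hafter x h (by omega)))
  rw [Finset.card_erase_of_mem (Finset.mem_Icc.2 ⟨by omega, by omega⟩), Nat.card_Icc] at hcard
  omega

theorem IsPath.exists_spaced_states (hf : S.IsPath f) :
    ∃ a, a + (S.numLayers - 4) * (S.d + 1) + 1 ≤ S.pathLen ∧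
      ∀ i ≤ S.numLayers - 4, S.offset ≤ f (a + i * (S.d + 1)) := by
  have hk := pathLen_eq (S := S)
  have hd := S.d_pos
  have hlayers : S.numLayers - 4 = S.n / S.d + 4 := rfl
  obtain ⟨a, ha1, had, hsa⟩ := hf.exists_state (i := 1) (by omega)
  have hmul : (S.n / S.d + 4) * (S.d + 1) = S.n / S.d * (S.d + 1) + 4 * S.d + 4 := by ring
  refine ⟨a, by rw [hlayers]; omega, fun i => ?_⟩
  induction i with
  | zero => exact fun _ => by rwa [zero_mul, add_zero]
  | succ i ih =>
    intro hi
    have hle : (i + 1) * (S.d + 1) ≤ (S.n / S.d + 4) * (S.d + 1) := Nat.mul_le_mul_right _ hi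
    rw [Nat.succ_mul] at hle ⊢
    simpa only [← add_assoc] using hf.next_state (by omega) (by omega) (ih (by omega))

end Path

end TokenSystem

/-! ### Tight paths give walks -/

theorem forall_or_forall_of_no_switch {P Q : ℕ → Prop} {m : ℕ} (h : ∀ i < m, P i ∨ Q i)
    (hPQ : ∀ i, i + 1 < m → P i → ¬ Q (i + 1)) (hQP : ∀ i, i + 1 < m → Q i → ¬ P (i + 1)) :
    (∀ i < m, P i) ∨ ∀ i < m, Q i := by
  induction m with
  | zero => exact .inl fun i hi => absurd hi (Nat.not_lt_zero i)
  | succ m ih =>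
    have hm := h m (Nat.lt_succ_self m)
    rcases Nat.eq_zero_or_pos m with rfl | hpos
    · simpa only [zero_add, Nat.lt_one_iff, forall_eq] using hm
    obtain ⟨l, rfl⟩ : ∃ l, m = l + 1 := ⟨m - 1, by omega⟩
    rcases ih (fun i hi => h i (by omega)) (fun i hi => hPQ i (by omega))
      (fun i hi => hQP i (by omega)) with hP | hQ
    · exact .inl (Nat.forall_lt_succ_right.2
        ⟨hP, hm.resolve_right (hPQ l (by omega) (hP l (by omega)))⟩)
    · exact .inr (Nat.forall_lt_succ_right.2
        ⟨hQ, hm.resolve_left (hQP l (by omega) (hQ l (by omega)))⟩)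

namespace TokenSystem

variable {S : TokenSystem} {f : ℕ → ℕ}

/-- The states `q 0, …, q m` follow each other, and the `m` blocks that two consecutive ones share
have no node in common. -/
structure IsChain (S : TokenSystem) (q : ℕ → ℕ) (m : ℕ) : Prop where
  follows : ∀ i < m, S.Follows (q i) (q (i + 1))
  block_injective : ∀ i < m, ∀ j < m, ∀ l < S.d, ∀ l' < S.d,
    S.element (q i) (S.d + l) = S.element (q j) (S.d + l') → i = j

/-- `IsChain` indexed by the layers that are visited for certain: `σ j` is a state in layer `j`. -/
structure IsRun (S : TokenSystem) (σ : ℕ → ℕ) : Prop where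
  valid : ∀ j, 3 ≤ j → j + 4 ≤ S.numLayers → S.Valid (σ j)
  layer_eq : ∀ j, 3 ≤ j → j + 4 ≤ S.numLayers → S.layer (σ j) = j
  follows : ∀ j, 3 ≤ j → j + 5 ≤ S.numLayers → S.Follows (σ j) (σ (j + 1))
  block_injective : ∀ i, 3 ≤ i → i + 5 ≤ S.numLayers → ∀ j, 3 ≤ j → j + 5 ≤ S.numLayers →
    ∀ l < S.d, ∀ l' < S.d, S.element (σ i) (S.d + l) = S.element (σ j) (S.d + l') → i = j

section Path

theorem IsTransition.exists_between {a i q q' : ℕ} (h : S.IsTransition f a q q') (hi : i < S.d)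
    (ha : S.offset ≤ f a) (ha' : S.offset ≤ f (a + S.d + 1)) :
    ∃ x, a < x ∧ x < a + S.d + 1 ∧ f x = S.element q (S.d + i) := by
  have hmem : S.element q (S.d + i) ∈ S.window f a := by
    rw [h.2]
    simp only [pairSet, Finset.mem_insert, Finset.mem_image, Finset.mem_range]
    exact .inr (.inr ⟨i, hi, rfl⟩)
  obtain ⟨x, hax, hxa, hx⟩ := mem_window.1 hmem
  have hlt := h.1.element_lt hi
  refine ⟨x, lt_of_le_of_ne hax ?_, lt_of_le_of_ne hxa ?_, hx⟩
  · rintro rfl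
    omega
  · rintro rfl
    omega

section Spaced

variable {a m : ℕ}

theorem spaced_succ_le (hm : a + m * (S.d + 1) + 1 ≤ S.pathLen) {i : ℕ} (hi : i < m) :
    a + i * (S.d + 1) + (S.d + 2) ≤ S.pathLen := by
  have hle : (i + 1) * (S.d + 1) ≤ m * (S.d + 1) := Nat.mul_le_mul_right _ hi
  rw [Nat.succ_mul] at hle
  omega

/-- The shared blocks lie in disjoint gaps between the states of the path. -/
theorem IsTransition.index_eq (hf : S.IsPath f) (hm : a + m * (S.d + 1) + 1 ≤ S.pathLen)
    (hs : ∀ i ≤ m, S.offset ≤ f (a + i * (S.d + 1))) {i j l l' q₁ q₂ q₁' q₂' : ℕ}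
    (hi : i < m) (hj : j < m) (h : S.IsTransition f (a + i * (S.d + 1)) q₁ q₂)
    (h' : S.IsTransition f (a + j * (S.d + 1)) q₁' q₂') (hl : l < S.d) (hl' : l' < S.d)
    (heq : S.element q₁ (S.d + l) = S.element q₁' (S.d + l')) : i = j := by
  have hgap : ∀ {i l q₁ q₂ : ℕ}, i < m → S.IsTransition f (a + i * (S.d + 1)) q₁ q₂ → l < S.d →
      ∃ x < S.pathLen, (x - a) / (S.d + 1) = i ∧ f x = S.element q₁ (S.d + l) := by
    intro i l q₁ q₂ hi h hl
    have hnext := hs (i + 1) hi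
    rw [Nat.succ_mul, ← add_assoc, ← add_assoc] at hnext
    have hik := spaced_succ_le hm hi
    obtain ⟨x, hax, hxa, hx⟩ := h.exists_between hl (hs i hi.le) hnext
    exact ⟨x, by omega, Nat.div_eq_of_lt_le (by omega) (by rw [Nat.succ_mul]; omega), hx⟩
  obtain ⟨x, hxk, rfl, hx⟩ := hgap hi h hl
  obtain ⟨x', hxk', rfl, hx'⟩ := hgap hj h' hl'
  rw [hf.1 x hxk x' hxk' (hx.trans (heq.trans hx'.symm))]

theorem IsPath.isTransition_all_or_all (hf : S.IsPath f)
    (hm : a + m * (S.d + 1) + 1 ≤ S.pathLen) (hs : ∀ i ≤ m, S.offset ≤ f (a + i * (S.d + 1))) :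
    (∀ i < m, S.IsTransition f (a + i * (S.d + 1)) (f (a + i * (S.d + 1)) - S.offset)
      (f (a + (i + 1) * (S.d + 1)) - S.offset)) ∨
    ∀ i < m, S.IsTransition f (a + i * (S.d + 1)) (f (a + (i + 1) * (S.d + 1)) - S.offset)
      (f (a + i * (S.d + 1)) - S.offset) := by
  refine forall_or_forall_of_no_switch (fun i hi => ?_) (fun i hi h h' => ?_) fun i hi h h' => ?_
  · have hsucc : (i + 1) * (S.d + 1) = i * (S.d + 1) + S.d + 1 := by ring
    exact hf.isTransition_or (spaced_succ_le hm hi) le_rfl (by omega) (by omega)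
      (hs i hi.le) (hs (i + 1) hi)
  -- At a turn, the blocks in front of and behind the middle state would coincide.
  · have := h.index_eq hf hm hs (by omega) hi h' S.d_pos S.d_pos
      ((h.1.element_eq S.d_pos).symm.trans (h'.1.element_eq S.d_pos))
    omega
  · have := h.index_eq hf hm hs (by omega) hi h' S.d_pos S.d_pos rfl
    omega

theorem IsPath.exists_isChain_of_spaced (hf : S.IsPath f)
    (hm : a + m * (S.d + 1) + 1 ≤ S.pathLen) (hs : ∀ i ≤ m, S.offset ≤ f (a + i * (S.d + 1))) :
    ∃ q, S.IsChain q m := by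
  rcases hf.isTransition_all_or_all hm hs with h | h
  · exact ⟨fun i => f (a + i * (S.d + 1)) - S.offset, fun i hi => (h i hi).1,
      fun i hi j hj l hl l' hl' heq => (h i hi).index_eq hf hm hs hi hj (h j hj) hl hl' heq⟩
  · have hrev : ∀ i < m, m - i = m - (i + 1) + 1 := fun i hi => by omega
    refine ⟨fun i => f (a + (m - i) * (S.d + 1)) - S.offset, fun i hi => ?_,
      fun i hi j hj l hl l' hl' heq => ?_⟩
    · rw [hrev i hi]
      exact (h (m - (i + 1)) (by omega)).1
    · rw [hrev i hi, hrev j hj] at heq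
      have := (h (m - (i + 1)) (by omega)).index_eq hf hm hs (by omega) (by omega)
        (h (m - (j + 1)) (by omega)) hl hl' heq
      omega

end Spaced

theorem IsPath.exists_isChain (hf : S.IsPath f) : ∃ q, S.IsChain q (S.numLayers - 4) := by
  obtain ⟨a, hm, hs⟩ := hf.exists_spaced_states
  exact hf.exists_isChain_of_spaced hm hs

end Path

theorem IsChain.layer_eq {q : ℕ → ℕ} {m i : ℕ} (h : S.IsChain q m) (hi : i ≤ m) :
    S.layer (q i) = S.layer (q 0) + i := by
  induction i with
  | zero => rfl
  | succ i ih => rw [(h.follows i hi).layer_eq, ih (by omega), add_assoc]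

theorem IsChain.valid {q : ℕ → ℕ} {m i : ℕ} (h : S.IsChain q m) (hm : 0 < m) (hi : i ≤ m) :
    S.Valid (q i) := by
  cases i with
  | zero => exact (h.follows 0 hm).1
  | succ i => exact (h.follows i hi).2.1

theorem IsChain.isRun {q : ℕ → ℕ} (h : S.IsChain q (S.numLayers - 4)) :
    S.IsRun fun j => q (j - S.layer (q 0)) := by
  have hlayers : 8 ≤ S.numLayers := Nat.le_add_left _ _
  have hstart : S.layer (q 0) ≤ 3 := by
    have hlast := layer_lt (h.valid (by omega) le_rfl)
    rw [h.layer_eq le_rfl] at hlast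
    omega
  refine ⟨fun j _ hj' => h.valid (by omega) (by omega), fun j hj hj' => ?_, fun j hj hj' => ?_,
    fun i hi hi' j hj hj' l hl l' hl' heq => ?_⟩
  · rw [h.layer_eq (by omega)]
    omega
  · rw [show j + 1 - S.layer (q 0) = j - S.layer (q 0) + 1 by omega]
    exact h.follows _ (by omega)
  · have := h.block_injective _ (by omega) _ (by omega) l hl l' hl' heq
    omega

section Run

variable {σ : ℕ → ℕ}

/-- The token of a run at position `g`. -/
def runToken (S : TokenSystem) (σ : ℕ → ℕ) (g : ℕ) : ℕ := S.token (σ (g / S.d)) (g % S.d)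

theorem block_bounds {g : ℕ} (hg : 3 * S.d ≤ g) (hg' : g < (S.numLayers - 3) * S.d) :
    3 ≤ g / S.d ∧ g / S.d + 4 ≤ S.numLayers := by
  have := (Nat.le_div_iff_mul_le S.d_pos).2 hg
  have := (Nat.div_lt_iff_lt_mul S.d_pos).2 hg'
  omega

theorem IsRun.occupied_iff (h : S.IsRun σ) {g : ℕ} (hg : 3 * S.d ≤ g)
    (hg' : g < (S.numLayers - 3) * S.d) : S.Occupied g ↔ S.runToken σ g < S.numTokens := by
  obtain ⟨hj, hj'⟩ := block_bounds hg hg'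
  have hiff := (h.valid _ hj hj').2.1 (g % S.d)
    ((Nat.mod_lt g S.d_pos).trans_le (Nat.le_mul_of_pos_left _ two_pos))
  rwa [h.layer_eq _ hj hj', Nat.div_add_mod'] at hiff

theorem IsRun.link (h : S.IsRun σ) {g : ℕ} (hg : 3 * S.d ≤ g)
    (hg' : g + 1 < (S.numLayers - 3) * S.d) :
    S.Link (S.runToken σ g) (S.runToken σ (g + 1)) := by
  have hd := S.d_pos
  obtain ⟨hj, hj'⟩ := block_bounds hg (by omega)
  obtain ⟨-, hnext⟩ := block_bounds (g := g + 1) (by omega) hg'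
  have hlt := Nat.mod_lt g hd
  have hlink := (h.valid _ hj hj').2.2.1 (g % S.d) (by omega)
  rcases Nat.lt_or_ge (g % S.d + 1) S.d with hin | hend
  · have hmod : (g + 1) % S.d = g % S.d + 1 := by
      rw [← Nat.mod_add_mod, Nat.mod_eq_of_lt hin]
    have hdiv : (g + 1) / S.d = g / S.d :=
      Nat.succ_div_of_not_dvd fun hdvd => by rw [Nat.mod_eq_zero_of_dvd hdvd] at hmod; omega
    rwa [runToken, runToken, hdiv, hmod]
  · have hmod : g % S.d + 1 = S.d + 0 := by omega
    have hdvd : S.d ∣ g + 1 := ⟨g / S.d + 1, by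
      have := Nat.div_add_mod g S.d
      rw [mul_add]
      omega⟩
    rw [Nat.succ_div_of_dvd hdvd] at hnext
    rwa [runToken, runToken, Nat.succ_div_of_dvd hdvd, Nat.mod_eq_zero_of_dvd hdvd,
      (h.follows _ hj (by omega)).token_eq hd, ← hmod]

theorem IsRun.element_eq_label (h : S.IsRun σ) {g : ℕ} (hg : S.Occupied g) :
    S.element (σ (g / S.d)) (g % S.d) = S.label (S.runToken σ g) := by
  have hlo := hg.1
  have hhi := occupied_lt hg
  obtain ⟨hj, hj'⟩ := block_bounds (S := S) (g := g) (by omega) (by omega)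
  rw [element, h.layer_eq _ hj hj', Nat.div_add_mod', elementNode]
  exact if_pos ((h.occupied_iff (by omega) (by omega)).1 hg)

theorem IsRun.label_injective (h : S.IsRun σ) {g g' : ℕ} (hg : S.Occupied g)
    (hg' : S.Occupied g') (heq : S.label (S.runToken σ g) = S.label (S.runToken σ g')) :
    g = g' := by
  have hprev : ∀ {g}, S.Occupied g → 4 ≤ g / S.d ∧ g / S.d + 4 ≤ S.numLayers ∧
      S.element (σ (g / S.d - 1)) (S.d + g % S.d) = S.label (S.runToken σ g) := by
    intro g hg
    have hlo := hg.1
    have hhi := occupied_lt hg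
    have hj := (Nat.le_div_iff_mul_le S.d_pos).2 hlo
    obtain ⟨-, hj'⟩ := block_bounds (S := S) (g := g) (by omega) (by omega)
    have hs := h.follows (g / S.d - 1) (by omega) (by omega)
    rw [show g / S.d - 1 + 1 = g / S.d by omega] at hs
    exact ⟨hj, hj', by rw [← hs.element_eq (Nat.mod_lt g S.d_pos), h.element_eq_label hg]⟩
  obtain ⟨hj, hj', hlab⟩ := hprev hg
  obtain ⟨hi, hi', hlab'⟩ := hprev hg'
  have hdiv : g / S.d = g' / S.d := by
    have := h.block_injective _ (by omega) (by omega) _ (by omega) (by omega) _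
      (Nat.mod_lt g S.d_pos) _ (Nat.mod_lt g' S.d_pos) (hlab.trans (heq.trans hlab'.symm))
    omega
  have hmod : g % S.d = g' % S.d := by
    rw [← h.element_eq_label hg, ← h.element_eq_label hg', ← hdiv] at heq
    have hlt := Nat.mod_lt g S.d_pos
    have hlt' := Nat.mod_lt g' S.d_pos
    exact element_injective (h.valid _ (by omega) hj') (by omega) (by omega) heq
  rw [← Nat.div_add_mod' g S.d, ← Nat.div_add_mod' g' S.d, hdiv, hmod]

theorem IsRun.exists_isWalk (h : S.IsRun σ) : ∃ τ, S.IsWalk τ := by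
  classical
  set τ : ℕ → ℕ := fun g => if S.Occupied g then S.runToken σ g else S.numTokens
  have hτ_occ : ∀ g, S.Occupied g → τ g = S.runToken σ g := fun g hg => if_pos hg
  have hτ_pad : ∀ g, ¬ S.Occupied g → τ g = S.numTokens := fun g hg => if_neg hg
  have hτ_run : ∀ g, 3 * S.d ≤ g → g < (S.numLayers - 3) * S.d → τ g = S.runToken σ g := by
    intro g hg hg'
    by_cases hocc : S.Occupied g
    · exact hτ_occ g hocc
    · have hge := (h.occupied_iff hg hg').not.1 hocc
      rw [hτ_pad g hocc]
      exact le_antisymm (not_lt.1 hge) (token_le _ _)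
  refine ⟨τ, fun g hg => ?_, hτ_pad, fun g => ?_, fun g g' hg hg' heq => ?_⟩
  · have hlo := hg.1
    have hhi := occupied_lt hg
    rw [hτ_occ g hg]
    exact (h.occupied_iff (by omega) (by omega)).1 hg
  · by_cases hocc : S.Occupied g ∨ S.Occupied (g + 1)
    · have hrange : 3 * S.d ≤ g ∧ g + 1 < (S.numLayers - 3) * S.d := by
        have := S.d_pos
        rcases hocc with hg | hg <;> have hlo := hg.1 <;> have hhi := occupied_lt hg <;> omega
      rw [hτ_run g hrange.1 (by omega), hτ_run (g + 1) (by omega) hrange.2]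
      exact h.link hrange.1 hrange.2
    · rw [not_or] at hocc
      rw [hτ_pad g hocc.1, hτ_pad (g + 1) hocc.2]
      exact .inr ⟨S.mark_numTokens, S.mark_numTokens_succ⟩
  · rw [hτ_occ g hg, hτ_occ g' hg'] at heq
    exact h.label_injective hg hg' heq

end Run

theorem IsPath.exists_isWalk (hf : S.IsPath f) : ∃ τ, S.IsWalk τ := by
  obtain ⟨q, hq⟩ := hf.exists_isChain
  exact hq.isRun.exists_isWalk

end TokenSystem

theorem length_flatMap_range_le {α : Type*} {f : ℕ → List α} {b : ℕ} (hf : ∀ x, (f x).length ≤ b)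
    (m : ℕ) : ((List.range m).flatMap f).length ≤ m * b := by
  rw [List.length_flatMap]
  refine (List.sum_le_card_nsmul _ b fun x hx => ?_).trans_eq ?_
  · obtain ⟨y, -, rfl⟩ := List.mem_map.1 hx
    exact hf y
  · rw [List.length_map, List.length_range, smul_eq_mul]

namespace TokenSystem

variable {S : TokenSystem}

/-! ### The list of hyperedges -/

theorem next_injective (q : ℕ) : Function.Injective (S.next q) := fun a a' h => by
  unfold next at h
  exact Nat.eq_of_mul_eq_mul_right (pow_pos (base_pos (S := S)) S.d) (by omega)

theorem next_ne {q a : ℕ} (ha : a < S.base ^ S.d) : S.next q a ≠ q := fun h => by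
  have := layer_next (q := q) ha
  rw [h] at this
  omega

theorem offset_add_notMem_map_element {l m q y : ℕ} (hq : S.Valid q) (hlm : l + m ≤ 2 * S.d) :
    S.offset + y ∉ (List.range m).map fun i => S.element q (l + i) := by
  rw [List.mem_map]
  rintro ⟨i, hi, h⟩
  have := List.mem_range.1 hi
  have := element_lt hq (show l + i < 2 * S.d by omega)
  omega

theorem nodup_map_element {l m q : ℕ} (hq : S.Valid q) (hlm : l + m ≤ 2 * S.d) :
    ((List.range m).map fun i => S.element q (l + i)).Nodup :=
  List.nodup_range.map_on fun x hx y hy h => by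
    have := List.mem_range.1 hx
    have := List.mem_range.1 hy
    have := element_injective hq (by omega) (by omega) h
    omega

theorem offset_add_mem_edge₁ {q u y : ℕ} (hq : S.Valid q) (hu : u < S.d) :
    S.offset + y ∈ S.edge₁ q u ↔ y = q := by
  rw [edge₁, List.mem_cons, or_iff_left (offset_add_notMem_map_element hq (by omega)),
    Nat.add_left_cancel_iff]

theorem offset_add_mem_edge₂ {q a y : ℕ} (hq : S.Valid q) :
    S.offset + y ∈ S.edge₂ q a ↔ y = q ∨ y = S.next q a := by
  rw [edge₂, List.mem_cons, List.mem_cons,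
    or_iff_left (offset_add_notMem_map_element hq (by omega)), Nat.add_left_cancel_iff,
    Nat.add_left_cancel_iff]

theorem nodup_edge₁ {q u : ℕ} (hq : S.Valid q) (hu : u < S.d) : (S.edge₁ q u).Nodup :=
  List.nodup_cons.2 ⟨offset_add_notMem_map_element hq (by omega), nodup_map_element hq (by omega)⟩

theorem nodup_edge₂ {q a : ℕ} (hq : S.Valid q) (ha : a < S.base ^ S.d) : (S.edge₂ q a).Nodup := by
  refine List.nodup_cons.2 ⟨fun h => ?_, List.nodup_cons.2
    ⟨offset_add_notMem_map_element hq (by omega), nodup_map_element hq (by omega)⟩⟩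
  rcases List.mem_cons.1 h with h | h
  · exact next_ne ha (Nat.add_left_cancel h).symm
  · exact offset_add_notMem_map_element hq (by omega) h

theorem nodup_of_mem_edges {e : List ℕ} (he : e ∈ S.edges) : e.Nodup := by
  rcases mem_edges.1 he with ⟨q, u, hq, hu, rfl⟩ | ⟨q, a, hq, ha, -, rfl⟩
  · exact nodup_edge₁ hq hu
  · exact nodup_edge₂ hq ha

theorem length_of_mem_edges {e : List ℕ} (he : e ∈ S.edges) : e.length = S.d + 2 := by
  rcases mem_edges.1 he with ⟨q, u, -, -, rfl⟩ | ⟨q, a, -, -, -, rfl⟩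
  · rw [edge₁, List.length_cons, List.length_map, List.length_range]
  · rw [edge₂, List.length_cons, List.length_cons, List.length_map, List.length_range]

theorem length_flatten_edges : S.edges.flatten.length = S.edges.length * (S.d + 2) := by
  rw [List.length_flatten, List.sum_eq_card_nsmul _ (S.d + 2), List.length_map, smul_eq_mul]
  exact List.forall_mem_map.2 fun e he => length_of_mem_edges he

theorem lt_of_mem_edges {e : List ℕ} (he : e ∈ S.edges) {y : ℕ} (hy : y ∈ e) :
    y < S.offset + S.numStates := by
  rcases lt_or_ge y S.offset with h | h
  · exact Nat.lt_add_right _ h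
  · obtain ⟨p, rfl⟩ := Nat.exists_eq_add_of_le h
    refine Nat.add_lt_add_left ?_ _
    rcases mem_edges.1 he with ⟨q, u, hq, hu, rfl⟩ | ⟨q, a, hq, -, hnext, rfl⟩
    · exact (offset_add_mem_edge₁ hq hu).1 hy ▸ hq.1
    · rcases (offset_add_mem_edge₂ hq).1 hy with rfl | rfl
      · exact hq.1
      · exact hnext.1

theorem le_of_edge₁_subset {q u u' : ℕ} (hq : S.Valid q) (hu : u < S.d) (hu' : u' < S.d)
    (h : S.edge₁ q u ⊆ S.edge₁ q u') : u' ≤ u := by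
  have hmem : S.element q u ∈ S.edge₁ q u' := h <| List.mem_cons_of_mem _ <|
    List.mem_map.2 ⟨0, List.mem_range.2 (by omega), rfl⟩
  rcases List.mem_cons.1 hmem with h' | h'
  · have := element_lt hq (show u < 2 * S.d by omega)
    omega
  · obtain ⟨i, hi, h'⟩ := List.mem_map.1 h'
    have := List.mem_range.1 hi
    have := element_injective hq (by omega) (by omega) h'
    omega

theorem not_edge₂_subset_edge₁ {q u q' a : ℕ} (hq : S.Valid q) (hu : u < S.d) (hq' : S.Valid q')
    (ha : a < S.base ^ S.d) : ¬ S.edge₂ q' a ⊆ S.edge₁ q u := fun h => by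
  have h₁ := (offset_add_mem_edge₁ hq hu).1 (h ((offset_add_mem_edge₂ hq').2 (.inl rfl)))
  have h₂ := (offset_add_mem_edge₁ hq hu).1 (h ((offset_add_mem_edge₂ hq').2 (.inr rfl)))
  exact next_ne ha (h₂.trans h₁.symm)

theorem edge₂_eq_of_subset {q a q' a' : ℕ} (hq : S.Valid q) (ha : a < S.base ^ S.d)
    (hq' : S.Valid q') (ha' : a' < S.base ^ S.d) (h : S.edge₂ q a ⊆ S.edge₂ q' a') :
    S.edge₂ q a = S.edge₂ q' a' := by
  have h₁ := (offset_add_mem_edge₂ hq').1 (h ((offset_add_mem_edge₂ hq).2 (.inl rfl)))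
  have h₂ := (offset_add_mem_edge₂ hq').1 (h ((offset_add_mem_edge₂ hq).2 (.inr rfl)))
  have hlayer := layer_next (q := q) ha
  have hlayer' := layer_next (q := q') ha'
  rcases h₁ with rfl | h₁
  · rcases h₂ with h₂ | h₂
    · exact absurd h₂ (next_ne ha)
    · rw [edge₂, edge₂, h₂]
  · rw [← h₁] at hlayer'
    rcases h₂ with h₂ | h₂
    · rw [h₂] at hlayer
      omega
    · exact absurd (h₂.trans h₁.symm) (next_ne ha)

theorem toFinset_injOn_edges : Set.InjOn List.toFinset {e | e ∈ S.edges} := by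
  intro e he e' he' h
  have hsub : e ⊆ e' := fun y hy => List.mem_toFinset.1 (h ▸ List.mem_toFinset.2 hy)
  have hsub' : e' ⊆ e := fun y hy => List.mem_toFinset.1 (h ▸ List.mem_toFinset.2 hy)
  rcases mem_edges.1 he with ⟨q, u, hq, hu, rfl⟩ | ⟨q, a, hq, ha, -, rfl⟩ <;>
    rcases mem_edges.1 he' with ⟨q', u', hq', hu', rfl⟩ | ⟨q', a', hq', ha', -, rfl⟩
  · obtain rfl : q = q' :=
      (offset_add_mem_edge₁ hq' hu').1 (hsub ((offset_add_mem_edge₁ hq hu).2 rfl))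
    rw [le_antisymm (le_of_edge₁_subset hq hu' hu hsub') (le_of_edge₁_subset hq hu hu' hsub)]
  · exact absurd hsub' (not_edge₂_subset_edge₁ hq hu hq' ha')
  · exact absurd hsub (not_edge₂_subset_edge₁ hq' hu' hq ha)
  · exact edge₂_eq_of_subset hq ha hq' ha' hsub

theorem head?_of_mem_edgesAt {q : ℕ} {e : List ℕ} (he : e ∈ S.edgesAt q) :
    e.head? = some (S.offset + q) := by
  rcases (mem_edgesAt.1 he).2 with ⟨u, -, rfl⟩ | ⟨a, -, -, rfl⟩
  · rfl
  · rfl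

theorem nodup_map_edge₁ {q : ℕ} (hq : S.Valid q) : ((List.range S.d).map (S.edge₁ q)).Nodup :=
  List.nodup_range.map_on fun u hu u' hu' h => by
    rw [List.mem_range] at hu hu'
    exact le_antisymm (le_of_edge₁_subset hq hu' hu (h ▸ List.Subset.refl _))
      (le_of_edge₁_subset hq hu hu' (h ▸ List.Subset.refl _))

theorem nodup_flatMap_edgesNext (q : ℕ) :
    ((List.range (S.base ^ S.d)).flatMap (S.edgesNext q)).Nodup := by
  refine List.nodup_flatMap.2 ⟨fun a _ => ?_, List.nodup_range.imp fun hne => ?_⟩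
  · rw [edgesNext]
    split_ifs
    · exact List.nodup_singleton _
    · exact List.nodup_nil
  · intro e he he'
    have h := (mem_edgesNext.1 he).2.symm.trans (mem_edgesNext.1 he').2
    simp only [edge₂, List.cons.injEq, add_right_inj] at h
    exact hne (next_injective q h.2.1)

theorem nodup_edgesAt (q : ℕ) : (S.edgesAt q).Nodup := by
  rw [edgesAt]
  split_ifs with hq
  · refine List.nodup_append'.2 ⟨nodup_map_edge₁ hq, nodup_flatMap_edgesNext q, fun e he he' => ?_⟩
    obtain ⟨u, hu, rfl⟩ := List.mem_map.1 he
    obtain ⟨a, ha, he'⟩ := List.mem_flatMap.1 he'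
    exact not_edge₂_subset_edge₁ hq (List.mem_range.1 hu) hq (List.mem_range.1 ha)
      ((mem_edgesNext.1 he').2 ▸ List.Subset.refl _)
  · exact List.nodup_nil

theorem nodup_edges : S.edges.Nodup := by
  refine List.nodup_flatMap.2 ⟨fun q _ => nodup_edgesAt q, List.nodup_range.imp fun hne => ?_⟩
  intro e he he'
  have h := (head?_of_mem_edgesAt he).symm.trans (head?_of_mem_edgesAt he')
  exact hne (Nat.add_left_cancel (Option.some.inj h))

theorem length_edges_le : S.edges.length ≤ S.numStates * (S.d + S.base ^ S.d) := by
  refine length_flatMap_range_le (fun q => ?_) _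
  have hnext : ∀ a, (S.edgesNext q a).length ≤ 1 := fun a => by
    rw [edgesNext]
    split_ifs <;> simp
  rw [edgesAt]
  split_ifs
  · rw [List.length_append, List.length_map, List.length_range]
    have := length_flatMap_range_le hnext (S.base ^ S.d)
    omega
  · exact Nat.zero_le _

end TokenSystem

namespace TokenSystem

variable {S : TokenSystem}

/-! ### The tight path of a walk -/

/-- The code of the sequence `a 0, …, a (m - 1)` of tokens. -/
def encode (S : TokenSystem) (a : ℕ → ℕ) (m : ℕ) : ℕ := ∑ i ∈ Finset.range m, a i * S.base ^ i

theorem encode_lt {a : ℕ → ℕ} (ha : ∀ i, a i ≤ S.numTokens) (m : ℕ) :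
    S.encode a m < S.base ^ m := by
  induction m with
  | zero => exact Nat.one_pos
  | succ m ih =>
    have := Nat.mul_le_mul_right (S.base ^ m) (ha m)
    rw [encode, Finset.sum_range_succ, ← encode, pow_succ, base, mul_add_one, ← base]
    linarith

theorem encode_add (a : ℕ → ℕ) (m l : ℕ) :
    S.encode a (m + l) = S.encode a m + S.encode (fun i => a (m + i)) l * S.base ^ m := by
  rw [encode, encode, encode, Finset.sum_range_add, Finset.sum_mul]
  refine congrArg _ (Finset.sum_congr rfl fun i _ => ?_)
  rw [pow_add]
  ring

theorem digit_encode {a : ℕ → ℕ} (ha : ∀ i, a i ≤ S.numTokens) {m i : ℕ} (hi : i < m) :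
    S.digit (S.encode a m) i = a i := by
  induction m with
  | zero => exact absurd hi (Nat.not_lt_zero i)
  | succ m ih =>
    have hsucc : S.encode a (m + 1) = S.encode a m + a m * S.base ^ m := Finset.sum_range_succ _ _
    rcases Nat.lt_succ_iff_lt_or_eq.1 hi with hi | rfl
    · rw [hsucc, ← digit_mod hi, Nat.add_mul_mod_self_right, digit_mod hi, ih hi]
    · rw [hsucc, digit, Nat.add_mul_div_right _ _ (pow_pos base_pos _),
        Nat.div_eq_of_lt (encode_lt ha _), zero_add,
        Nat.mod_eq_of_lt (show a i < S.base from Nat.lt_succ_of_le (ha i))]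

section Walk

variable {τ : ℕ → ℕ}

/-- The state of the walk `τ` after block `j`. -/
def walkState (S : TokenSystem) (τ : ℕ → ℕ) (j : ℕ) : ℕ :=
  j * S.base ^ (2 * S.d) + S.encode (fun i => τ (j * S.d + i)) (2 * S.d)

/-- The element node of the walk `τ` at position `g`. -/
def walkNode (S : TokenSystem) (τ : ℕ → ℕ) (g : ℕ) : ℕ := S.elementNode g (τ g)

/-- The tight path of the walk `τ`: each block of `d` element nodes is followed by a state. -/
def walkPath (S : TokenSystem) (τ : ℕ → ℕ) (x : ℕ) : ℕ :=
  if x % (S.d + 1) < S.d then S.walkNode τ (x / (S.d + 1) * S.d + x % (S.d + 1))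
  else S.offset + S.walkState τ (x / (S.d + 1))

theorem IsWalk.le (h : S.IsWalk τ) (g : ℕ) : τ g ≤ S.numTokens := by
  by_cases hg : S.Occupied g
  · exact (h.lt g hg).le
  · exact (h.eq_numTokens g hg).le

theorem IsWalk.occupied_iff (h : S.IsWalk τ) {g : ℕ} : S.Occupied g ↔ τ g < S.numTokens :=
  ⟨h.lt g, fun hlt => by_contra fun hg => hlt.ne (h.eq_numTokens g hg)⟩

theorem IsWalk.walkNode_injective (h : S.IsWalk τ) : Function.Injective (S.walkNode τ) := by
  intro g g' he
  simp only [walkNode, elementNode] at he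
  split_ifs at he with hg hg' hg'
  · exact h.label_injOn g g' (h.occupied_iff.2 hg) (h.occupied_iff.2 hg') he
  · have := S.label_lt _ hg
    omega
  · have := S.label_lt _ hg'
    omega
  · omega

theorem walkNode_lt {g : ℕ} (hg : g < (S.numLayers + 1) * S.d) : S.walkNode τ g < S.offset :=
  elementNode_lt hg

theorem IsWalk.layer_walkState (h : S.IsWalk τ) (j : ℕ) : S.layer (S.walkState τ j) = j :=
  layer_mul_add (encode_lt (fun _ => h.le _) _)

theorem IsWalk.code_walkState (h : S.IsWalk τ) (j : ℕ) :
    S.code (S.walkState τ j) = S.encode (fun i => τ (j * S.d + i)) (2 * S.d) :=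
  code_mul_add (encode_lt (fun _ => h.le _) _)

theorem IsWalk.token_walkState (h : S.IsWalk τ) (j : ℕ) {i : ℕ} (hi : i < 2 * S.d) :
    S.token (S.walkState τ j) i = τ (j * S.d + i) := by
  rw [token, h.code_walkState, digit_encode (fun _ => h.le _) hi]

theorem IsWalk.element_walkState (h : S.IsWalk τ) (j : ℕ) {i : ℕ} (hi : i < 2 * S.d) :
    S.element (S.walkState τ j) i = S.walkNode τ (j * S.d + i) := by
  rw [element, h.layer_walkState, h.token_walkState j hi, walkNode]

theorem IsWalk.walkState_lt (h : S.IsWalk τ) {j : ℕ} (hj : j < S.numLayers) :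
    S.walkState τ j < S.numStates := by
  have hcode := encode_lt (fun i => h.le (j * S.d + i)) (2 * S.d)
  calc S.walkState τ j < j * S.base ^ (2 * S.d) + S.base ^ (2 * S.d) := Nat.add_lt_add_left hcode _
    _ = (j + 1) * S.base ^ (2 * S.d) := (Nat.succ_mul _ _).symm
    _ ≤ S.numStates := Nat.mul_le_mul_right _ hj

theorem IsWalk.valid_walkState (h : S.IsWalk τ) {j : ℕ} (hj : j < S.numLayers) :
    S.Valid (S.walkState τ j) := by
  refine ⟨h.walkState_lt hj, fun i hi => ?_, fun i hi => ?_, fun i hi i' hi' he => ?_⟩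
  · rw [h.layer_walkState, h.token_walkState j hi, h.occupied_iff]
  · rw [h.token_walkState j (by omega), h.token_walkState j hi]
    exact h.link _
  · rw [h.element_walkState j hi, h.element_walkState j (by omega)] at he
    have := h.walkNode_injective he
    omega

theorem IsWalk.next_walkState (h : S.IsWalk τ) (j : ℕ) :
    S.next (S.walkState τ j) (S.encode (fun i => τ ((j + 2) * S.d + i)) S.d) =
      S.walkState τ (j + 1) := by
  have hshift : ∀ j i, j * S.d + (S.d + i) = (j + 1) * S.d + i := fun j i => by ring
  rw [next, h.layer_walkState, h.code_walkState, walkState, two_mul, encode_add, encode_add,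
    Nat.add_mul_div_right _ _ (pow_pos base_pos _),
    Nat.div_eq_of_lt (encode_lt (fun _ => h.le _) _), zero_add]
  simp only [hshift]

theorem walkPath_block (j : ℕ) {i : ℕ} (hi : i < S.d) :
    S.walkPath τ (j * (S.d + 1) + i) = S.walkNode τ (j * S.d + i) := by
  rw [walkPath, mul_comm, Nat.mul_add_div (Nat.succ_pos _), Nat.mul_add_mod,
    Nat.div_eq_of_lt (by omega), Nat.mod_eq_of_lt (by omega), if_pos hi, add_zero]

theorem walkPath_state (j : ℕ) :
    S.walkPath τ (j * (S.d + 1) + S.d) = S.offset + S.walkState τ j := by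
  rw [walkPath, mul_comm, Nat.mul_add_div (Nat.succ_pos _), Nat.mul_add_mod,
    Nat.div_eq_of_lt (by omega), Nat.mod_eq_of_lt (by omega), if_neg (lt_irrefl _), add_zero]

theorem pathLen_add_one : S.pathLen + 1 = (S.numLayers + 1) * (S.d + 1) :=
  Nat.sub_add_cancel (Nat.mul_pos (Nat.succ_pos _) (Nat.succ_pos _))

theorem block_or_state {x : ℕ} (hx : x < S.pathLen) :
    (∃ j i, i < S.d ∧ x = j * (S.d + 1) + i ∧ j * S.d + i < (S.numLayers + 1) * S.d) ∨
      ∃ j < S.numLayers, x = j * (S.d + 1) + S.d := by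
  have hlen := pathLen_add_one (S := S)
  obtain ⟨j, i, hi, rfl⟩ : ∃ j i, i ≤ S.d ∧ x = j * (S.d + 1) + i :=
    ⟨x / (S.d + 1), x % (S.d + 1), Nat.lt_succ_iff.1 (Nat.mod_lt _ (Nat.succ_pos _)),
      (Nat.div_add_mod' _ _).symm⟩
  have hj : j ≤ S.numLayers := by
    by_contra hj
    have := Nat.mul_le_mul_right (S.d + 1) (show S.numLayers + 1 ≤ j by omega)
    omega
  rcases hi.lt_or_eq with hi | rfl
  · have := Nat.mul_le_mul_right S.d (Nat.add_le_add_right hj 1)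
    rw [add_one_mul] at this
    exact .inl ⟨j, i, hi, rfl, by omega⟩
  · refine .inr ⟨j, hj.lt_of_ne ?_, rfl⟩
    rintro rfl
    rw [add_one_mul] at hlen
    omega

theorem IsWalk.walkPath_lt (h : S.IsWalk τ) {x : ℕ} (hx : x < S.pathLen) :
    S.walkPath τ x < S.offset + S.numStates := by
  rcases block_or_state hx with ⟨j, i, hi, rfl, hg⟩ | ⟨j, hj, rfl⟩
  · rw [walkPath_block j hi]
    exact Nat.lt_add_right _ (walkNode_lt hg)
  · rw [walkPath_state]
    exact Nat.add_lt_add_left (h.walkState_lt hj) _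

theorem IsWalk.walkPath_injOn (h : S.IsWalk τ) : Set.InjOn (S.walkPath τ) {x | x < S.pathLen} := by
  intro x hx y hy he
  rcases block_or_state hx with ⟨j, i, hi, rfl, hg⟩ | ⟨j, -, rfl⟩ <;>
    rcases block_or_state hy with ⟨j', i', hi', rfl, hg'⟩ | ⟨j', -, rfl⟩
  · rw [walkPath_block j hi, walkPath_block j' hi'] at he
    have he := h.walkNode_injective he
    obtain rfl : j = j' := by
      have := congrArg (· / S.d) he
      simpa only [mul_comm _ S.d, Nat.mul_add_div S.d_pos, Nat.div_eq_of_lt hi,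
        Nat.div_eq_of_lt hi', add_zero] using this
    omega
  · rw [walkPath_block j hi, walkPath_state] at he
    have := walkNode_lt (τ := τ) hg
    omega
  · rw [walkPath_block j' hi', walkPath_state] at he
    have := walkNode_lt (τ := τ) hg'
    omega
  · rw [walkPath_state, walkPath_state] at he
    rw [← h.layer_walkState j, ← h.layer_walkState j', Nat.add_left_cancel he]

theorem IsWalk.element_mem_window (h : S.IsWalk τ) {j u i : ℕ} (hui : u ≤ i)
    (hiu : i ≤ u + S.d) (hi : i < 2 * S.d) :
    S.element (S.walkState τ j) i ∈ S.window (S.walkPath τ) (j * (S.d + 1) + u) := by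
  rw [h.element_walkState j hi, mem_window]
  rcases lt_or_ge i S.d with hid | hid
  · exact ⟨j * (S.d + 1) + i, by omega, by omega, walkPath_block j hid⟩
  · obtain ⟨i, rfl⟩ := Nat.exists_eq_add_of_le hid
    refine ⟨(j + 1) * (S.d + 1) + i, ?_, ?_, ?_⟩
    · rw [add_one_mul]
      omega
    · rw [add_one_mul]
      omega
    · rw [walkPath_block (j + 1) (by omega), add_one_mul, add_assoc]

theorem walkState_mem_window {j u : ℕ} (hu : u ≤ S.d) :
    S.offset + S.walkState τ j ∈ S.window (S.walkPath τ) (j * (S.d + 1) + u) :=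
  mem_window.2 ⟨j * (S.d + 1) + S.d, by omega, by omega, walkPath_state j⟩

theorem window_eq_toFinset {f : ℕ → ℕ} {i : ℕ} {e : List ℕ} (he : e ∈ S.edges)
    (h : ∀ y ∈ e, y ∈ S.window f i) : S.window f i = e.toFinset := by
  refine (Finset.eq_of_subset_of_card_le (fun y hy => h y (List.mem_toFinset.1 hy)) ?_).symm
  rw [List.toFinset_card_of_nodup (nodup_of_mem_edges he), length_of_mem_edges he]
  exact Finset.card_image_le.trans_eq (by rw [Nat.card_Ico, Nat.add_sub_cancel_left])

theorem IsWalk.window_walkPath_of_lt (h : S.IsWalk τ) {j u : ℕ} (hj : j < S.numLayers)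
    (hu : u < S.d) : ∃ e ∈ S.edges, S.window (S.walkPath τ) (j * (S.d + 1) + u) = e.toFinset := by
  have he : S.edge₁ (S.walkState τ j) u ∈ S.edges :=
    mem_edges.2 (.inl ⟨_, u, h.valid_walkState hj, hu, rfl⟩)
  refine ⟨_, he, window_eq_toFinset he (List.forall_mem_cons.2 ⟨walkState_mem_window hu.le, ?_⟩)⟩
  refine List.forall_mem_map.2 fun i hi => ?_
  have := List.mem_range.1 hi
  exact h.element_mem_window (by omega) (by omega) (by omega)

theorem IsWalk.window_walkPath_eq (h : S.IsWalk τ) {j : ℕ} (hj : j + 1 < S.numLayers) :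
    ∃ e ∈ S.edges, S.window (S.walkPath τ) (j * (S.d + 1) + S.d) = e.toFinset := by
  have he : S.edge₂ (S.walkState τ j) (S.encode (fun i => τ ((j + 2) * S.d + i)) S.d) ∈ S.edges :=
    mem_edges.2 (.inr ⟨_, _, h.valid_walkState (by omega), encode_lt (fun _ => h.le _) _,
      (h.next_walkState j).symm ▸ h.valid_walkState hj, rfl⟩)
  refine ⟨_, he, window_eq_toFinset he (List.forall_mem_cons.2
    ⟨walkState_mem_window le_rfl, List.forall_mem_cons.2 ⟨?_, ?_⟩⟩)⟩
  · rw [h.next_walkState]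
    refine mem_window.2 ⟨(j + 1) * (S.d + 1) + S.d, ?_, ?_, walkPath_state (j + 1)⟩ <;>
    · rw [add_one_mul]
      omega
  · refine List.forall_mem_map.2 fun i hi => ?_
    have := List.mem_range.1 hi
    exact h.element_mem_window (by omega) (by omega) (by omega)

theorem IsWalk.isPath_walkPath (h : S.IsWalk τ) : S.IsPath (S.walkPath τ) := by
  refine ⟨fun x hx y hy he => h.walkPath_injOn hx hy he, fun x hx => ?_⟩
  have hlen := pathLen_add_one (S := S)
  rcases block_or_state (show x < S.pathLen by omega) with ⟨j, u, hu, rfl, -⟩ | ⟨j, -, rfl⟩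
  · refine h.window_walkPath_of_lt (lt_of_not_ge fun hj => ?_) hu
    have := Nat.mul_le_mul_right (S.d + 1) hj
    rw [add_one_mul] at hlen
    omega
  · refine h.window_walkPath_eq (lt_of_not_ge fun hj => ?_)
    have := Nat.mul_le_mul_right (S.d + 1) hj
    rw [add_one_mul] at hlen this
    omega

end Walk

end TokenSystem

/-! ## Exact covers and walks -/

theorem rel_getD_of_isChain {α : Type*} {R : α → α → Prop} {b : α} (hb : R b b) {l : List α} :
    ∀ {i : ℕ}, (l ++ [b]).IsChain R → R (l.getD i b) (l.getD (i + 1) b) := by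
  induction l with
  | nil => exact fun _ => hb
  | cons a l ih =>
    rintro (_ | i) h
    · cases l <;> exact h.rel
    · exact ih h.tail

namespace TokenSystem

variable {S : TokenSystem} {τ : ℕ → ℕ}

/-- The walk `τ` visits the token `t`. -/
def Visits (S : TokenSystem) (τ : ℕ → ℕ) (t : ℕ) : Prop := ∃ g, S.Occupied g ∧ τ g = t

theorem IsWalk.visits_of_lt (h : S.IsWalk τ) {g : ℕ} (hg : τ g < S.numTokens) :
    S.Visits τ (τ g) :=
  ⟨g, h.occupied_iff.2 hg, rfl⟩

theorem IsWalk.visits_succ_iff (h : S.IsWalk τ) {t : ℕ} (ht : t + 1 < S.numTokens)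
    (hmark : S.mark (t + 1) = 0) : S.Visits τ (t + 1) ↔ S.Visits τ t := by
  constructor
  · rintro ⟨g, hg, hgt⟩
    obtain ⟨g, rfl⟩ : ∃ g', g = g' + 1 := Nat.exists_eq_succ_of_ne_zero fun h0 => by
      have := hg.1
      have := S.d_pos
      omega
    rcases h.link g with ⟨-, hsucc⟩ | ⟨hne, -⟩
    · obtain rfl : τ g = t := by omega
      exact h.visits_of_lt (by omega)
    · exact absurd (hgt ▸ hmark) hne
  · rintro ⟨g, -, rfl⟩
    rcases h.link g with ⟨-, hsucc⟩ | ⟨-, hne⟩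
    · exact hsucc ▸ h.visits_of_lt (by omega)
    · exact absurd hmark hne

theorem IsWalk.exists_label_eq (h : S.IsWalk τ) {x : ℕ} (hx : x < S.n) :
    ∃ t < S.numTokens, S.Visits τ t ∧ S.label t = x := by
  have hocc : ∀ y : Fin S.n, S.Occupied (4 * S.d + y) := fun y =>
    ⟨Nat.le_add_right _ _, Nat.add_lt_add_left y.2 _⟩
  let F : Fin S.n → Fin S.n := fun y =>
    ⟨S.label (τ (4 * S.d + y)), S.label_lt _ (h.lt _ (hocc y))⟩
  have hF : Function.Injective F := fun y y' he => by
    have := h.label_injOn _ _ (hocc y) (hocc y') (congrArg Fin.val he)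
    exact Fin.ext (by omega)
  obtain ⟨y, hy⟩ := Finite.injective_iff_surjective.1 hF ⟨x, hx⟩
  exact ⟨_, h.lt _ (hocc y), ⟨_, hocc y, rfl⟩, congrArg Fin.val hy⟩

/-- The tokens of the list `l`, preceded and followed by padding. -/
def padded (S : TokenSystem) (l : List ℕ) (g : ℕ) : ℕ :=
  (S.numTokens :: l).getD (g + 1 - 4 * S.d) S.numTokens

theorem padded_of_occupied {l : List ℕ} (hlen : l.length = S.n) {g : ℕ} (hg : S.Occupied g) :
    ∃ h : g - 4 * S.d < l.length, S.padded l g = l[g - 4 * S.d] := by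
  obtain ⟨hg, hg'⟩ := hg
  refine ⟨by omega, ?_⟩
  rw [padded, show g + 1 - 4 * S.d = g - 4 * S.d + 1 by omega, List.getD_cons_succ,
    List.getD_eq_getElem _ _ (by omega)]

theorem padded_of_not_occupied {l : List ℕ} (hlen : l.length = S.n) {g : ℕ}
    (hg : ¬ S.Occupied g) : S.padded l g = S.numTokens := by
  rcases lt_or_ge g (4 * S.d) with h | h
  · rw [padded, Nat.sub_eq_zero_of_le h, List.getD_cons_zero]
  · have : 4 * S.d + S.n ≤ g := not_lt.1 fun h' => hg ⟨h, h'⟩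
    exact List.getD_eq_default _ _ (by rw [List.length_cons]; omega)

theorem isWalk_padded {l : List ℕ} (hlt : ∀ t ∈ l, t < S.numTokens) (hlen : l.length = S.n)
    (hlabel : (l.map S.label).Nodup)
    (hchain : (S.numTokens :: (l ++ [S.numTokens])).IsChain S.Link) : S.IsWalk (S.padded l) where
  lt g hg := by
    obtain ⟨h, he⟩ := padded_of_occupied hlen hg
    exact he ▸ hlt _ (List.getElem_mem h)
  eq_numTokens g hg := padded_of_not_occupied hlen hg
  link g := by
    have hpad : S.Link S.numTokens S.numTokens := .inr ⟨S.mark_numTokens, S.mark_numTokens_succ⟩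
    rcases lt_or_ge (g + 1) (4 * S.d) with h | h
    · rw [padded, padded, Nat.sub_eq_zero_of_le h.le, Nat.sub_eq_zero_of_le h]
      exact hpad
    · rw [padded, padded, Nat.sub_add_comm h]
      exact rel_getD_of_isChain hpad hchain
  label_injOn g g' hg hg' he := by
    obtain ⟨h, hgl⟩ := padded_of_occupied hlen hg
    obtain ⟨h', hgl'⟩ := padded_of_occupied hlen hg'
    rw [hgl, hgl'] at he
    have := (hlabel.getElem_inj_iff (i := g - 4 * S.d) (j := g' - 4 * S.d)
      (hi := by rwa [List.length_map]) (hj := by rwa [List.length_map])).1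
        (by rw [List.getElem_map, List.getElem_map, he])
    have := hg.1
    have := hg'.1
    omega

theorem isChain_range' {l : List ℕ} {m : ℕ} : ∀ {s : ℕ}, (∀ i < m, S.mark (s + i + 1) = 0) →
    ((s + m) :: l).IsChain S.Link → (s :: (List.range' (s + 1) m ++ l)).IsChain S.Link := by
  induction m with
  | zero => exact fun _ h => h
  | succ m ih =>
    intro s hmark h
    rw [List.range'_succ, List.cons_append, List.isChain_cons_cons]
    refine ⟨.inl ⟨hmark 0 (Nat.succ_pos _), rfl⟩, ih (fun i hi => ?_) ?_⟩
    · rw [add_right_comm s 1 i]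
      exact hmark (i + 1) (by omega)
    · rwa [add_right_comm s 1 m]

end TokenSystem

/-- A list of subsets of `{0, …, n - 1}`, each given by the list of its elements: the form in which
a machine sees an instance of Exact Cover. -/
structure SetList where
  n : ℕ
  sets : List (List ℕ)
  lt : ∀ l ∈ sets, ∀ x ∈ l, x < n
  nodup : ∀ l ∈ sets, l.Nodup

namespace SetList

variable (L : SetList)

/-- The `i`-th set, which is empty if the list has at most `i` sets. -/
def set (i : ℕ) : List ℕ := L.sets.getD i []

/-- There are pairwise disjoint sets in the list that cover `{0, …, n - 1}`. -/
def HasExactCover : Prop :=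
  ∃ D : Finset ℕ, (D : Set ℕ).Pairwise (fun i j => (L.set i).Disjoint (L.set j)) ∧
    ∀ x < L.n, ∃ i ∈ D, x ∈ L.set i

/-- The number of entries in front of the `i`-th set when all sets are written one after another. -/
def start (i : ℕ) : ℕ := (L.sets.take i).flatten.length

/-- The entry at position `t` when all sets are written one after another. -/
def label (t : ℕ) : ℕ := L.sets.flatten.getD t 0

open Classical in
/-- Marks the positions at which a set may begin or the list has ended; the position after the end
serves as padding. -/
noncomputable def mark (t : ℕ) : ℕ :=
  if (∃ i ≤ L.sets.length, t = L.start i) ∨ t = L.sets.flatten.length + 1 then 1 else 0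

variable {L} {i i' j j' t x : ℕ}

theorem nodup_set (i : ℕ) : (L.set i).Nodup := by
  rcases lt_or_ge i L.sets.length with h | h
  · rw [set, List.getD_eq_getElem _ _ h]
    exact L.nodup _ (List.getElem_mem h)
  · rw [set, List.getD_eq_default _ _ h]
    exact List.nodup_nil

theorem lt_length_of_mem_set (h : x ∈ L.set i) : i < L.sets.length := by
  by_contra! hi
  rw [set, List.getD_eq_default _ _ hi] at h
  exact List.not_mem_nil h

theorem start_succ (i : ℕ) : L.start (i + 1) = L.start i + (L.set i).length := by
  rcases lt_or_ge i L.sets.length with h | h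
  · rw [start, start, set, List.getD_eq_getElem _ _ h, List.take_add_one,
      List.getElem?_eq_getElem h, Option.toList_some, List.flatten_append, List.length_append,
      List.flatten_singleton]
  · rw [start, start, set, List.getD_eq_default _ _ h, List.take_of_length_le h,
      List.take_of_length_le (h.trans i.le_succ), List.length_nil, add_zero]

theorem start_mono : Monotone L.start :=
  monotone_nat_of_le_succ fun i => by rw [start_succ]; exact Nat.le_add_right _ _

theorem start_length : L.start L.sets.length = L.sets.flatten.length := by
  rw [start, List.take_length]

theorem start_succ_le (i : ℕ) : L.start (i + 1) ≤ L.sets.flatten.length :=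
  ((List.take_sublist _ _).flatten).length_le

theorem start_add_lt (hj : j < (L.set i).length) : L.start i + j < L.sets.flatten.length := by
  have := L.start_succ_le i
  rw [start_succ] at this
  omega

theorem start_add_inj (hj : j < (L.set i).length) (hj' : j' < (L.set i').length)
    (h : L.start i + j = L.start i' + j') : i = i' := by
  rcases lt_trichotomy i i' with hlt | rfl | hlt
  · have := L.start_mono (Nat.succ_le_of_lt hlt)
    rw [Nat.succ_eq_add_one, start_succ] at this
    omega
  · rfl
  · have := L.start_mono (Nat.succ_le_of_lt hlt)
    rw [Nat.succ_eq_add_one, start_succ] at this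
    omega

theorem exists_start_add (ht : t < L.sets.flatten.length) :
    ∃ i j, j < (L.set i).length ∧ t = L.start i + j := by
  suffices ∀ m, t < L.start m → ∃ i j, j < (L.set i).length ∧ t = L.start i + j from
    this L.sets.length (L.start_length ▸ ht)
  intro m
  induction m with
  | zero => intro h; exact absurd h (Nat.not_lt_zero t)
  | succ m ih =>
    intro h
    rw [start_succ] at h
    rcases lt_or_ge t (L.start m) with hlt | hge
    · exact ih hlt
    · exact ⟨m, t - L.start m, by omega, by omega⟩

theorem label_start_add (hj : j < (L.set i).length) : L.label (L.start i + j) = (L.set i)[j] := by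
  have hi : i < L.sets.length := lt_length_of_mem_set (List.getElem_mem hj)
  have hset : L.set i = L.sets[i] := List.getD_eq_getElem _ _ hi
  have hsplit : L.sets.flatten =
      (L.sets.take i).flatten ++ (L.set i ++ (L.sets.drop (i + 1)).flatten) := by
    rw [hset, ← List.flatten_cons, ← List.drop_eq_getElem_cons hi, ← List.flatten_append,
      List.take_append_drop]
  rw [label, hsplit, start, List.getD_append_right _ _ _ _ (Nat.le_add_right _ _),
    Nat.add_sub_cancel_left, List.getD_append _ _ _ _ hj, List.getD_eq_getElem _ _ hj]

theorem label_lt (ht : t < L.sets.flatten.length) : L.label t < L.n := by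
  rw [label, List.getD_eq_getElem _ _ ht]
  obtain ⟨l, hl, hx⟩ := List.mem_flatten.1 (List.getElem_mem ht)
  exact L.lt l hl _ hx

theorem mark_start (hi : i ≤ L.sets.length) : L.mark (L.start i) ≠ 0 := by
  rw [mark, if_pos (.inl ⟨i, hi, rfl⟩)]
  exact one_ne_zero

theorem mark_start_add_succ (hj : j + 1 < (L.set i).length) : L.mark (L.start i + j + 1) = 0 := by
  refine if_neg ?_
  rintro (⟨i', -, h⟩ | h)
  · rcases le_or_gt i' i with hle | hlt
    · have := L.start_mono hle
      omega
    · have := L.start_mono (Nat.succ_le_of_lt hlt)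
      rw [Nat.succ_eq_add_one, start_succ] at this
      omega
  · have := L.start_add_lt hj
    omega

variable (L)

/-- The token system whose tokens are the entries of all sets, written one after another. -/
noncomputable def tokens (d : ℕ) (hd : 0 < d) : TokenSystem where
  d := d
  n := L.n
  numTokens := L.sets.flatten.length
  label := L.label
  mark := L.mark
  d_pos := hd
  label_lt _ := label_lt
  label_numTokens := List.getD_eq_default _ _ le_rfl
  mark_numTokens := by
    rw [← start_length]
    exact mark_start le_rfl
  mark_numTokens_succ := by
    rw [mark, if_pos (.inr rfl)]
    exact one_ne_zero

variable {L} {d : ℕ} {hd : 0 < d} {τ : ℕ → ℕ}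

/-! ### From walks to exact covers -/

theorem visits_start_add_iff (h : (L.tokens d hd).IsWalk τ) (hj : j < (L.set i).length) :
    (L.tokens d hd).Visits τ (L.start i + j) ↔ (L.tokens d hd).Visits τ (L.start i) := by
  induction j with
  | zero => rfl
  | succ j ih =>
    exact (h.visits_succ_iff (t := L.start i + j) (start_add_lt hj) (mark_start_add_succ hj)).trans
      (ih (Nat.lt_of_succ_lt hj))

theorem hasExactCover_of_isWalk (h : (L.tokens d hd).IsWalk τ) : L.HasExactCover := by
  classical
  have visits : ∀ i, (L.tokens d hd).Visits τ (L.start i) → ∀ x ∈ L.set i,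
      ∃ j < (L.set i).length, ∃ g, (L.tokens d hd).Occupied g ∧ τ g = L.start i + j ∧
        (L.tokens d hd).label (τ g) = x := by
    intro i hi x hx
    obtain ⟨j, hj, rfl⟩ := List.getElem_of_mem hx
    obtain ⟨g, hg, hgτ⟩ := (visits_start_add_iff h hj).2 hi
    exact ⟨j, hj, g, hg, hgτ, hgτ ▸ label_start_add hj⟩
  refine ⟨(Finset.range L.sets.length).filter fun i => (L.tokens d hd).Visits τ (L.start i),
    fun i hi i' hi' hne => ?_, fun x hx => ?_⟩
  · refine List.disjoint_left.2 fun x hx hx' => ?_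
    obtain ⟨j, hj, g, hg, hgτ, hgx⟩ := visits i (Finset.mem_filter.1 hi).2 x hx
    obtain ⟨j', hj', g', hg', hgτ', hgx'⟩ := visits i' (Finset.mem_filter.1 hi').2 x hx'
    obtain rfl := h.label_injOn g g' hg hg' (hgx.trans hgx'.symm)
    exact hne (start_add_inj hj hj' (hgτ.symm.trans hgτ'))
  · obtain ⟨t, ht, hvis, rfl⟩ := h.exists_label_eq hx
    obtain ⟨i, j, hj, rfl⟩ := exists_start_add ht
    have hmem : L.label (L.start i + j) ∈ L.set i := label_start_add hj ▸ List.getElem_mem hj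
    exact ⟨i, Finset.mem_filter.2 ⟨Finset.mem_range.2 (lt_length_of_mem_set hmem),
      (visits_start_add_iff h hj).1 hvis⟩, hmem⟩

/-! ### From exact covers to walks -/

/-- The positions of the entries of the sets with indices in `I`. -/
def positions (L : SetList) (I : List ℕ) : List ℕ :=
  I.flatMap fun i => List.range' (L.start i) (L.set i).length

theorem mem_positions {I : List ℕ} :
    t ∈ L.positions I ↔ ∃ i ∈ I, ∃ j < (L.set i).length, t = L.start i + j := by
  simp only [positions, List.mem_flatMap, List.mem_range', one_mul]

theorem nodup_map_label_positions {I : List ℕ} (hI : I.Nodup)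
    (hdisj : ∀ i ∈ I, ∀ i' ∈ I, i ≠ i' → (L.set i).Disjoint (L.set i')) :
    ((L.positions I).map L.label).Nodup := by
  have hmap : (L.positions I).map L.label = I.flatMap L.set := by
    rw [positions, List.map_flatMap]
    refine List.flatMap_congr fun i _ => List.ext_getElem (by simp) fun j hj _ => ?_
    rw [List.length_map, List.length_range'] at hj
    rw [List.getElem_map, List.getElem_range', one_mul, label_start_add hj]
  rw [hmap, List.nodup_flatMap]
  exact ⟨fun i _ => nodup_set i, hI.imp_of_mem fun hi hi' hne => hdisj _ hi _ hi' hne⟩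

theorem isChain_link_positions {I : List ℕ} (hI : ∀ i ∈ I, i < L.sets.length)
    (ht : L.mark (t + 1) ≠ 0) :
    (t :: (L.positions I ++ [L.sets.flatten.length])).IsChain (L.tokens d hd).Link := by
  induction I generalizing t with
  | nil => exact List.isChain_pair.2 (.inr ⟨(L.tokens d hd).mark_numTokens, ht⟩)
  | cons i I ih =>
    obtain ⟨hi, hI⟩ := List.forall_mem_cons.1 hI
    rw [positions, List.flatMap_cons, List.append_assoc]
    rcases hm : (L.set i).length with _ | m
    · exact ih hI ht
    · rw [List.range'_succ, List.cons_append, List.isChain_cons_cons]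
      refine ⟨.inr ⟨mark_start hi.le, ht⟩,
        TokenSystem.isChain_range' (fun j hj => mark_start_add_succ (by omega)) (ih hI ?_)⟩
      rw [add_assoc, ← hm, ← start_succ]
      exact mark_start hi

theorem HasExactCover.exists_isWalk (h : L.HasExactCover) :
    ∃ τ, (L.tokens d hd).IsWalk τ := by
  obtain ⟨D, hdisj, hcov⟩ := h
  set I := (D.filter (· < L.sets.length)).toList
  have memI : ∀ {i}, i ∈ I ↔ i ∈ D ∧ i < L.sets.length := by
    simp only [I, Finset.mem_toList, Finset.mem_filter, implies_true]
  have hlt : ∀ t ∈ L.positions I, t < L.sets.flatten.length := fun t ht => by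
    obtain ⟨i, -, j, hj, rfl⟩ := mem_positions.1 ht
    exact start_add_lt hj
  have hnodup : ((L.positions I).map L.label).Nodup :=
    nodup_map_label_positions (Finset.nodup_toList _) fun i hi i' hi' =>
      hdisj (memI.1 hi).1 (memI.1 hi').1
  have hlabels : ((L.positions I).map L.label).toFinset = Finset.range L.n := by
    ext x
    rw [List.mem_toFinset, List.mem_map, Finset.mem_range]
    constructor
    · rintro ⟨t, ht, rfl⟩
      exact label_lt (hlt t ht)
    · intro hx
      obtain ⟨i, hi, hxi⟩ := hcov x hx
      obtain ⟨j, hj, rfl⟩ := List.getElem_of_mem hxi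
      exact ⟨L.start i + j,
        mem_positions.2 ⟨i, memI.2 ⟨hi, lt_length_of_mem_set hxi⟩, j, hj, rfl⟩,
        label_start_add hj⟩
  have hlength : (L.positions I).length = L.n := by
    rw [← List.length_map (f := L.label), ← List.toFinset_card_of_nodup hnodup, hlabels,
      Finset.card_range]
  exact ⟨_, TokenSystem.isWalk_padded hlt hlength hnodup
    (isChain_link_positions (fun i hi => (memI.1 hi).2) (L.tokens d hd).mark_numTokens_succ)⟩

/-! ### Instances of Exact Cover -/

/-- The list of subsets of `{0, …, n - 1}` given by a list of subsets of `Fin n`. -/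
def ofFin {n : ℕ} (L : List (List (Fin n))) (h : ∀ l ∈ L, l.Nodup) : SetList where
  n := n
  sets := L.map (List.map Fin.val)
  lt := by
    simp only [List.forall_mem_map, Fin.is_lt, implies_true]
  nodup := by
    rw [List.forall_mem_map]
    exact fun l hl => (h l hl).map Fin.val_injective

theorem set_ofFin {n : ℕ} {L : List (List (Fin n))} (h : ∀ l ∈ L, l.Nodup) (i : ℕ) :
    (ofFin L h).set i = (L.getD i []).map Fin.val :=
  List.getD_map L [] (List.map Fin.val)

theorem hasExactCover_ofFin {n : ℕ} {L : List (List (Fin n))} (h : ∀ l ∈ L, l.Nodup) :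
    (ofFin L h).HasExactCover ↔
      ∃ D : Finset ℕ,
        (D : Set ℕ).Pairwise
          (fun i j => Disjoint (L.getD i []).toFinset (L.getD j []).toFinset) ∧
        ∀ x, ∃ i ∈ D, x ∈ (L.getD i []).toFinset := by
  have disjoint_map_iff : ∀ l l' : List (Fin n),
      (l.map Fin.val).Disjoint (l'.map Fin.val) ↔ l.Disjoint l' := fun l l' =>
    ⟨List.Disjoint.of_map, List.disjoint_map Fin.val_injective⟩
  simp only [HasExactCover, set_ofFin, disjoint_map_iff, List.disjoint_toFinset_iff_disjoint,
    List.mem_toFinset]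
  refine exists_congr fun D => and_congr_right' ?_
  constructor
  · intro hcov x
    obtain ⟨i, hi, hx⟩ := hcov x x.2
    exact ⟨i, hi, (List.mem_map_of_injective Fin.val_injective).1 hx⟩
  · intro hcov x hx
    obtain ⟨i, hi, hx⟩ := hcov ⟨x, hx⟩
    exact ⟨i, hi, List.mem_map_of_mem hx⟩

theorem mem_map_toFinset_iff {α : Type*} [DecidableEq α] {L : List (List α)} {B : Finset α} :
    B ∈ L.map List.toFinset ↔ ∃ i < L.length, (L.getD i []).toFinset = B := by
  rw [List.mem_map]
  constructor
  · rintro ⟨l, hl, rfl⟩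
    obtain ⟨i, hi, rfl⟩ := List.getElem_of_mem hl
    exact ⟨i, hi, congrArg List.toFinset (List.getD_eq_getElem _ _ hi)⟩
  · rintro ⟨i, hi, rfl⟩
    exact ⟨L[i], List.getElem_mem hi, congrArg List.toFinset (List.getD_eq_getElem _ _ hi).symm⟩

theorem eq_of_toFinset_getD_eq {α : Type*} [DecidableEq α] {L : List (List α)}
    (hL : (L.map List.toFinset).Nodup) {i j : ℕ} (hi : i < L.length) (hj : j < L.length)
    (h : (L.getD i []).toFinset = (L.getD j []).toFinset) : i = j := by
  rw [List.getD_eq_getElem _ _ hi, List.getD_eq_getElem _ _ hj] at h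
  refine (hL.getElem_inj_iff (hi := ?_) (hj := ?_)).1 ?_
  · rwa [List.length_map]
  · rwa [List.length_map]
  · rwa [List.getElem_map, List.getElem_map]

theorem yes_iff_hasExactCover {I : ExactCoverInstance} {L : List (List (Fin I.n))}
    (h : ∀ l ∈ L, l.Nodup) (hL : (L.map List.toFinset).Nodup)
    (hfam : (L.map List.toFinset).toFinset = I.family) :
    I.Yes ↔ (ofFin L h).HasExactCover := by
  classical
  rw [hasExactCover_ofFin]
  set A : ℕ → Finset (Fin I.n) := fun i => (L.getD i []).toFinset
  have mem_family : ∀ B, B ∈ I.family ↔ ∃ i < L.length, A i = B := fun B => by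
    rw [← hfam, List.mem_toFinset, mem_map_toFinset_iff]
  constructor
  · rintro ⟨T, hT, hdisj, hcov⟩
    refine ⟨(Finset.range L.length).filter (A · ∈ T), fun i hi j hj hne => ?_, fun x => ?_⟩
    · simp only [Finset.coe_filter, Finset.mem_range, Set.mem_ofPred_eq] at hi hj
      exact hdisj _ hi.2 _ hj.2 fun h => hne (eq_of_toFinset_getD_eq hL hi.1 hj.1 h)
    · obtain ⟨B, hB, hxB⟩ := hcov x
      obtain ⟨i, hi, rfl⟩ := (mem_family B).1 (hT hB)
      exact ⟨i, Finset.mem_filter.2 ⟨Finset.mem_range.2 hi, hB⟩, hxB⟩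
  · rintro ⟨D, hdisj, hcov⟩
    refine ⟨I.family.filter fun B => ∃ i ∈ D, A i = B, Finset.filter_subset _ _, ?_, fun x => ?_⟩
    · intro B hB B' hB' hne
      obtain ⟨-, i, hi, rfl⟩ := Finset.mem_filter.1 hB
      obtain ⟨-, j, hj, rfl⟩ := Finset.mem_filter.1 hB'
      exact hdisj hi hj fun h => hne (congrArg A h)
    · obtain ⟨i, hi, hx⟩ := hcov x
      have hlt : i < L.length := by
        by_contra! hge
        rw [List.getD_eq_default _ _ hge] at hx
        exact List.not_mem_nil (List.mem_toFinset.1 hx)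
      exact ⟨A i, Finset.mem_filter.2 ⟨(mem_family _).2 ⟨i, hlt, rfl⟩, i, hi, rfl⟩, hx⟩

end SetList

/-! ## The instance of `k`-HyperPath -/

namespace TokenSystem

variable (S : TokenSystem)

/-- The word that presents the hypergraph of the token system to an algorithm for `k`-HyperPath. -/
noncomputable def word : List ℕ :=
  [S.offset + S.numStates, S.edges.length, S.pathLen] ++ S.edges.flatten

theorem numNodes_pos : 0 < S.offset + S.numStates := by
  have : 0 < (S.numLayers + 1) * S.d := Nat.mul_pos (Nat.succ_pos _) S.d_pos
  rw [offset]
  omega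

/-- The node with number `x`, read modulo the number of nodes to make it total. -/
def toNode (x : ℕ) : Fin (S.offset + S.numStates) := ⟨x % _, Nat.mod_lt _ S.numNodes_pos⟩

variable {S}

theorem val_toNode {x : ℕ} (hx : x < S.offset + S.numStates) : (S.toNode x : ℕ) = x :=
  Nat.mod_eq_of_lt hx

theorem map_val_map_toNode {e : List ℕ} (he : e ∈ S.edges) :
    (e.map S.toNode).map Fin.val = e := by
  rw [List.map_map]
  exact (List.map_congr_left fun x hx => val_toNode (lt_of_mem_edges he hx)).trans (List.map_id e)

theorem image_val_toFinset_map_toNode {e : List ℕ} (he : e ∈ S.edges) :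
    (e.map S.toNode).toFinset.image Fin.val = e.toFinset := by
  conv_rhs => rw [← map_val_map_toNode he]
  ext y
  simp only [Finset.mem_image, List.mem_toFinset, List.mem_map]

theorem nodup_map_toNode {e : List ℕ} (he : e ∈ S.edges) : (e.map S.toNode).Nodup :=
  List.Nodup.of_map Fin.val ((map_val_map_toNode he).symm ▸ nodup_of_mem_edges he)

theorem nodup_map_toFinset_edges :
    ((S.edges.map (List.map S.toNode)).map List.toFinset).Nodup := by
  rw [List.map_map]
  refine nodup_edges.map_on fun e he e' he' h => toFinset_injOn_edges he he' ?_
  rw [← image_val_toFinset_map_toNode he, ← image_val_toFinset_map_toNode he']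
  exact congrArg _ h

variable (S)

/-- The instance of `k`-HyperPath given by the hyperedges of the token system. -/
noncomputable def hyperPathInstance : HyperPathInstance (S.d + 2) where
  numVerts := S.offset + S.numStates
  graph :=
    { edges := ((S.edges.map (List.map S.toNode)).map List.toFinset).toFinset
      card_eq := by
        simp only [List.map_map, List.mem_toFinset, List.forall_mem_map, Function.comp_apply]
        exact fun e he => by rw [List.toFinset_card_of_nodup (nodup_map_toNode he),
          List.length_map, length_of_mem_edges he] }
  k := S.pathLen

theorem size_hyperPathInstance :
    S.hyperPathInstance.size = S.offset + S.numStates + S.edges.length + S.pathLen := by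
  have hcard : S.hyperPathInstance.graph.edges.card = S.edges.length :=
    (List.toFinset_card_of_nodup nodup_map_toFinset_edges).trans (by simp only [List.length_map])
  rw [HyperPathInstance.size, hcard]
  rfl

theorem enc_word_hyperPathInstance : HyperPathInstance.Enc S.word S.hyperPathInstance := by
  refine ⟨S.edges.map (List.map S.toNode), ?_, nodup_map_toFinset_edges, rfl, ?_⟩
  · rw [List.forall_mem_map]
    exact fun e he => nodup_map_toNode he
  · rw [word, List.length_map, List.map_flatten, List.map_map]
    congr 2
    exact ((List.map_congr_left fun e he => map_val_map_toNode he).trans (List.map_id _)).symm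

variable {S}

theorem mem_edges_hyperPathInstance {A : Finset (Fin (S.offset + S.numStates))} :
    A ∈ S.hyperPathInstance.graph.edges ↔ ∃ e ∈ S.edges, A.image Fin.val = e.toFinset := by
  change A ∈ ((S.edges.map (List.map S.toNode)).map List.toFinset).toFinset ↔ _
  rw [List.mem_toFinset, List.map_map, List.mem_map]
  refine exists_congr fun e => and_congr_right fun he => ?_
  rw [← image_val_toFinset_map_toNode he, (Finset.image_injective Fin.val_injective).eq_iff]
  exact eq_comm

theorem image_val_window {k m d : ℕ} {f : ℕ → ℕ} {v : Fin k → Fin m}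
    (hv : ∀ x : Fin k, f x = v x) {i : ℕ} (hi : i + d ≤ k) :
    (Finset.univ.image fun j : Fin d => v ⟨i + j, by have := j.isLt; omega⟩).image Fin.val =
      (Finset.Ico i (i + d)).image f := by
  ext y
  simp only [Finset.mem_image, Finset.mem_univ, true_and, Finset.mem_Ico, exists_exists_eq_and]
  constructor
  · rintro ⟨j, rfl⟩
    exact ⟨i + j, ⟨by omega, by omega⟩, hv ⟨i + j, by omega⟩⟩
  · rintro ⟨x, ⟨h, h'⟩, rfl⟩
    refine ⟨⟨x - i, by omega⟩, ?_⟩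
    rw [← hv]
    exact congrArg f (show i + (x - i) = x by omega)

theorem exists_isPath_of_yes (h : S.hyperPathInstance.Yes) : ∃ f, S.IsPath f := by
  obtain ⟨v, hinj, hv⟩ := h
  let f : ℕ → ℕ := fun x => if h : x < S.pathLen then v ⟨x, h⟩ else 0
  have hf : ∀ x (h : x < S.pathLen), f x = v ⟨x, h⟩ := fun x h => dif_pos h
  refine ⟨f, fun x hx y hy h => ?_, fun i hi => ?_⟩
  · rw [hf x hx, hf y hy] at h
    exact congrArg Fin.val (hinj (Fin.ext h))
  · rw [← image_val_window (fun x => hf x x.2) hi]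
    exact mem_edges_hyperPathInstance.1 (hv i hi)

theorem IsPath.yes {f : ℕ → ℕ} (hf : S.IsPath f)
    (hlt : ∀ x < S.pathLen, f x < S.offset + S.numStates) : S.hyperPathInstance.Yes := by
  let v : Fin S.pathLen → Fin (S.offset + S.numStates) := fun x => ⟨f x, hlt x x.2⟩
  refine ⟨v, fun x y h => Fin.ext (hf.1 x x.2 y y.2 (congrArg Fin.val h)), fun i hi => ?_⟩
  obtain ⟨e, he, hfe⟩ := hf.2 i hi
  exact mem_edges_hyperPathInstance.2
    ⟨e, he, (image_val_window (v := v) (fun _ => rfl) hi).trans hfe⟩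

theorem yes_iff_exists_isWalk : S.hyperPathInstance.Yes ↔ ∃ τ, S.IsWalk τ := by
  constructor
  · intro h
    obtain ⟨f, hf⟩ := exists_isPath_of_yes h
    exact hf.exists_isWalk
  · rintro ⟨τ, hτ⟩
    exact hτ.isPath_walkPath.yes fun x hx => hτ.walkPath_lt hx

end TokenSystem

theorem SetList.yes_iff {L : SetList} {d : ℕ} {hd : 0 < d} :
    (L.tokens d hd).hyperPathInstance.Yes ↔ L.HasExactCover := by
  rw [TokenSystem.yes_iff_exists_isWalk]
  exact ⟨fun ⟨_, hτ⟩ => hasExactCover_of_isWalk hτ, fun h => h.exists_isWalk⟩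

/-! ## The reduction as a program -/

namespace RAM

namespace Expr

/-- The power `e ^ i`. -/
def pow (e : Expr) : ℕ → Expr
  | 0 => .const 1
  | i + 1 => .mul (e.pow i) e

/-- The remainder of `e` modulo `f`. -/
def mod (e f : Expr) : Expr := .sub e (.mul (.div e f) f)

/-- The sign of `e`: `1` if `e` is nonzero, and `0` otherwise. -/
def sgn (e : Expr) : Expr := .sub (.const 1) (.sub (.const 1) e)

/-- Nonzero if `e` and `f` are equal. -/
def eq (e f : Expr) : Expr := .sub (.const 1) (.add (.sub e f) (.sub f e))

/-- Nonzero if all expressions of a list are nonzero. -/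
def all : List Expr → Expr
  | [] => .const 1
  | e :: l => .mul e (all l)

variable {s : State} {e f : Expr}

theorem eval_pow (i : ℕ) : (e.pow i).eval s = e.eval s ^ i := by
  induction i with
  | zero => rfl
  | succ i ih => rw [pow, eval, ih, pow_succ]

theorem eval_mod : (e.mod f).eval s = e.eval s % f.eval s := by
  have := Nat.div_add_mod' (e.eval s) (f.eval s)
  simp only [mod, eval]
  omega

theorem eval_sgn_eq_iff : e.sgn.eval s = f.sgn.eval s ↔ (e.eval s ≠ 0 ↔ f.eval s ≠ 0) := by
  simp only [sgn, eval]
  omega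

theorem eval_eq_ne_zero : (e.eq f).eval s ≠ 0 ↔ e.eval s = f.eval s := by
  simp only [eq, eval]
  omega

theorem eval_add_ne_zero : (e.add f).eval s ≠ 0 ↔ e.eval s ≠ 0 ∨ f.eval s ≠ 0 := by
  simp only [eval]
  omega

theorem eval_mul_ne_zero : (e.mul f).eval s ≠ 0 ↔ e.eval s ≠ 0 ∧ f.eval s ≠ 0 :=
  Nat.mul_ne_zero_iff

theorem eval_all_ne_zero {l : List Expr} : (all l).eval s ≠ 0 ↔ ∀ e ∈ l, e.eval s ≠ 0 := by
  induction l with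
  | nil => simp [all, eval]
  | cons e l ih => rw [all, eval_mul_ne_zero, ih, List.forall_mem_cons]

end Expr

end RAM

namespace TokenSystem

open RAM

variable {S : TokenSystem}

/-- The memory holds the token system: its parameters are in registers `1`, `3`, `8`, `10`, `11`,
`21` and `22`, its labels in array `1` and its marks in array `2`. -/
structure Loaded (S : TokenSystem) (s : State) : Prop where
  n : s.reg 1 = S.n
  numTokens : s.reg 3 = S.numTokens
  base : s.reg 8 = S.base
  offset : s.reg 10 = S.offset
  numStates : s.reg 11 = S.numStates
  pow_d : s.reg 21 = S.base ^ S.d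
  pow_two_d : s.reg 22 = S.base ^ (2 * S.d)
  label : s.arr 1 = S.label
  mark : s.arr 2 = S.mark

/-- The position of token `i` of a state whose layer is in register `j`. -/
def positionExpr (d j i : ℕ) : Expr := .add (.mul (.var j) (.const d)) (.const i)

/-- Token `i` of a state whose code is in register `c`. -/
def tokenExpr (c i : ℕ) : Expr := ((Expr.var c).div ((Expr.var 8).pow i)).mod (.var 8)

/-- Nonzero if the position is occupied. -/
def occupiedExpr (d j i : ℕ) : Expr :=
  .mul (.sub (.add (positionExpr d j i) (.const 1)) (.const (4 * d)))
    (.sub (.add (.const (4 * d)) (.var 1)) (positionExpr d j i))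

/-- Element node `i` of a state whose layer is in register `j` and whose code is in register `c`.
It relies on the label of padding being `0`. -/
def elementExpr (d j c i : ℕ) : Expr :=
  .add (.load 1 (tokenExpr c i))
    (.mul (.sub (.const 1) (.sub (.var 3) (tokenExpr c i)))
      (.add (.var 1) (positionExpr d j i)))

/-- Nonzero if token `i + 1` may follow token `i`. -/
def linkExpr (c i : ℕ) : Expr :=
  .add (.mul ((Expr.load 2 (tokenExpr c (i + 1))).eq (.const 0))
      ((tokenExpr c (i + 1)).eq (.add (tokenExpr c i) (.const 1))))
    (.mul (.load 2 (tokenExpr c (i + 1))) (.load 2 (.add (tokenExpr c i) (.const 1))))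

/-- Nonzero if the state in register `q` with layer and code in registers `j` and `c` is valid. -/
def validExpr (d q j c : ℕ) : Expr :=
  .mul (.sub (.var 11) (.var q)) <|
  .mul (Expr.all ((List.range (2 * d)).map fun i =>
    (occupiedExpr d j i).sgn.eq (Expr.sub (.var 3) (tokenExpr c i)).sgn)) <|
  .mul (Expr.all ((List.range (2 * d - 1)).map (linkExpr c)))
    (Expr.all ((List.range (2 * d)).flatMap fun i => (List.range i).map fun i' =>
      .sub (.const 1) ((elementExpr d j c i).eq (elementExpr d j c i'))))

section Eval

variable {s : State} {q rq j c i : ℕ}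

theorem eval_positionExpr (hj : s.reg j = S.layer q) :
    (positionExpr S.d j i).eval s = S.layer q * S.d + i := by
  simp only [positionExpr, Expr.eval, hj]

theorem eval_tokenExpr (h : S.Loaded s) (hc : s.reg c = S.code q) :
    (tokenExpr c i).eval s = S.token q i := by
  simp only [tokenExpr, Expr.eval_mod, Expr.eval, Expr.eval_pow, hc, h.base, token, digit]

theorem eval_occupiedExpr_ne_zero (h : S.Loaded s) (hj : s.reg j = S.layer q) :
    (occupiedExpr S.d j i).eval s ≠ 0 ↔ S.Occupied (S.layer q * S.d + i) := by
  simp only [occupiedExpr, Expr.eval, eval_positionExpr hj, h.n, Nat.mul_ne_zero_iff, Occupied]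
  omega

theorem eval_elementExpr (h : S.Loaded s) (hj : s.reg j = S.layer q) (hc : s.reg c = S.code q) :
    (elementExpr S.d j c i).eval s = S.element q i := by
  simp only [elementExpr, Expr.eval, eval_positionExpr hj, eval_tokenExpr h hc, h.n, h.numTokens,
    h.label, element, elementNode]
  split_ifs with hlt
  · rw [Nat.sub_eq_zero_of_le (Nat.sub_pos_of_lt hlt), zero_mul, add_zero]
  · rw [(token_le q i).antisymm (not_lt.1 hlt), S.label_numTokens, Nat.sub_self,
      Nat.sub_zero, one_mul, zero_add]

theorem eval_linkExpr_ne_zero (h : S.Loaded s) (hc : s.reg c = S.code q) :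
    (linkExpr c i).eval s ≠ 0 ↔ S.Link (S.token q i) (S.token q (i + 1)) := by
  rw [linkExpr, Expr.eval_add_ne_zero, Expr.eval_mul_ne_zero, Expr.eval_mul_ne_zero,
    Expr.eval_eq_ne_zero, Expr.eval_eq_ne_zero]
  simp only [Expr.eval, eval_tokenExpr h hc, h.mark, Link]

theorem eval_validExpr_ne_zero (h : S.Loaded s) (hq : s.reg rq = q) (hj : s.reg j = S.layer q)
    (hc : s.reg c = S.code q) : (validExpr S.d rq j c).eval s ≠ 0 ↔ S.Valid q := by
  rw [validExpr, Expr.eval_mul_ne_zero, Expr.eval_mul_ne_zero, Expr.eval_mul_ne_zero,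
    Expr.eval_all_ne_zero, Expr.eval_all_ne_zero, Expr.eval_all_ne_zero, Valid]
  refine and_congr ?_ (and_congr ?_ (and_congr ?_ ?_))
  · simp only [Expr.eval, h.numStates, hq]
    omega
  · simp only [List.forall_mem_map, List.mem_range]
    refine forall₂_congr fun i _ => ?_
    rw [Expr.eval_eq_ne_zero, Expr.eval_sgn_eq_iff, eval_occupiedExpr_ne_zero h hj]
    simp only [Expr.eval, eval_tokenExpr h hc, h.numTokens]
    exact iff_congr Iff.rfl (by omega)
  · simp only [List.forall_mem_map, List.mem_range, eval_linkExpr_ne_zero h hc]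
    exact forall_congr' fun i => imp_congr_left (by omega)
  · simp only [List.forall_mem_flatMap, List.forall_mem_map, List.mem_range]
    refine forall₂_congr fun i _ => forall₂_congr fun i' _ => ?_
    rw [← eval_elementExpr (i := i) h hj hc, ← eval_elementExpr (i := i') h hj hc, Ne, Ne,
      ← Expr.eval_eq_ne_zero (s := s), Expr.eval, Expr.eval]
    omega

end Eval

end TokenSystem

/-! ## Writing hyperedges -/

namespace RAM

/-- Run the programs of a list one after the other. -/
def Prog.seqAll : List Prog → Prog
  | [] => .skip
  | p :: l => .seq p (seqAll l)

/-- Append the values of the expressions to array `3`, whose length is in register `19`, and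
increase the number of hyperedges, which is kept in register `20` and in cell `1` of array `3`. -/
def emit : List Expr → Prog
  | [] => .seq (.assign 20 (.add (.var 20) (.const 1))) (.store 3 (.const 1) (.var 20))
  | e :: l => .seq (.store 3 (.var 19) e)
      (.seq (.assign 19 (.add (.var 19) (.const 1))) (emit l))

theorem update_getD_length (l : List ℕ) (v : ℕ) :
    Function.update (fun i => l.getD i 0) l.length v = fun i => (l ++ [v]).getD i 0 := by
  funext i
  rw [Function.update_apply]
  split_ifs with h
  · rw [h, List.getD_append_right _ _ _ _ le_rfl, Nat.sub_self, List.getD_cons_zero]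
  · rcases lt_or_gt_of_ne h with h | h
    · rw [List.getD_append _ _ _ _ h]
    · rw [List.getD_eq_default _ _ h.le, List.getD_eq_default _ _ (by
        rw [List.length_append, List.length_singleton]; exact h)]

/-- Array `3` holds a header, the hyperedges `l` and the beginning `e` of a further hyperedge. -/
structure Written (V k : ℕ) (l : List (List ℕ)) (e : List ℕ) (s : State) : Prop where
  pointer : s.reg 19 = ([V, l.length, k] ++ l.flatten ++ e).length
  count : s.reg 20 = l.length
  output : s.arr 3 = fun i => ([V, l.length, k] ++ l.flatten ++ e).getD i 0

namespace Written

variable {V k : ℕ} {l : List (List ℕ)} {e : List ℕ} {s s' : State}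

theorem congr (h : Written V k l e s) (h₁₉ : s'.reg 19 = s.reg 19) (h₂₀ : s'.reg 20 = s.reg 20)
    (h₃ : s'.arr 3 = s.arr 3) : Written V k l e s' :=
  ⟨h₁₉.trans h.pointer, h₂₀.trans h.count, h₃.trans h.output⟩

theorem pointer_eq (h : Written V k l e s) : s.reg 19 = 3 + (l ++ [e]).flatten.length := by
  simp only [h.pointer, List.flatten_append, List.flatten_singleton, List.length_append,
    List.length_cons, List.length_nil]
  omega

theorem append (h : Written V k l e s) (v : ℕ) :
    Written V k l (e ++ [v]) ((s.setArr 3 (s.reg 19) v).setReg 19 (s.reg 19 + 1)) where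
  pointer := by
    rw [State.reg_setReg, if_pos rfl, ← List.append_assoc, List.length_append, ← h.pointer,
      List.length_singleton]
  count := by
    rw [State.reg_setReg, if_neg (by decide), State.reg_setArr, h.count]
  output := by
    rw [State.arr_setReg, State.arr_setArr, if_pos rfl, h.pointer, h.output, update_getD_length,
      List.append_assoc]

theorem finish (h : Written V k l e s) :
    Written V k (l ++ [e]) [] ((s.setReg 20 (l.length + 1)).setArr 3 1 (l.length + 1)) where
  pointer := by
    rw [State.reg_setArr, State.reg_setReg, if_neg (by decide), h.pointer]
    simp only [List.flatten_append, List.flatten_singleton, List.length_append, List.length_cons,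
      List.length_nil]
    omega
  count := by
    rw [State.reg_setArr, State.reg_setReg, if_pos rfl, List.length_append, List.length_singleton]
  output := by
    rw [State.arr_setArr, if_pos rfl, State.arr_setReg, h.output]
    funext i
    rw [Function.update_apply]
    rcases i with _ | _ | i <;> simp

end Written

theorem Prog.WP.assign_seq {B x v : ℕ} {e : Expr} {p : Prog} {Q : State → Prop} {s : State}
    (he : e.eval s = v) (hv : v ≤ B) (hp : p.WP B Q (s.setReg x v)) :
    (Prog.seq (.assign x e) p).WP B Q s := by
  subst he
  exact ⟨hv, hp⟩

theorem Prog.WP.store_seq {B a x v : ℕ} {i e : Expr} {p : Prog} {Q : State → Prop} {s : State}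
    (hi : i.eval s = x) (he : e.eval s = v) (hv : v ≤ B) (hp : p.WP B Q (s.setArr a x v)) :
    (Prog.seq (.store a i e) p).WP B Q s := by
  subst hi he
  exact ⟨hv, hp⟩

/-- A property of the memory that does not depend on the output of `emit`. -/
def OutputFree (F : State → Prop) : Prop :=
  ∀ s s' : State, (∀ x, x ≠ 19 → x ≠ 20 → s'.reg x = s.reg x) →
    (∀ a, a ≠ 3 → s'.arr a = s.arr a) → F s → F s'

variable {B V k : ℕ} {F : State → Prop}

theorem wp_emit_nil (hF : OutputFree F) {l : List (List ℕ)} (hl : l.length + 1 ≤ B) {e : List ℕ}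
    {s : State} (hs : F s) (hw : Written V k l e s) :
    (emit []).WP B (fun s' => F s' ∧ Written V k (l ++ [e]) [] s') s := by
  refine Prog.WP.assign_seq (v := l.length + 1) (congrArg (· + 1) hw.count) hl ?_
  have hval : (Expr.var 20).eval (s.setReg 20 (l.length + 1)) = l.length + 1 := by
    rw [Expr.eval, State.reg_setReg, if_pos rfl]
  rw [Prog.WP, hval]
  refine ⟨hl, hF _ _ (fun x _ hx => ?_) (fun a ha => ?_) hs, hw.finish⟩
  · rw [State.reg_setArr, State.reg_setReg, if_neg hx]
  · rw [State.arr_setArr, if_neg ha, State.arr_setReg]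

theorem wp_emit (hF : OutputFree F) {l : List (List ℕ)} (hl : l.length + 1 ≤ B)
    {es : List Expr} : ∀ {vals e : List ℕ} {s : State},
    (∀ s, F s → es.map (Expr.eval s) = vals) → (∀ v ∈ vals, v ≤ B) →
    3 + (l ++ [e ++ vals]).flatten.length ≤ B → F s → Written V k l e s →
    (emit es).WP B (fun s' => F s' ∧ Written V k (l ++ [e ++ vals]) [] s') s := by
  induction es with
  | nil =>
    intro vals e s hes _ _ hs hw
    obtain rfl : vals = [] := (hes s hs).symm
    rw [List.append_nil]
    exact wp_emit_nil hF hl hs hw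
  | cons x es ih =>
    intro vals e s hes hv hB hs hw
    obtain ⟨v, vals, rfl⟩ : ∃ v vs, vals = v :: vs := ⟨_, _, (hes s hs).symm⟩
    obtain ⟨hvB, hvals⟩ := List.forall_mem_cons.1 hv
    have hx : x.eval s = v := (List.cons.inj (hes s hs)).1
    have hpointer : s.reg 19 + 1 ≤ B := by
      simp only [hw.pointer_eq, List.flatten_append, List.flatten_singleton, List.length_append,
        List.length_cons] at hB ⊢
      omega
    rw [show e ++ v :: vals = e ++ [v] ++ vals from (List.append_cons e v vals)] at hB ⊢
    rw [emit, Prog.WP, Prog.WP, hx]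
    refine ⟨hvB, Prog.WP.assign_seq (v := s.reg 19 + 1) rfl hpointer <|
      ih (fun s hs => (List.cons.inj (hes s hs)).2) hvals hB ?_ (hw.append v)⟩
    refine hF _ _ (fun y hy _ => ?_) (fun a ha => ?_) hs
    · rw [State.reg_setReg, if_neg hy, State.reg_setArr]
    · rw [State.arr_setReg, State.arr_setArr, if_neg ha]

theorem wp_seqAll_emit (hF : OutputFree F) {ess : List (List Expr)} :
    ∀ {es l : List (List ℕ)} {s : State}, (∀ s, F s → ess.map (List.map (Expr.eval s)) = es) →
    (∀ e ∈ es, ∀ v ∈ e, v ≤ B) → (l ++ es).length ≤ B → 3 + (l ++ es).flatten.length ≤ B →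
    F s → Written V k l [] s →
    (Prog.seqAll (ess.map emit)).WP B (fun s' => F s' ∧ Written V k (l ++ es) [] s') s := by
  induction ess with
  | nil =>
    intro es l s hes _ _ _ hs hw
    obtain rfl : es = [] := (hes s hs).symm
    rw [List.append_nil]
    exact ⟨hs, hw⟩
  | cons xs ess ih =>
    intro es l s hes hv hlen hflat hs hw
    obtain ⟨e, es, rfl⟩ : ∃ e es', es = e :: es' := ⟨_, _, (hes s hs).symm⟩
    obtain ⟨heB, hesB⟩ := List.forall_mem_cons.1 hv
    rw [List.append_cons] at hlen hflat ⊢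
    rw [List.map_cons, Prog.seqAll, Prog.WP]
    refine Prog.WP.mono _ (fun s' h => ?_) (wp_emit hF (e := []) ?_
      (fun s hs => (List.cons.inj (hes s hs)).1) heB ?_ hs hw)
    · exact ih (fun s hs => (List.cons.inj (hes s hs)).2) hesB hlen hflat h.1 h.2
    · rw [List.length_append, List.length_append, List.length_singleton] at hlen
      omega
    · rw [List.flatten_append, List.length_append] at hflat
      rw [List.nil_append]
      omega

theorem writesOnly_emit {R A : ℕ → Prop} (h₁₉ : R 19) (h₂₀ : R 20) (h₃ : A 3) (l : List Expr) :
    (emit l).WritesOnly R A := by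
  induction l with
  | nil => exact ⟨h₂₀, h₃⟩
  | cons e l ih => exact ⟨h₃, h₁₉, ih⟩

theorem writesOnly_seqAll_emit {R A : ℕ → Prop} (h₁₉ : R 19) (h₂₀ : R 20) (h₃ : A 3)
    (l : List (List Expr)) : (Prog.seqAll (l.map emit)).WritesOnly R A := by
  induction l with
  | nil => trivial
  | cons e l ih => exact ⟨writesOnly_emit h₁₉ h₂₀ h₃ e, ih⟩

end RAM

namespace TokenSystem

open RAM

variable {S : TokenSystem}

/-- The nodes of hyperedge `u` among those that contain the state in register `12` only. -/
def edgeExprs₁ (d u : ℕ) : List Expr :=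
  .add (.var 10) (.var 12) :: (List.range (d + 1)).map fun i => elementExpr d 13 14 (u + i)

/-- The nodes of the hyperedge that contains the states in registers `12` and `16`. -/
def edgeExprs₂ (d : ℕ) : List Expr :=
  .add (.var 10) (.var 12) :: .add (.var 10) (.var 16) ::
    (List.range d).map fun i => elementExpr d 13 14 (d + i)

/-- List the hyperedge that contains the state in register `12` and its successor with number
given by register `15`, if that successor is valid. -/
def nextBody (d : ℕ) : Prog :=
  .seq (.assign 16 (.add (.mul (.add (.var 13) (.const 1)) (.var 22))
    (.add (.div (.var 14) (.var 21)) (.mul (.var 15) (.var 21))))) <|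
  .seq (.assign 17 (.div (.var 16) (.var 22))) <|
  .seq (.assign 18 ((Expr.var 16).mod (.var 22))) <|
  .ite (validExpr d 16 17 18) (emit (edgeExprs₂ d)) .skip

/-- List the hyperedges that contain the state in register `12` and a following state. -/
def nextProg (d : ℕ) : Prog := .for 15 (.var 21) (nextBody d)

/-- List the hyperedges that belong to the state in register `12`. -/
def edgesBody (d : ℕ) : Prog :=
  .seq (.assign 13 (.div (.var 12) (.var 22))) <|
  .seq (.assign 14 ((Expr.var 12).mod (.var 22))) <|
  .ite (validExpr d 12 13 14)
    (.seq (.seqAll (((List.range d).map (edgeExprs₁ d)).map emit)) (nextProg d)) .skip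

/-- List all hyperedges. -/
def edgesProg (d : ℕ) : Prog := .for 12 (.var 11) (edgesBody d)

/-- All numbers that occur when the hyperedges are listed are at most `B`. -/
structure FitsIn (S : TokenSystem) (B : ℕ) : Prop where
  numNodes : S.offset + S.numStates ≤ B
  length_edges : S.edges.length ≤ B
  length_flatten_edges : 3 + S.edges.flatten.length ≤ B
  next : S.numStates + S.base ^ (2 * S.d) ≤ B
  pow_d : S.base ^ S.d ≤ B

/-- The hyperedges `l` of the reduced instance have been written. -/
abbrev Output (S : TokenSystem) (l : List (List ℕ)) (s : State) : Prop :=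
  Written (S.offset + S.numStates) S.pathLen l [] s

/-- The token system is loaded, and registers `12` to `14` hold the state `q`, its layer and its
code. -/
structure AtState (S : TokenSystem) (q : ℕ) (s : State) : Prop where
  loaded : S.Loaded s
  state : s.reg 12 = q
  layer : s.reg 13 = S.layer q
  code : s.reg 14 = S.code q

/-- In addition, registers `15` to `18` hold `a` and the successor of `q` with number `a`, its layer
and its code. -/
structure AtNext (S : TokenSystem) (q a : ℕ) (s : State) : Prop extends S.AtState q s where
  index : s.reg 15 = a
  next : s.reg 16 = S.next q a
  layer_next : s.reg 17 = S.layer (S.next q a)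
  code_next : s.reg 18 = S.code (S.next q a)

theorem Loaded.congr {s s' : State} (h : S.Loaded s)
    (hr : ∀ x, x ≤ 11 ∨ 21 ≤ x → s'.reg x = s.reg x) (ha : ∀ a, a ≠ 3 → s'.arr a = s.arr a) :
    S.Loaded s' where
  n := (hr 1 (by decide)).trans h.n
  numTokens := (hr 3 (by decide)).trans h.numTokens
  base := (hr 8 (by decide)).trans h.base
  offset := (hr 10 (by decide)).trans h.offset
  numStates := (hr 11 (by decide)).trans h.numStates
  pow_d := (hr 21 (by decide)).trans h.pow_d
  pow_two_d := (hr 22 (by decide)).trans h.pow_two_d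
  label := (ha 1 (by decide)).trans h.label
  mark := (ha 2 (by decide)).trans h.mark

theorem AtState.congr {q : ℕ} {s s' : State} (h : S.AtState q s)
    (hr : ∀ x, x ≤ 14 ∨ 21 ≤ x → s'.reg x = s.reg x) (ha : ∀ a, a ≠ 3 → s'.arr a = s.arr a) :
    S.AtState q s' where
  loaded := h.loaded.congr (fun x hx => hr x (by omega)) ha
  state := (hr 12 (by decide)).trans h.state
  layer := (hr 13 (by decide)).trans h.layer
  code := (hr 14 (by decide)).trans h.code

theorem outputFree_atState (q : ℕ) : OutputFree (S.AtState q) := fun _ _ hr ha h =>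
  h.congr (fun x hx => hr x (by omega) (by omega)) ha

theorem outputFree_atNext (q a : ℕ) : OutputFree (S.AtNext q a) := fun _ _ hr ha h =>
  { outputFree_atState q _ _ hr ha h.toAtState with
    index := (hr 15 (by decide) (by decide)).trans h.index
    next := (hr 16 (by decide) (by decide)).trans h.next
    layer_next := (hr 17 (by decide) (by decide)).trans h.layer_next
    code_next := (hr 18 (by decide) (by decide)).trans h.code_next }

theorem length_le_and_length_flatten_le {α : Type*} {l l' : List (List α)} (h : l <+: l') :
    l.length ≤ l'.length ∧ l.flatten.length ≤ l'.flatten.length :=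
  ⟨h.length_le, h.sublist.flatten.length_le⟩

theorem flatMap_range_isPrefix_of_le {α : Type*} (f : ℕ → List α) {i N : ℕ} (h : i ≤ N) :
    (List.range i).flatMap f <+: (List.range N).flatMap f := by
  obtain ⟨m, rfl⟩ := Nat.exists_eq_add_of_le h
  rw [List.range_add, List.flatMap_append]
  exact List.prefix_append _ _

theorem flatMap_range_succ {α : Type*} (f : ℕ → List α) (i : ℕ) :
    (List.range (i + 1)).flatMap f = (List.range i).flatMap f ++ f i := by
  rw [List.range_succ, List.flatMap_append, List.flatMap_singleton]

section

variable {B q a : ℕ} {l : List (List ℕ)} {s : State}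

theorem eval_edgeExprs₁ (h : S.AtState q s) (u : ℕ) :
    (edgeExprs₁ S.d u).map (Expr.eval s) = S.edge₁ q u := by
  simp only [edgeExprs₁, edge₁, List.map_cons, Expr.eval, h.loaded.offset, h.state, List.map_map]
  congr 1
  exact List.map_congr_left fun i _ => eval_elementExpr h.loaded h.layer h.code

theorem eval_edgeExprs₂ (h : S.AtNext q a s) :
    (edgeExprs₂ S.d).map (Expr.eval s) = S.edge₂ q a := by
  simp only [edgeExprs₂, edge₂, List.map_cons, Expr.eval, h.loaded.offset, h.state, h.next,
    List.map_map]
  congr 2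
  exact List.map_congr_left fun i _ => eval_elementExpr h.loaded h.layer h.code

theorem wp_emit_edgeExprs₂ (hB : S.FitsIn B) (hl : l ++ [S.edge₂ q a] <+: S.edges)
    (hs : S.AtNext q a s) (hw : S.Output l s) :
    (emit (edgeExprs₂ S.d)).WP B
      (fun s' => S.AtNext q a s' ∧ S.Output (l ++ [S.edge₂ q a]) s') s := by
  obtain ⟨hlen, hflat⟩ := length_le_and_length_flatten_le hl
  have hmem : S.edge₂ q a ∈ S.edges :=
    hl.subset (List.mem_append_right _ (List.mem_singleton_self _))
  refine wp_emit (outputFree_atNext q a) (e := []) (vals := S.edge₂ q a) ?_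
    (fun s hs => eval_edgeExprs₂ hs) (fun v hv => ((lt_of_mem_edges hmem hv).le.trans hB.numNodes))
    ((Nat.add_le_add_left hflat 3).trans hB.length_flatten_edges) hs hw
  rw [List.length_append, List.length_singleton] at hlen
  exact hlen.trans hB.length_edges

theorem wp_emit_edgeExprs₁ (hB : S.FitsIn B)
    (hl : l ++ (List.range S.d).map (S.edge₁ q) <+: S.edges)
    (hs : S.AtState q s) (hw : S.Output l s) :
    (Prog.seqAll (((List.range S.d).map (edgeExprs₁ S.d)).map emit)).WP B
      (fun s' => S.AtState q s' ∧ S.Output (l ++ (List.range S.d).map (S.edge₁ q)) s') s := by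
  obtain ⟨hlen, hflat⟩ := length_le_and_length_flatten_le hl
  refine wp_seqAll_emit (outputFree_atState q) (fun s hs => ?_) (fun e he v hv => ?_)
    (hlen.trans hB.length_edges) ((Nat.add_le_add_left hflat 3).trans hB.length_flatten_edges) hs hw
  · rw [List.map_map]
    exact List.map_congr_left fun u _ => eval_edgeExprs₁ hs u
  · exact (lt_of_mem_edges (hl.subset (List.mem_append_right _ he)) hv).le.trans hB.numNodes

theorem next_le (hB : S.FitsIn B) (hq : S.Valid q) (ha : a < S.base ^ S.d) : S.next q a ≤ B := by
  refine le_trans ?_ hB.next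
  have hlayer := Nat.mul_le_mul_right (S.base ^ (2 * S.d)) (Nat.succ_le_of_lt (layer_lt hq))
  exact Nat.add_le_add hlayer (next_code_lt ha).le

theorem wp_nextBody (hB : S.FitsIn B) (hq : S.Valid q) (ha : a < S.base ^ S.d)
    (hl : l ++ S.edgesNext q a <+: S.edges) (hs : S.AtState q s) (h₁₅ : s.reg 15 = a)
    (hw : S.Output l s) :
    (nextBody S.d).WP B
      (fun s' => S.AtState q s' ∧ s'.reg 15 = a ∧ S.Output (l ++ S.edgesNext q a) s') s := by
  have hnext := next_le hB hq ha
  refine Prog.WP.assign_seq (v := S.next q a) ?_ hnext <|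
    Prog.WP.assign_seq (v := S.layer (S.next q a)) ?_ ((Nat.div_le_self _ _).trans hnext) <|
    Prog.WP.assign_seq (v := S.code (S.next q a)) ?_ ((Nat.mod_le _ _).trans hnext) ?_
  · simp only [Expr.eval, hs.layer, hs.code, hs.loaded.pow_two_d, hs.loaded.pow_d, h₁₅, next]
  · simp [Expr.eval, State.reg_setReg, hs.loaded.pow_two_d, layer]
  · simp [Expr.eval_mod, Expr.eval, State.reg_setReg, hs.loaded.pow_two_d, code]
  generalize hs₁ : ((s.setReg 16 (S.next q a)).setReg 17 (S.layer (S.next q a))).setReg 18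
    (S.code (S.next q a)) = s₁
  have hat : S.AtNext q a s₁ := by
    subst hs₁
    refine ⟨hs.congr (fun x hx => ?_) fun _ _ => rfl, h₁₅, rfl, rfl, rfl⟩
    simp only [State.reg_setReg]
    rw [if_neg (by omega), if_neg (by omega), if_neg (by omega)]
  have hw₁ : S.Output l s₁ := by
    subst hs₁
    exact hw.congr rfl rfl rfl
  have hvalid := eval_validExpr_ne_zero hat.loaded hat.next hat.layer_next hat.code_next
  refine ⟨fun he => ?_, fun he => ?_⟩
  · rw [edgesNext, if_pos (hvalid.1 he)] at hl ⊢
    exact (wp_emit_edgeExprs₂ hB hl hat hw₁).mono _ fun s' h => ⟨h.1.toAtState, h.1.index, h.2⟩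
  · rw [edgesNext, if_neg fun hv => hvalid.2 hv he, List.append_nil]
    exact ⟨hat.toAtState, hat.index, hw₁⟩

theorem wp_nextProg (hB : S.FitsIn B) (hq : S.Valid q)
    (hl : l ++ (List.range (S.base ^ S.d)).flatMap (S.edgesNext q) <+: S.edges)
    (hs : S.AtState q s) (hw : S.Output l s) :
    (nextProg S.d).WP B (fun s' => S.AtState q s' ∧
      S.Output (l ++ (List.range (S.base ^ S.d)).flatMap (S.edgesNext q)) s') s := by
  have hset {s : State} (v : ℕ) (h : S.AtState q s) : S.AtState q (s.setReg 15 v) :=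
    h.congr (fun x hx => by rw [State.reg_setReg, if_neg (by omega)]) fun _ _ => rfl
  refine Prog.WP.for (N := S.base ^ S.d) (fun a s => S.AtState q s ∧ s.reg 15 = a ∧
    S.Output (l ++ (List.range a).flatMap (S.edgesNext q)) s) hB.pow_d ?_ ?_ ?_ ?_
  · refine ⟨hset 0 hs, rfl, ?_⟩
    rw [List.range_zero, List.flatMap_nil, List.append_nil]
    exact hw.congr rfl rfl rfl
  · exact fun a s h => ⟨h.2.1, h.1.loaded.pow_d⟩
  · rintro a ha s ⟨hs, h₁₅, hw⟩
    have hpre := ((List.prefix_append_right_inj l).2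
      (flatMap_range_isPrefix_of_le (S.edgesNext q) (Nat.succ_le_of_lt ha))).trans hl
    rw [flatMap_range_succ, ← List.append_assoc] at hpre
    refine (wp_nextBody hB hq ha hpre hs h₁₅ hw).mono _ fun s' h =>
      ⟨h.2.1, hset (a + 1) h.1, rfl, ?_⟩
    rw [flatMap_range_succ, ← List.append_assoc]
    exact h.2.2.congr rfl rfl rfl
  · exact fun s h => ⟨h.1, h.2.2⟩

theorem wp_edgesBody (hB : S.FitsIn B) (hq : q < S.numStates) (hl : l ++ S.edgesAt q <+: S.edges)
    (hs : S.Loaded s) (h₁₂ : s.reg 12 = q) (hw : S.Output l s) :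
    (edgesBody S.d).WP B (fun s' => S.AtState q s' ∧ S.Output (l ++ S.edgesAt q) s') s := by
  have hqB : q ≤ B := hq.le.trans ((Nat.le_add_left _ _).trans hB.numNodes)
  refine Prog.WP.assign_seq (v := S.layer q) ?_ ((Nat.div_le_self _ _).trans hqB) <|
    Prog.WP.assign_seq (v := S.code q) ?_ ((Nat.mod_le _ _).trans hqB) ?_
  · simp only [Expr.eval, h₁₂, hs.pow_two_d, layer]
  · simp [Expr.eval_mod, Expr.eval, State.reg_setReg, h₁₂, hs.pow_two_d, code]
  generalize hs₁ : (s.setReg 13 (S.layer q)).setReg 14 (S.code q) = s₁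
  have hat : S.AtState q s₁ := by
    subst hs₁
    refine ⟨hs.congr (fun x hx => ?_) fun _ _ => rfl, h₁₂, rfl, rfl⟩
    simp only [State.reg_setReg]
    rw [if_neg (by omega), if_neg (by omega)]
  have hw₁ : S.Output l s₁ := by
    subst hs₁
    exact hw.congr rfl rfl rfl
  have hvalid := eval_validExpr_ne_zero hat.loaded hat.state hat.layer hat.code
  refine ⟨fun he => ?_, fun he => ?_⟩
  · rw [edgesAt, if_pos (hvalid.1 he), ← List.append_assoc] at hl ⊢
    exact Prog.WP.seq (wp_emit_edgeExprs₁ hB ((List.prefix_append _ _).trans hl) hat hw₁)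
      fun s' h => wp_nextProg hB (hvalid.1 he) hl h.1 h.2
  · rw [edgesAt, if_neg fun hv => hvalid.2 hv he, List.append_nil]
    exact ⟨hat, hw₁⟩

theorem wp_edgesProg (hB : S.FitsIn B) (hs : S.Loaded s) (hw : S.Output [] s) :
    (edgesProg S.d).WP B (fun s' => S.Output S.edges s') s := by
  have hset {s : State} (v : ℕ) (h : S.Loaded s) : S.Loaded (s.setReg 12 v) :=
    h.congr (fun x hx => by rw [State.reg_setReg, if_neg (by omega)]) fun _ _ => rfl
  refine Prog.WP.for (N := S.numStates) (fun q s => S.Loaded s ∧ s.reg 12 = q ∧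
    S.Output ((List.range q).flatMap S.edgesAt) s)
    ((Nat.le_add_left _ _).trans hB.numNodes) ?_ ?_ ?_ ?_
  · exact ⟨hset 0 hs, rfl, hw.congr rfl rfl rfl⟩
  · exact fun q s h => ⟨h.2.1, h.1.numStates⟩
  · rintro q hq s ⟨hs, h₁₂, hw⟩
    have hpre : (List.range (q + 1)).flatMap S.edgesAt <+: S.edges :=
      flatMap_range_isPrefix_of_le S.edgesAt (Nat.succ_le_of_lt hq)
    rw [flatMap_range_succ] at hpre
    refine (wp_edgesBody hB hq hpre hs h₁₂ hw).mono _ fun s' h =>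
      ⟨h.1.state, hset (q + 1) h.1.loaded, rfl, ?_⟩
    rw [flatMap_range_succ]
    exact h.2.congr rfl rfl rfl
  · exact fun s h => h.2.2

end

end TokenSystem

/-! ## Reading the input -/

namespace SetList

open RAM

/-- The word that presents the list of sets to an algorithm for Exact Cover. -/
def word (L : SetList) : List ℕ :=
  [L.n, L.sets.length] ++ L.sets.flatMap fun l => l.length :: l

variable {L : SetList} {i j : ℕ}

theorem length_flatMap_cons {α : Type*} {a : List α → α} (ls : List (List α)) :
    (ls.flatMap fun l => a l :: l).length = ls.length + ls.flatten.length := by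
  induction ls with
  | nil => rfl
  | cons l ls ih =>
    simp only [List.flatMap_cons, List.flatten_cons, List.length_append, List.length_cons, ih]
    omega

theorem getD_word (hi : i < L.sets.length) (hj : j ≤ (L.set i).length) :
    L.word.getD (2 + i + L.start i + j) 0 = ((L.set i).length :: L.set i).getD j 0 := by
  have hset : L.set i = L.sets[i] := List.getD_eq_getElem _ _ hi
  have hsplit : L.sets = L.sets.take i ++ L.set i :: L.sets.drop (i + 1) := by
    rw [hset, ← List.drop_eq_getElem_cons hi, List.take_append_drop]
  have hpre : ([L.n, L.sets.length] ++
      (L.sets.take i).flatMap fun l => l.length :: l).length = 2 + i + L.start i := by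
    rw [List.length_append, length_flatMap_cons, List.length_take, min_eq_left hi.le, start,
      ← add_assoc]
    rfl
  have hword : L.word = ([L.n, L.sets.length] ++
      (L.sets.take i).flatMap fun l => l.length :: l) ++ (((L.set i).length :: L.set i) ++
        (L.sets.drop (i + 1)).flatMap fun l => l.length :: l) := by
    rw [List.append_assoc, word]
    exact congrArg _ <| (congrArg (List.flatMap fun l => l.length :: l) hsplit).trans <| by
      rw [List.flatMap_append, List.flatMap_cons]
  rw [hword, ← hpre, List.getD_append_right _ _ _ _ (Nat.le_add_right _ _),
    Nat.add_sub_cancel_left, List.getD_append _ _ _ _ (Nat.lt_succ_of_le hj)]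

theorem getD_word_start (hi : i < L.sets.length) :
    L.word.getD (2 + i + L.start i) 0 = (L.set i).length :=
  getD_word hi (Nat.zero_le _)

theorem getD_word_label (hi : i < L.sets.length) (hj : j < (L.set i).length) :
    L.word.getD (2 + i + L.start i + 1 + j) 0 = L.label (L.start i + j) := by
  rw [add_assoc _ 1 j, add_comm 1 j, getD_word hi hj, List.getD_cons_succ, label_start_add hj,
    List.getD_eq_getElem _ _ hj]

/-- Copy the next entry of the input to array `1`. The number of entries that have been copied is
in register `3`, the position in the input is in register `4`. -/
def readSetBody : Prog :=
  .seq (.store 1 (.var 3) (.load 0 (.var 4))) <|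
  .seq (.assign 3 (.add (.var 3) (.const 1))) (.assign 4 (.add (.var 4) (.const 1)))

/-- Read the elements of one set, whose cardinality is in register `6`. -/
def readSet : Prog := .for 7 (.var 6) readSetBody

/-- Read the cardinality and the elements of one set, and mark its start in array `2`. -/
def readSetsBody : Prog :=
  .seq (.store 2 (.var 3) (.const 1)) <|
  .seq (.assign 6 (.load 0 (.var 4))) <|
  .seq (.assign 4 (.add (.var 4) (.const 1))) readSet

/-- Read all sets, whose number is in register `2`. -/
def readSets : Prog := .for 5 (.var 2) readSetsBody

/-- The memory after the cardinalities of `c` sets and `x` elements have been read. -/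
structure HasRead (L : SetList) (c x : ℕ) (s : State) : Prop where
  n : s.reg 1 = L.n
  numSets : s.reg 2 = L.sets.length
  numTokens : s.reg 3 = x
  position : s.reg 4 = 2 + c + x
  numEdges : s.reg 20 = 0
  input : s.arr 0 = fun i => L.word.getD i 0
  label : s.arr 1 = fun t => if t < x then L.label t else 0
  mark : s.arr 2 = fun t => if ∃ i < c, t = L.start i then 1 else 0
  output : s.arr 3 = fun _ => 0

namespace HasRead

variable {c x : ℕ} {s s' : State}

theorem congr (h : L.HasRead c x s) (hr : ∀ y, y ≤ 4 ∨ 8 ≤ y → s'.reg y = s.reg y)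
    (ha : s'.arr = s.arr) : L.HasRead c x s' where
  n := (hr 1 (by decide)).trans h.n
  numSets := (hr 2 (by decide)).trans h.numSets
  numTokens := (hr 3 (by decide)).trans h.numTokens
  position := (hr 4 (by decide)).trans h.position
  numEdges := (hr 20 (by decide)).trans h.numEdges
  input := ha ▸ h.input
  label := ha ▸ h.label
  mark := ha ▸ h.mark
  output := ha ▸ h.output

theorem setReg (h : L.HasRead c x s) {y : ℕ} (hy : 5 ≤ y ∧ y < 8) (v : ℕ) :
    L.HasRead c x (s.setReg y v) :=
  h.congr (fun z hz => by rw [State.reg_setReg, if_neg (by omega)]) rfl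

theorem readLabel (h : L.HasRead c x s) :
    L.HasRead c (x + 1)
      (((s.setArr 1 x (L.label x)).setReg 3 (x + 1)).setReg 4 (2 + c + x + 1)) where
  n := h.n
  numSets := h.numSets
  numTokens := rfl
  position := rfl
  numEdges := h.numEdges
  input := h.input
  mark := h.mark
  output := h.output
  label := by
    simp only [State.arr_setReg, State.arr_setArr, if_true, h.label]
    funext t
    rw [Function.update_apply]
    rcases lt_trichotomy t x with hlt | rfl | hgt
    · rw [if_neg hlt.ne, if_pos hlt, if_pos (hlt.trans x.lt_succ_self)]
    · rw [if_pos rfl, if_pos t.lt_succ_self]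
    · rw [if_neg hgt.ne', if_neg hgt.le.not_gt, if_neg (Nat.succ_le_of_lt hgt).not_gt]

theorem mark_setArr (h : L.HasRead c (L.start c) s) :
    (s.setArr 2 (L.start c) 1).arr 2 = fun t => if ∃ i < c + 1, t = L.start i then 1 else 0 := by
  rw [State.arr_setArr, if_pos rfl, h.mark]
  funext t
  simp only [Function.update_apply, Nat.exists_lt_succ_right]
  by_cases ht : t = L.start c
  · rw [if_pos ht, if_pos (.inr ht)]
  · rw [if_neg ht]
    exact if_congr (or_iff_left ht).symm rfl rfl

theorem readCard (h : L.HasRead c (L.start c) s) (v : ℕ) :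
    L.HasRead (c + 1) (L.start c) (((s.setArr 2 (L.start c) 1).setReg 6 v).setReg 4
      (2 + c + L.start c + 1)) where
  n := h.n
  numSets := h.numSets
  numTokens := h.numTokens
  position := by
    rw [State.reg_setReg, if_pos rfl]
    omega
  numEdges := h.numEdges
  input := h.input
  label := h.label
  mark := h.mark_setArr
  output := h.output

end HasRead

section

variable {B : ℕ} {s : State}

theorem wp_readSetBody (hn : L.n ≤ B) (hB : 2 + L.sets.length + L.sets.flatten.length ≤ B)
    (hi : i < L.sets.length) (hj : j < (L.set i).length)
    (h : L.HasRead (i + 1) (L.start i + j) s) :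
    readSetBody.WP B (fun s' => L.HasRead (i + 1) (L.start i + (j + 1)) s' ∧
      ∀ y, y ≠ 3 → y ≠ 4 → s'.reg y = s.reg y) s := by
  have hlt := start_add_lt hj
  have hread : (Expr.load 0 (.var 4)).eval s = L.label (L.start i + j) := by
    rw [Expr.eval, Expr.eval, h.input, h.position, ← getD_word_label hi hj]
    congr 1
    omega
  have hposition : s.reg 4 + 1 = 2 + (i + 1) + (L.start i + j) + 1 := congrArg (· + 1) h.position
  refine Prog.WP.store_seq h.numTokens hread ((label_lt hlt).le.trans hn) <|
    Prog.WP.assign_seq (v := L.start i + j + 1) (congrArg (· + 1) h.numTokens) (by omega) ?_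
  refine ⟨hposition.trans_le (by omega), ?_, fun y h₃ h₄ => ?_⟩
  · change L.HasRead _ _ (State.setReg _ 4 (s.reg 4 + 1))
    rw [hposition]
    exact h.readLabel
  · rw [State.reg_setReg, if_neg h₄, State.reg_setReg, if_neg h₃, State.reg_setArr]

theorem wp_readSet (hn : L.n ≤ B) (hB : 2 + L.sets.length + L.sets.flatten.length ≤ B)
    (hi : i < L.sets.length) (hs : L.HasRead (i + 1) (L.start i) s) (h₅ : s.reg 5 = i)
    (h₆ : s.reg 6 = (L.set i).length) :
    readSet.WP B (fun s' => L.HasRead (i + 1) (L.start (i + 1)) s' ∧ s'.reg 5 = i) s := by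
  have hcard : (L.set i).length ≤ B := by
    have := L.start_succ_le i
    rw [start_succ] at this
    omega
  refine Prog.WP.for (N := (L.set i).length) (fun j s => L.HasRead (i + 1) (L.start i + j) s ∧
    s.reg 5 = i ∧ s.reg 6 = (L.set i).length ∧ s.reg 7 = j) hcard ?_ ?_ ?_ ?_
  · exact ⟨hs.setReg (by decide) 0, h₅, h₆, rfl⟩
  · exact fun j s h => ⟨h.2.2.2, h.2.2.1⟩
  · rintro j hj s ⟨h, h₅, h₆, h₇⟩
    refine (wp_readSetBody hn hB hi hj h).mono _ fun s' h' => ?_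
    exact ⟨(h'.2 7 (by decide) (by decide)).trans h₇, h'.1.setReg (by decide) _,
      (h'.2 5 (by decide) (by decide)).trans h₅, (h'.2 6 (by decide) (by decide)).trans h₆, rfl⟩
  · rintro s ⟨h, h₅, -⟩
    rw [← start_succ] at h
    exact ⟨h, h₅⟩

theorem wp_readSetsBody (hn : L.n ≤ B) (hB : 2 + L.sets.length + L.sets.flatten.length ≤ B)
    (hi : i < L.sets.length) (hs : L.HasRead i (L.start i) s) (h₅ : s.reg 5 = i) :
    readSetsBody.WP B (fun s' => L.HasRead (i + 1) (L.start (i + 1)) s' ∧ s'.reg 5 = i) s := by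
  have hle := L.start_succ_le i
  rw [start_succ] at hle
  have hread : (Expr.load 0 (.var 4)).eval (s.setArr 2 (L.start i) 1) = (L.set i).length := by
    rw [← getD_word_start hi, ← hs.position, Expr.eval, Expr.eval, State.reg_setArr,
      State.arr_setArr, if_neg (by decide), hs.input]
  exact Prog.WP.store_seq (v := 1) hs.numTokens rfl (by omega) <|
    Prog.WP.assign_seq hread (by omega) <|
    Prog.WP.assign_seq (v := 2 + i + L.start i + 1) (congrArg (· + 1) hs.position) (by omega) <|
    wp_readSet hn hB hi (hs.readCard _) h₅ rfl

theorem wp_readSets (hn : L.n ≤ B) (hB : 2 + L.sets.length + L.sets.flatten.length ≤ B)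
    (hs : L.HasRead 0 0 s) :
    readSets.WP B (fun s' => L.HasRead L.sets.length L.sets.flatten.length s') s := by
  refine Prog.WP.for (N := L.sets.length) (fun i s => L.HasRead i (L.start i) s ∧ s.reg 5 = i)
    (by omega) ⟨hs.setReg (by decide) 0, rfl⟩ (fun i s h => ⟨h.2, h.1.numSets⟩) ?_ ?_
  · exact fun i hi s h => (wp_readSetsBody hn hB hi h.1 h.2).mono _ fun s' h' =>
      ⟨h'.2, h'.1.setReg (by decide) _, rfl⟩
  · rintro s ⟨h, -⟩
    rwa [start_length] at h

end

end SetList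

namespace TokenSystem

variable (S : TokenSystem)

theorem numLayers_le_numStates : S.numLayers ≤ S.numStates :=
  Nat.le_mul_of_pos_right _ (pow_pos base_pos _)

theorem numLayers_le_numNodes : S.numLayers ≤ S.offset + S.numStates :=
  S.numLayers_le_numStates.trans (Nat.le_add_left _ _)

theorem pathLen_le_numNodes : S.pathLen ≤ S.offset + S.numStates := by
  have := S.numLayers_le_numStates
  rw [pathLen, offset, Nat.mul_succ]
  omega

end TokenSystem

/-! ## The whole reduction -/

namespace SetList

open RAM

/-- Read the input. -/
def readInput : Prog :=
  .seq (.assign 1 (.load 0 (.const 0))) <|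
  .seq (.assign 2 (.load 0 (.const 1))) <|
  .seq (.assign 4 (.const 2)) readSets

/-- Mark the end of the sets and the padding, and compute the parameters of the token system. -/
def loadTokens (d : ℕ) : Prog :=
  .seq (.store 2 (.var 3) (.const 1)) <|
  .seq (.store 2 (.add (.var 3) (.const 1)) (.const 1)) <|
  .seq (.assign 8 (.add (.var 3) (.const 1))) <|
  .seq (.assign 9 (.add (.div (.var 1) (.const d)) (.const 8))) <|
  .seq (.assign 10 (.add (.var 1) (.mul (.add (.var 9) (.const 1)) (.const d)))) <|
  .seq (.assign 21 ((Expr.var 8).pow d)) <|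
  .seq (.assign 22 ((Expr.var 8).pow (2 * d))) <|
  .assign 11 (.mul (.var 9) (.var 22))

/-- Write the header of an instance of `k`-HyperPath that has no hyperedges yet. -/
def writeHeader (d : ℕ) : Prog :=
  .seq (.store 3 (.const 0) (.add (.var 10) (.var 11))) <|
  .seq (.store 3 (.const 2)
    (.sub (.mul (.add (.var 9) (.const 1)) (.const (d + 1))) (.const 1))) <|
  .assign 19 (.const 3)

/-- The program that turns a presentation of an Exact Cover instance into a presentation of an
instance of `k`-HyperPath. -/
def reduction (d : ℕ) : Prog :=
  .seq readInput (.seq (loadTokens d) (.seq (writeHeader d) (TokenSystem.edgesProg d)))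

variable {L : SetList} {B d : ℕ} {hd : 0 < d}

theorem hasRead_init :
    L.HasRead 0 0 ((((State.init L.word).setReg 1 L.n).setReg 2 L.sets.length).setReg 4 2) where
  n := rfl
  numSets := rfl
  numTokens := rfl
  position := rfl
  numEdges := rfl
  input := rfl
  label := by
    funext t
    exact (if_neg (Nat.not_lt_zero t)).symm
  mark := by
    funext t
    exact (if_neg fun ⟨i, hi, _⟩ => Nat.not_lt_zero i hi).symm
  output := rfl

theorem wp_readInput (hn : L.n ≤ B) (hB : 2 + L.sets.length + L.sets.flatten.length ≤ B) :
    readInput.WP B (fun s' => L.HasRead L.sets.length L.sets.flatten.length s')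
      (State.init L.word) :=
  Prog.WP.assign_seq (v := L.n) rfl hn <|
    Prog.WP.assign_seq (v := L.sets.length) rfl (by omega) <|
    Prog.WP.assign_seq (v := 2) rfl (by omega) <| wp_readSets hn hB hasRead_init

namespace HasRead

variable {s : State}

theorem label_eq {c : ℕ} (h : L.HasRead c L.sets.flatten.length s) : s.arr 1 = L.label := by
  rw [h.label]
  funext t
  split_ifs with ht
  · rfl
  · exact (List.getD_eq_default _ _ (not_lt.1 ht)).symm

theorem mark_eq (h : L.HasRead L.sets.length L.sets.flatten.length s) :
    ((s.setArr 2 L.sets.flatten.length 1).setArr 2 (L.sets.flatten.length + 1) 1).arr 2 =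
      L.mark := by
  have hmark := HasRead.mark_setArr (L := L) (c := L.sets.length) (s := s) (by rwa [start_length])
  rw [start_length] at hmark
  rw [State.arr_setArr, if_pos rfl, hmark]
  funext t
  rw [Function.update_apply, SetList.mark]
  simp only [Nat.lt_succ_iff]
  by_cases ht : t = L.sets.flatten.length + 1
  · rw [if_pos ht, if_pos (.inr ht)]
  · rw [if_neg ht]
    exact if_congr (or_iff_left ht).symm rfl rfl

end HasRead

theorem wp_loadTokens {s : State} (hS : (L.tokens d hd).FitsIn B)
    (h : L.HasRead L.sets.length L.sets.flatten.length s) :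
    (loadTokens d).WP B (fun s' => (L.tokens d hd).Loaded s' ∧
      s'.reg 9 = (L.tokens d hd).numLayers ∧ s'.reg 20 = 0 ∧ s'.arr 3 = fun _ => 0) s := by
  have hbase : (L.tokens d hd).base ≤ (L.tokens d hd).base ^ d := Nat.le_self_pow hd.ne' _
  have hbaseB : L.sets.flatten.length + 1 ≤ B := hbase.trans hS.pow_d
  have hnumNodes := hS.numNodes
  refine Prog.WP.store_seq (v := 1) h.numTokens rfl (by omega) <|
    Prog.WP.store_seq (x := L.sets.flatten.length + 1) (v := 1) ?_ rfl (by omega) <|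
    Prog.WP.assign_seq (v := (L.tokens d hd).base) ?_ hbaseB <|
    Prog.WP.assign_seq (v := (L.tokens d hd).numLayers) ?_
      ((L.tokens d hd).numLayers_le_numNodes.trans hnumNodes) <|
    Prog.WP.assign_seq (v := (L.tokens d hd).offset) ?_ (by omega) <|
    Prog.WP.assign_seq (v := (L.tokens d hd).base ^ d) (Expr.eval_pow d) hS.pow_d <|
    Prog.WP.assign_seq (v := (L.tokens d hd).base ^ (2 * d)) (Expr.eval_pow (2 * d))
      ((Nat.le_add_left _ _).trans hS.next) ⟨(Nat.le_add_left _ _).trans hnumNodes, ?_⟩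
  · exact congrArg (· + 1) h.numTokens
  · exact congrArg (· + 1) h.numTokens
  · exact congrArg (· / d + 8) h.n
  · exact congrArg (· + ((L.tokens d hd).numLayers + 1) * d) h.n
  · exact ⟨⟨h.n, h.numTokens, rfl, rfl, rfl, rfl, rfl, h.label_eq, h.mark_eq⟩, rfl, h.numEdges,
      h.output⟩

theorem wp_writeHeader {S : TokenSystem} {s : State} (hS : S.FitsIn B) (hs : S.Loaded s)
    (h₉ : s.reg 9 = S.numLayers) (h₂₀ : s.reg 20 = 0) (h₃ : s.arr 3 = fun _ => 0) :
    (writeHeader S.d).WP B (fun s' => S.Loaded s' ∧ S.Output [] s') s := by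
  have hpathLen : (s.reg 9 + 1) * (S.d + 1) - 1 = S.pathLen := by rw [h₉, TokenSystem.pathLen]
  refine Prog.WP.store_seq (x := 0) (v := S.offset + S.numStates) rfl
    (congrArg₂ (· + ·) hs.offset hs.numStates) hS.numNodes <|
    Prog.WP.store_seq (x := 2) (v := S.pathLen) rfl hpathLen
      (S.pathLen_le_numNodes.trans hS.numNodes)
        ⟨(Nat.le_add_right _ _).trans hS.length_flatten_edges, ?_, rfl, h₂₀, ?_⟩
  · refine hs.congr (fun x hx => ?_) fun a ha => ?_
    · rw [State.reg_setReg, if_neg (by omega), State.reg_setArr, State.reg_setArr]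
    · rw [State.arr_setReg, State.arr_setArr, if_neg ha, State.arr_setArr, if_neg ha]
  · simp only [State.arr_setReg, State.arr_setArr, if_true, h₃]
    funext i
    rw [Function.update_apply, Function.update_apply]
    rcases i with _ | _ | _ | i <;> rfl

theorem wp_reduction (hS : (L.tokens d hd).FitsIn B)
    (hB : 2 + L.n + L.sets.length + L.sets.flatten.length ≤ B) :
    (reduction d).WP B (fun s => s.arr 3 = fun i => (L.tokens d hd).word.getD i 0)
      (State.init L.word) := by
  refine (wp_readInput (by omega) (by omega)).seq fun s h => (wp_loadTokens hS h).seq ?_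
  rintro s ⟨hs, h₉, h₂₀, h₃⟩
  refine (wp_writeHeader hS hs h₉ h₂₀ h₃).seq fun s h => ?_
  refine (TokenSystem.wp_edgesProg hS h.1 h.2).mono _ fun s' h' => ?_
  rw [h'.output, List.append_nil]
  rfl

theorem writesOnly_reduction (d : ℕ) :
    (reduction d).WritesOnly (fun x => x % 40 ≠ 0) (· < 4) := by
  simp [reduction, readInput, readSets, readSetsBody, readSet, readSetBody, loadTokens,
    writeHeader, TokenSystem.edgesProg, TokenSystem.edgesBody, TokenSystem.nextProg,
    TokenSystem.nextBody, Prog.for, Prog.WritesOnly, writesOnly_emit, writesOnly_seqAll_emit,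
    -List.map_map]

end SetList

/-! ## The running time -/

namespace SetList

open RAM

/-- The number of elements of the ground set plus the number of sets. -/
def size (L : SetList) : ℕ := L.n + L.sets.length

theorem length_le {L : SetList} {l : List ℕ} (hl : l ∈ L.sets) : l.length ≤ L.n := by
  rw [← List.toFinset_card_of_nodup (L.nodup l hl), ← Finset.card_range L.n]
  exact Finset.card_le_card fun x hx => Finset.mem_range.2 (L.lt l hl x (List.mem_toFinset.1 hx))

theorem length_flatten_le (L : SetList) : L.sets.flatten.length ≤ L.sets.length * L.n := by
  rw [List.length_flatten, ← List.length_map (f := List.length), ← smul_eq_mul]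
  exact List.sum_le_card_nsmul _ _ (List.forall_mem_map.2 fun l hl => length_le hl)

section PolyBounded

theorem polyBounded_n : PolyBounded size n :=
  (PolyBounded.self _).mono fun _ => Nat.le_add_right _ _

theorem polyBounded_length_flatten : PolyBounded size fun L => L.sets.flatten.length :=
  (((PolyBounded.self _).mono fun _ => Nat.le_add_left _ _).mul polyBounded_n).mono
    length_flatten_le

variable {d : ℕ} (hd : 0 < d)

theorem polyBounded_base : PolyBounded size fun L => (L.tokens d hd).base :=
  polyBounded_length_flatten.add (.const _ 1)

theorem polyBounded_numLayers : PolyBounded size fun L => (L.tokens d hd).numLayers :=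
  (polyBounded_n.add (.const _ 8)).mono fun _ => Nat.add_le_add_right (Nat.div_le_self _ _) 8

theorem polyBounded_numStates : PolyBounded size fun L => (L.tokens d hd).numStates :=
  (polyBounded_numLayers hd).mul ((polyBounded_base hd).pow (2 * d))

theorem polyBounded_numNodes :
    PolyBounded size fun L => (L.tokens d hd).offset + (L.tokens d hd).numStates :=
  (polyBounded_n.add (((polyBounded_numLayers hd).add (.const _ 1)).mul (.const _ d))).add
    (polyBounded_numStates hd)

theorem polyBounded_length_edges : PolyBounded size fun L => (L.tokens d hd).edges.length :=
  ((polyBounded_numStates hd).mul ((PolyBounded.const _ d).add ((polyBounded_base hd).pow d))).mono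
    fun _ => TokenSystem.length_edges_le

theorem polyBounded_size_hyperPathInstance :
    PolyBounded size fun L => (L.tokens d hd).hyperPathInstance.size :=
  (((polyBounded_numNodes hd).add (polyBounded_length_edges hd)).add
    (polyBounded_numNodes hd)).mono fun L =>
      (TokenSystem.size_hyperPathInstance _).trans_le
        (Nat.add_le_add_left (L.tokens d hd).pathLen_le_numNodes _)

/-- A bound for all numbers that occur in the reduction. -/
noncomputable def bound (L : SetList) : ℕ :=
  2 + L.size + L.sets.flatten.length + ((L.tokens d hd).offset + (L.tokens d hd).numStates) +
    (3 + (L.tokens d hd).edges.length * (d + 2)) +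
    ((L.tokens d hd).numStates + (L.tokens d hd).base ^ (2 * d)) + (L.tokens d hd).base ^ d

theorem polyBounded_bound : PolyBounded size (bound hd) :=
  (((((PolyBounded.const _ 2).add (.self _)).add polyBounded_length_flatten).add
    (polyBounded_numNodes hd)).add
    ((PolyBounded.const _ 3).add ((polyBounded_length_edges hd).mul (.const _ (d + 2))))).add
    ((polyBounded_numStates hd).add ((polyBounded_base hd).pow (2 * d))) |>.add
    ((polyBounded_base hd).pow d)

end PolyBounded

variable {d : ℕ} {hd : 0 < d} {L : SetList}

theorem input_le_bound :
    2 + L.n + L.sets.length + L.sets.flatten.length ≤ L.bound hd := by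
  rw [bound, size]
  omega

theorem fitsIn_bound : (L.tokens d hd).FitsIn (L.bound hd) := by
  have hflat : (L.tokens d hd).edges.flatten.length = (L.tokens d hd).edges.length * (d + 2) :=
    TokenSystem.length_flatten_edges
  have hle := Nat.le_mul_of_pos_right (L.tokens d hd).edges.length (show 0 < d + 2 by omega)
  constructor <;> simp only [bound, hflat, show (L.tokens d hd).d = d from rfl] <;> omega

theorem mem_word_le {v : ℕ} (hv : v ∈ L.word) : v ≤ L.n + L.sets.length := by
  simp only [word, List.cons_append, List.nil_append, List.mem_cons, List.mem_flatMap] at hv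
  rcases hv with rfl | rfl | ⟨l, hl, rfl | hv⟩
  · exact Nat.le_add_right _ _
  · exact Nat.le_add_left _ _
  · exact (length_le hl).trans (Nat.le_add_right _ _)
  · exact (L.lt l hl v hv).le.trans (Nat.le_add_right _ _)

end SetList

theorem RAM.State.boundedBy_init {B : ℕ} {w : List ℕ} (h : ∀ v ∈ w, v ≤ B) :
    (State.init w).BoundedBy B := by
  refine ⟨fun _ => Nat.zero_le _, fun a i => ?_⟩
  change (if a = 0 then w.getD i 0 else 0) ≤ B
  split_ifs
  · rcases lt_or_ge i w.length with hi | hi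
    · rw [List.getD_eq_getElem _ _ hi]
      exact h _ (List.getElem_mem hi)
    · rw [List.getD_eq_default _ _ hi]
      exact Nat.zero_le _
  · exact Nat.zero_le _

namespace SetList

open RAM

/-- The reduction leaves the registers `40 x` and the arrays `a + 4` untouched, so that after it an
algorithm for `k`-HyperPath, renamed to use the registers `40 x` and the arrays `a + 3`, finds its
initial memory. -/
theorem haltsWithin_reduction {d : ℕ} (hd : 0 < d) (L : SetList) :
    (reduction d).HaltsWithin ((reduction d).timeBound (L.bound hd))
      (fun s => s.restrict (40 * ·) (· + 3) = State.init (L.tokens d hd).word)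
      (State.init L.word) := by
  have hB := L.input_le_bound (hd := hd)
  obtain ⟨s, t, hE, ⟨-, hout⟩, ht⟩ := Prog.WP.haltsWithin _
    (State.boundedBy_init fun v hv => (mem_word_le hv).trans (by omega))
    (wp_reduction fitsIn_bound hB)
  obtain ⟨hreg, harr⟩ := hE.frame (writesOnly_reduction d)
  refine ⟨s, t, hE, ?_, ht⟩
  simp only [State.restrict, State.init, State.mk.injEq]
  constructor
  · funext x
    exact hreg (40 * x) (not_not.2 (Nat.mul_mod_right 40 x))
  · funext a i
    split_ifs with ha
    · rw [ha]
      exact congrFun hout i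
    · rw [harr (a + 3) (by omega)]
      rfl

theorem word_ofFin {n : ℕ} {L : List (List (Fin n))} (h : ∀ l ∈ L, l.Nodup) :
    (ofFin L h).word = [n, L.length] ++ (L.map fun l => l.length :: l.map Fin.val).flatten := by
  rw [word, ofFin, List.length_map, List.flatMap_map, List.flatMap_def]
  simp only [List.length_map]

theorem size_ofFin {I : ExactCoverInstance} {L : List (List (Fin I.n))} (h : ∀ l ∈ L, l.Nodup)
    (hL : (L.map List.toFinset).Nodup) (hfam : (L.map List.toFinset).toFinset = I.family) :
    (ofFin L h).size = I.size := by
  rw [size, ExactCoverInstance.size, ← hfam, List.toFinset_card_of_nodup hL, ofFin,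
    List.length_map, List.length_map]

end SetList

namespace TokenSystem

variable (S : TokenSystem)

theorem n_le_pathLen : S.n ≤ S.pathLen := by
  have hlt : S.n < S.n / S.d * S.d + S.d := Nat.lt_div_mul_add S.d_pos
  rw [pathLen_eq]
  nlinarith [Nat.zero_le (S.n / S.d)]

theorem mul_pathLen_le : (1 - 1 / ((S.d : ℝ) + 1)) * S.pathLen ≤ S.n + 9 * S.d := by
  have hdiv : S.n / S.d * S.d ≤ S.n := Nat.div_mul_le_self _ _
  have hle : S.d * S.pathLen ≤ (S.n + 9 * S.d) * (S.d + 1) := by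
    rw [pathLen_eq]
    nlinarith
  have hcast : (S.d : ℝ) * S.pathLen ≤ (S.n + 9 * S.d) * (S.d + 1) := by exact_mod_cast hle
  rwa [one_sub_div (by positivity), add_sub_cancel_right, div_mul_eq_mul_div,
    div_le_iff₀ (by positivity)]

theorem two_rpow_mul_pathLen_le {γ δ : ℝ} (hγ : 0 ≤ γ) (hδγ : δ ≤ γ) :
    (2 : ℝ) ^ ((1 - 1 / ((S.d : ℝ) + 1) - γ) * S.pathLen) ≤
      2 ^ (9 * S.d) * 2 ^ ((1 - δ) * (S.n : ℝ)) := by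
  have hlen : (S.n : ℝ) ≤ S.pathLen := by exact_mod_cast S.n_le_pathLen
  have hsaving : δ * S.n ≤ γ * S.pathLen := mul_le_mul hδγ hlen (Nat.cast_nonneg _) hγ
  have hexp : (1 - 1 / ((S.d : ℝ) + 1) - γ) * S.pathLen ≤
      ((9 * S.d : ℕ) : ℝ) + (1 - δ) * S.n := by
    have := S.mul_pathLen_le
    push_cast
    linarith
  rw [← Real.rpow_natCast, ← Real.rpow_add two_pos]
  exact Real.rpow_le_rpow_of_exponent_le one_le_two hexp

end TokenSystem

theorem add_time_le {K₁ K₂ C D c₁ c₂ : ℕ} {x y P t₁ t₂ : ℝ} (hP : 1 ≤ P) (hx : 0 ≤ x)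
    (h₁ : t₁ ≤ K₁ * (x + 1) ^ c₁) (hy : y ≤ K₂ * (x + 1) ^ c₂) (h₂ : t₂ ≤ C * y * (2 ^ D * P)) :
    t₁ + t₂ ≤ ((K₁ + C * K₂ * 2 ^ D : ℕ) : ℝ) * (x + 1) ^ (c₁ + c₂) * P := by
  have hpow₁ : (x + 1) ^ c₁ ≤ (x + 1) ^ (c₁ + c₂) := pow_le_pow_right₀ (by linarith) (by omega)
  have hpow₂ : (x + 1) ^ c₂ ≤ (x + 1) ^ (c₁ + c₂) := pow_le_pow_right₀ (by linarith) (by omega)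
  have ht₁ : t₁ ≤ K₁ * (x + 1) ^ (c₁ + c₂) * P :=
    calc t₁ ≤ K₁ * (x + 1) ^ c₁ := h₁
      _ ≤ K₁ * (x + 1) ^ (c₁ + c₂) := by gcongr
      _ ≤ _ := le_mul_of_one_le_right (by positivity) hP
  have ht₂ : t₂ ≤ C * (K₂ * (x + 1) ^ (c₁ + c₂)) * (2 ^ D * P) :=
    h₂.trans (by
      gcongr
      exact hy.trans (by gcongr))
  push_cast
  calc t₁ + t₂ ≤ _ := add_le_add ht₁ ht₂
    _ = _ := by ring

theorem exactCoverSolvable_of_hyperPathSolvable {d : ℕ} (hd : 0 < d) {γ δ : ℝ} (hγ : 0 ≤ γ)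
    (hδγ : δ ≤ γ) (hδ : δ ≤ 1)
    (h : HyperPathSolvable (d + 2) (1 - 1 / ((d : ℝ) + 1) - γ)) : ExactCoverSolvable (1 - δ) := by
  obtain ⟨p, C, c, hp⟩ := h
  obtain ⟨K₁, c₁, h₁⟩ :=
    (SetList.reduction d).polyBounded_timeBound.comp (SetList.polyBounded_bound hd)
  obtain ⟨K₂, c₂, h₂⟩ :=
    ((SetList.polyBounded_size_hyperPathInstance hd).add (.const _ 1)).pow c
  refine ⟨.seq (SetList.reduction d) (p.rename (40 * ·) (· + 3)),
    K₁ + C * K₂ * 2 ^ (9 * d), c₁ + c₂, ?_⟩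
  rintro I _ ⟨l, hl, hinj, hfam, rfl⟩
  let L := SetList.ofFin l hl
  let S := L.tokens d hd
  obtain ⟨s₁, t₁, E₁, hs₁, ht₁⟩ := L.haltsWithin_reduction hd
  obtain ⟨s₂, t₂, E₂, hans, ht₂⟩ := hp _ _ S.enc_word_hyperPathInstance
  obtain ⟨s₃, E₃, hs₃⟩ := E₂.rename (ρ := (40 * ·)) (σ := (· + 3))
    (mul_right_injective₀ (by decide)) (add_left_injective 3) s₁ hs₁
  refine ⟨s₃, t₁ + t₂, SetList.word_ofFin hl ▸ .seq E₁ E₃, ?_, ?_⟩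
  · have hreg : s₃.reg 0 = s₂.reg 0 := congrFun (congrArg RAM.State.reg hs₃) 0
    rw [SetList.yes_iff_hasExactCover hl hinj hfam, hreg]
    exact hans.trans SetList.yes_iff
  · rw [← SetList.size_ofFin hl hinj hfam, Nat.cast_add]
    refine add_time_le (D := 9 * d)
      (Real.one_le_rpow one_le_two (mul_nonneg (sub_nonneg.2 hδ) (Nat.cast_nonneg _)))
      (Nat.cast_nonneg _) ?_ ?_
      (ht₂.trans (mul_le_mul_of_nonneg_left (S.two_rpow_mul_pathLen_le hγ hδγ) (by positivity)))
    · exact_mod_cast ht₁.trans (h₁ L)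
    · exact_mod_cast h₂ L

theorem lemma3 (γ : ℝ) (hγ : 0 < γ) :
    ∃ δ : ℝ, 0 < δ ∧ ∀ r : ℕ, 3 ≤ r →
      HyperPathSolvable r (1 - 1 / ((r : ℝ) - 1) - γ) → ExactCoverSolvable (1 - δ) := by
  refine ⟨min γ 1, lt_min hγ one_pos, fun r hr h => ?_⟩
  obtain ⟨d, rfl⟩ : ∃ d, r = d + 2 := ⟨r - 2, by omega⟩
  rw [show ((d + 2 : ℕ) : ℝ) - 1 = d + 1 by push_cast; ring] at h
  exact exactCoverSolvable_of_hyperPathSolvable (by omega) hγ.le (min_le_left _ _)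
    (min_le_right _ _) h
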